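/- All graphs are finite, simple and undirected. A set $S\subseteq V$ of vertices of a graph $G=(V,E)$ is a twin-cover of $G$ if $G-S$ is a disjoint union of complete graphs and any two vertices $u,v$ in the same connected component of $G-S$ satisfy $N(u)\cap S=N(v)\cap S$; the twin-cover number $tc(G)$ is the minimum cardinality of a twin-cover of $G$. In the problem Triangle Partition, the input is a pair $(G,k)$ of a graph $G$ and a natural number $k$, and the question is whether $G$ contains exactly $k/3$ pairwise vertex-disjoint triangles whose union includes every vertex of $G$ (the answer is no if $3\nmid k$). The parameter of the input $(G,k)$ is $tc(G)$. Theorem. Triangle Partition parameterized by the twin-cover number has a polynomial kernel. That is, there are a polynomial $p$ and a deterministic polynomial-time algorithm (time measured in the length of an encoding of $(G,k)$ with $G$ given by its adjacency matrix and $k$ in binary) that maps every input $(G,k)$ to an input $(G',k')$, which it outputs together with its parameter $tc(G')$, such that $(G,k)$ is a yes-instance if and only if $(G',k')$ is a yes-instance, and the size of the output (the encoding length of $(G',k')$ plus $tc(G')$) is at most $p(tc(G))$. The algorithm is given neither $tc(G)$ nor a twin-cover of $G$. -/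

import Mathlib

/-! ### Graphs, twin-covers and triangle partitions -/

/-- A cluster: a disjoint union of complete graphs, that is, every connected component is
complete. -/
def IsCluster {V : Type*} (G : SimpleGraph V) : Prop :=
  ∀ u v, G.Reachable u v → u ≠ v → G.Adj u v

/-- `S` is a twin-cover of `G`: the graph `G - S` is a cluster, and any two vertices in the same
connected component of `G - S` have the same neighbours in `S`. -/
def IsTwinCover {V : Type*} (G : SimpleGraph V) (S : Set V) : Prop :=
  IsCluster (G.induce Sᶜ) ∧
    ∀ u v : (Sᶜ : Set V), (G.induce Sᶜ).Reachable u v →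
      G.neighborSet u ∩ S = G.neighborSet v ∩ S

/-- The set of all vertices is a twin-cover, so `twinCoverNumber` is a genuine minimum. -/
theorem isTwinCover_univ {V : Type*} (G : SimpleGraph V) : IsTwinCover G Set.univ :=
  ⟨fun u => absurd (Set.mem_univ _) u.2, fun u => absurd (Set.mem_univ _) u.2⟩

/-- The twin-cover number `tc(G)`: the smallest cardinality of a twin-cover of `G`. -/
noncomputable def twinCoverNumber {V : Type*} (G : SimpleGraph V) : ℕ :=
  sInf {m : ℕ | ∃ S : Finset V, S.card = m ∧ IsTwinCover G (S : Set V)}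

theorem exists_twinCover_card_eq {V : Type*} [Fintype V] (G : SimpleGraph V) :
    ∃ S : Finset V, S.card = twinCoverNumber G ∧ IsTwinCover G (S : Set V) :=
  Nat.sInf_mem (s := {m : ℕ | ∃ S : Finset V, S.card = m ∧ IsTwinCover G (S : Set V)})
    ⟨_, Finset.univ, rfl, by simpa using isTwinCover_univ G⟩

/-- `G` contains `k / 3` (exact division) vertex disjoint triangles whose union includes every
vertex of `G`. -/
def HasTrianglePartition {V : Type*} (G : SimpleGraph V) (k : ℕ) : Prop :=
  ∃ T : Finset (Finset V),
    (∀ t ∈ T, G.IsNClique 3 t) ∧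
    (T : Set (Finset V)).PairwiseDisjoint id ∧
    3 * T.card = k ∧
    ∀ v, ∃ t ∈ T, v ∈ t

/-! ### Parameterized problems and polynomial kernels -/

/-- A parameterized decision problem whose parameter is determined by the input: a type of inputs,
an injective encoding of them as words over a finite alphabet, the set of yes-inputs, and the
parameter. Its instances are the pairs `(x, param x)`. -/
structure ParameterizedProblem where
  Input : Type
  Alphabet : Type
  [alphabetFintype : Fintype Alphabet]
  encode : Input → List Alphabet
  encode_injective : Function.Injective encode
  Yes : Input → Prop
  param : Input → ℕ

namespace ParameterizedProblem

/-- The word that encodes the instance `(x, param x)`: the word of `x` followed by the parameter in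
unary. Its length `|x| + param x` is the size of the instance. -/
def encodeInstance (Q : ParameterizedProblem) (x : Q.Input) : List (Option Q.Alphabet) :=
  (Q.encode x).map some ++ List.replicate (Q.param x) none

/-- `Q` admits a polynomial kernel: some polynomial-time algorithm maps every instance
`(x, param x)` to an instance `(x', param x')` with the same answer, whose size is bounded by a
polynomial in `param x`. The algorithm only reads `x`: the value of the parameter need not be
supplied. It writes both `x'` and `param x'`. Algorithms are Turing machines with finitely many
stacks, and time is the number of machine steps. -/
def HasPolynomialKernel (Q : ParameterizedProblem) : Prop :=
  ∃ (K : Q.Input → Q.Input) (p : Polynomial ℕ),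
    Nonempty (Turing.TM2ComputableInPolyTime Q.encode Q.encodeInstance K) ∧
    ∀ x : Q.Input,
      (Q.Yes x ↔ Q.Yes (K x)) ∧
      (Q.encodeInstance (K x)).length ≤ p.eval (Q.param x)

end ParameterizedProblem

/-! ### Triangle Partition parameterized by twin-cover number -/

/-- An input `(G, k)`: a finite simple graph `G` with vertex set `{0, …, n - 1}`, and a number
`k`. -/
structure GraphInput where
  n : ℕ
  G : SimpleGraph (Fin n)
  k : ℕ

namespace GraphInput

open scoped Classical in
/-- Row `i` of the adjacency matrix of `G` in bits, closed by the separator `none`. -/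
noncomputable def encodeRow {n : ℕ} (G : SimpleGraph (Fin n)) (i : Fin n) : List (Option Bool) :=
  (List.finRange n).map (fun j => some (decide (G.Adj i j))) ++ [none]

/-- The rows of the adjacency matrix, each closed by a separator, then `k` in binary. -/
noncomputable def encode (x : GraphInput) : List (Option Bool) :=
  (List.finRange x.n).flatMap (encodeRow x.G) ++ (Computability.encodeNat x.k).map some

theorem count_encode (x : GraphInput) : (encode x).count none = x.n := by
  have h : ∀ (b : List Bool), (b.map some).count none = 0 := fun b =>
    List.count_eq_zero.2 (by simp)
  have hr : ∀ i, (encodeRow x.G i).count none = 1 := fun i => by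
    have : ((List.finRange x.n).map
        (fun j => some (@decide (x.G.Adj i j) (Classical.propDecidable _)))).count none = 0 :=
      List.count_eq_zero.2 (by simp)
    simp [encodeRow, List.count_append, this]
  simp [encode, List.count_append, h, List.count_flatMap, hr, Function.comp_def]

theorem eq_of_flatMap_eq {α β : Type*} (f g : α → List β)
    (hl : ∀ a, (f a).length = (g a).length) :
    ∀ l : List α, l.flatMap f = l.flatMap g → ∀ a ∈ l, f a = g a
  | [], _ => by simp
  | b :: l, h => by
    rw [List.flatMap_cons, List.flatMap_cons] at h
    obtain ⟨h1, h2⟩ := List.append_inj h (hl b)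
    intro a ha
    rcases List.mem_cons.1 ha with rfl | ha
    · exact h1
    · exact eq_of_flatMap_eq f g hl l h2 a ha

theorem encode_injective : Function.Injective encode := by
  rintro ⟨n, G, k⟩ ⟨n', G', k'⟩ h
  have hn : n = n' := by simpa only [count_encode] using congrArg (List.count none) h
  subst hn
  have hl : ∀ i, (encodeRow G i).length = (encodeRow G' i).length := by simp [encodeRow]
  obtain ⟨h1, h2⟩ := List.append_inj h (by simp [List.length_flatMap, hl])
  have hk : k = k' := by
    have h3 := (List.map_injective_iff.2 (Option.some_injective _)) h2
    simpa only [Computability.decode_encodeNat] using congrArg Computability.decodeNat h3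
  subst hk
  have hG : G = G' := by
    ext i j
    have h4 := eq_of_flatMap_eq _ _ hl _ h1 i (List.mem_finRange i)
    have h5 := (List.append_inj h4 (by simp)).1
    have h6 := List.map_inj_left.1 h5 j (List.mem_finRange j)
    simpa using h6
  rw [hG]

end GraphInput

/-- Triangle Partition parameterized by the twin-cover number of the input graph. -/
noncomputable def trianglePartitionTC : ParameterizedProblem where
  Input := GraphInput
  Alphabet := Option Bool
  encode := GraphInput.encode
  encode_injective := GraphInput.encode_injective
  Yes x := HasTrianglePartition x.G x.k
  param x := twinCoverNumber x.G

/-! Call two adjacent vertices nontwins if some third vertex is adjacent to exactly one of them.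
Every twin-cover is a vertex cover of the graph of nontwin pairs (`nontwin_mem_of_isTwinCover`).
Buss's high-degree argument then yields, without knowledge of a twin-cover, a set `S` of at most
`tc² + tc` vertices that meets every nontwin pair (`good_card`, `card_cover_le`). Outside `S` the
graph falls into classes: cliques of twins with a common neighbourhood in `S`.

A triangle partition consists of triangles that meet `S` and triangles inside classes. There are at
most `|S|` of the former, they use at most `2|S|` vertices outside `S`, and such a `Packing` extends
to a partition exactly if what it leaves of every class has size divisible by three. This allows two
reductions. In a large class a multiple of three vertices can be dropped, because the vertices of a
class are interchangeable. For every choice of at most six vertices of `S`, every residue of the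
class size modulo three and both answers to whether the size is below six, only the first `2|S| + 6`
classes that see the chosen vertices are marked, and unmarked classes disappear. The exchange
argument is `Removable.exists_packing_card_lt`: if a packing uses an unmarked class, then at most
three of its triangles use three or six vertices of that class altogether, and these can be moved to
a marked class of the same type that the packing avoids; the class sizes left over keep their
residues. A packing with the fewest removed vertices therefore uses none (`Removable.tiles_iff`).
The number of vertices that remain is polynomial in `|S|` (`card_compl_removed_le`).

The parameter of the output has to be written as well, so a graph with evident twin-cover number is
needed. The `gadget` hangs two triangles on every vertex `u`, each of which forms a clique of size
four with `u`. This does not affect the existence of a triangle partition (`tiles_gadget_iff`), and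
the twin-cover number becomes the number of original vertices (`twinCoverNumber_gadget`).

For the running time, the rule that selects vertices is a fixed expression built from arithmetic,
bounded sums and queries to the input. Values of such expressions are polynomially bounded, so they
can be held in unary on a stack, and each fixed expression compiles to a stack machine that runs in
polynomial time (`Expr.compile_spec`, `Writer.computableInPolyTime`). It remains to write the kernel
as such a program (`Writer.word_kernel`). -/

/-! ### A structured stack language and its translation to Turing machines with stacks -/

namespace StackLang

open Function

/-- The alphabet of the input and of the work stacks. -/
abbrev Sym := Option Bool

/-- The stacks other than the output stack. -/
inductive Reg
  | inp | dat | aux | aux2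
  deriving DecidableEq

instance : Fintype Reg := ⟨{.inp, .dat, .aux, .aux2}, fun r => by cases r <;> simp⟩

/-- The alphabet of each stack; the stack `none` is the output stack. -/
abbrev Alph (B : Type) : Option Reg → Type
  | none => B
  | some _ => Sym

/-- Structured programs over the stacks, with a variable that holds the symbol popped last. -/
inductive Cmd (B : Type) : Type
  | skip : Cmd B
  | push : Reg → Sym → Cmd B
  | pop : Reg → Cmd B
  | put : Reg → Cmd B
  | emit : B → Cmd B
  | seq : Cmd B → Cmd B → Cmd B
  | ite : (Option Sym → Bool) → Cmd B → Cmd B → Cmd B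
  | loop : (Option Sym → Bool) → Cmd B → Cmd B

/-- A store: the symbol popped last and the contents of the stacks. -/
structure Store (B : Type) where
  v : Option Sym
  reg : Reg → List Sym
  out : List B

/-- Big-step semantics with the exact number of machine steps. -/
inductive Run {B : Type} : Cmd B → Store B → Store B → ℕ → Prop
  | skip (s) : Run .skip s s 1
  | push (k a v r o) : Run (.push k a) ⟨v, r, o⟩ ⟨v, update r k (a :: r k), o⟩ 1
  | pop (k v r o) : Run (.pop k) ⟨v, r, o⟩ ⟨(r k).head?, update r k (r k).tail, o⟩ 1
  | put (k a r o) : Run (.put k) ⟨some a, r, o⟩ ⟨some a, update r k (a :: r k), o⟩ 1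
  | emit (b v r o) : Run (.emit b) ⟨v, r, o⟩ ⟨v, r, b :: o⟩ 1
  | seq {a b s₀ s₁ s₂ t₁ t₂} : Run a s₀ s₁ t₁ → Run b s₁ s₂ t₂ → Run (.seq a b) s₀ s₂ (t₁ + t₂)
  | iteTrue {p : Option Sym → Bool} {a b s₀ s₁ t} :
      p s₀.v = true → Run a s₀ s₁ t → Run (.ite p a b) s₀ s₁ (1 + t)
  | iteFalse {p : Option Sym → Bool} {a b s₀ s₁ t} :
      p s₀.v = false → Run b s₀ s₁ t → Run (.ite p a b) s₀ s₁ (1 + t)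
  | loopFalse {p : Option Sym → Bool} {c s} : p s.v = false → Run (.loop p c) s s 1
  | loopTrue {p : Option Sym → Bool} {c s₀ s₁ s₂ t₁ t₂} :
      p s₀.v = true → Run c s₀ s₁ t₁ → Run (.loop p c) s₁ s₂ t₂ →
      Run (.loop p c) s₀ s₂ (1 + t₁ + t₂)

namespace Cmd

variable {B : Type}

/-- The machine labels that a program uses. -/
def Label : Cmd B → Type
  | skip | push _ _ | pop _ | put _ | emit _ => Unit
  | seq a b => a.Label ⊕ b.Label
  | ite _ a b => Option (a.Label ⊕ b.Label)
  | loop _ c => Option c.Label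

/-- The label at which a program starts. -/
def entry : (c : Cmd B) → c.Label
  | skip | push _ _ | pop _ | put _ | emit _ => ()
  | seq a _ => Sum.inl a.entry
  | ite _ _ _ => none
  | loop _ _ => none

/-- There are finitely many labels. -/
@[reducible]
def labelFintype : (c : Cmd B) → Fintype c.Label
  | skip | push _ _ | pop _ | put _ | emit _ => inferInstanceAs (Fintype Unit)
  | seq a b =>
    letI := a.labelFintype; letI := b.labelFintype; inferInstanceAs (Fintype (a.Label ⊕ b.Label))
  | ite _ a b =>
    letI := a.labelFintype; letI := b.labelFintype
    inferInstanceAs (Fintype (Option (a.Label ⊕ b.Label)))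
  | loop _ c => letI := c.labelFintype; inferInstanceAs (Fintype (Option c.Label))

/-- The machine code of a program whose labels are embedded by `emb`; control leaves to `exit`. -/
def code {Λ : Type} : (c : Cmd B) → (c.Label → Λ) → Λ → c.Label →
    Turing.TM2.Stmt (Alph B) Λ (Option Sym)
  | skip, _, exit, _ => .goto fun _ => exit
  | push k a, _, exit, _ => .push (some k) (fun _ => (a : Sym)) (.goto fun _ => exit)
  | pop k, _, exit, _ => .pop (some k) (fun _ (a : Option Sym) => a) (.goto fun _ => exit)
  -- The default is immaterial: `Run.put` covers only stores whose variable holds a symbol.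
  | put k, _, exit, _ => .push (some k) (fun v => (v.getD none : Sym)) (.goto fun _ => exit)
  | emit b, _, exit, _ => .push none (fun _ => b) (.goto fun _ => exit)
  | seq a b, emb, _, .inl l => a.code (emb ∘ Sum.inl) (emb (.inr b.entry)) l
  | seq _ b, emb, exit, .inr l => b.code (emb ∘ Sum.inr) exit l
  | ite p a b, emb, _, none =>
    .goto fun v => bif p v then emb (some (.inl a.entry)) else emb (some (.inr b.entry))
  | ite _ a _, emb, exit, some (.inl l) => a.code (emb ∘ some ∘ Sum.inl) exit l
  | ite _ _ b, emb, exit, some (.inr l) => b.code (emb ∘ some ∘ Sum.inr) exit l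
  | loop p c, emb, exit, none => .goto fun v => bif p v then emb (some c.entry) else exit
  | loop _ c, emb, _, some l => c.code (emb ∘ some) (emb none) l

end Cmd

variable {B : Type}

/-- The stacks of a store, indexed as the machine indexes them. -/
def Store.stk (s : Store B) : ∀ k, List (Alph B k)
  | none => s.out
  | some k => s.reg k

/-- The machine configuration at a label. -/
def Store.cfg {Λ : Type} (l : Λ) (s : Store B) : Turing.TM2.Cfg (Alph B) Λ (Option Sym) :=
  ⟨some l, s.v, s.stk⟩

theorem Store.update_stk_some (v : Option Sym) (r : Reg → List Sym) (o : List B) (k : Reg)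
    (x : List (Alph B (some k))) :
    update (Store.stk ⟨v, r, o⟩) (some k) x = Store.stk ⟨v, update r k x, o⟩ := by
  funext j
  rcases j with _ | j
  · exact update_of_ne (by simp) _ _
  · by_cases h : j = k
    · subst h
      exact (update_self _ _ _).trans (update_self (β := fun _ => List Sym) j x r).symm
    · exact (update_of_ne (by simpa using h) _ _).trans
        (update_of_ne (β := fun _ => List Sym) h x r).symm

theorem Store.update_stk_none (v : Option Sym) (r : Reg → List Sym) (o : List B)
    (x : List (Alph B none)) :
    update (Store.stk ⟨v, r, o⟩) none x = Store.stk ⟨v, r, x⟩ := by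
  funext j
  rcases j with _ | j
  · exact update_self _ _ _
  · exact update_of_ne (by simp) _ _

/-- Runs of a program are runs of its machine code. -/
theorem Run.steps {Λ : Type} {M : Λ → Turing.TM2.Stmt (Alph B) Λ (Option Sym)} {c : Cmd B}
    {s s' : Store B} {t : ℕ} (h : Run c s s' t) :
    ∀ (emb : c.Label → Λ) (exit : Λ), (∀ l, M (emb l) = c.code emb exit l) →
      (flip bind (Turing.TM2.step M))^[t] (some (s.cfg (emb c.entry))) = some (s'.cfg exit) := by
  have step1 (l : Λ) (s : Store B) (x : Turing.TM2.Cfg (Alph B) Λ (Option Sym))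
      (hx : Turing.TM2.stepAux (M l) s.v s.stk = x) :
      (flip bind (Turing.TM2.step M))^[1] (some (s.cfg l)) = some x := congrArg some hx
  induction h with
  | skip s =>
    intro emb exit hM
    exact step1 _ _ _ (by rw [hM]; rfl)
  | push k a v r o =>
    intro emb exit hM
    refine step1 _ _ _ ?_
    rw [hM, Store.cfg, ← Store.update_stk_some v]
    rfl
  | pop k v r o =>
    intro emb exit hM
    refine step1 _ _ _ ?_
    rw [hM, Store.cfg, ← Store.update_stk_some (r k).head?]
    rfl
  | put k a r o =>
    intro emb exit hM
    refine step1 _ _ _ ?_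
    rw [hM, Store.cfg, ← Store.update_stk_some (some a)]
    rfl
  | emit b v r o =>
    intro emb exit hM
    refine step1 _ _ _ ?_
    rw [hM, Store.cfg, ← Store.update_stk_none v r o (b :: o)]
    rfl
  | @seq a b s₀ s₁ s₂ t₁ t₂ _ _ iha ihb =>
    intro emb exit hM
    rw [Nat.add_comm, iterate_add_apply,
      show emb (Cmd.seq a b).entry = (emb ∘ Sum.inl) a.entry from rfl,
      iha (emb ∘ Sum.inl) (emb (.inr b.entry)) fun l => hM (.inl l)]
    exact ihb (emb ∘ Sum.inr) exit fun l => hM (.inr l)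
  | @iteTrue p a b s₀ s₁ t hp _ ih =>
    intro emb exit hM
    rw [Nat.add_comm, iterate_add_apply, step1 _ s₀ (s₀.cfg (emb (some (.inl a.entry))))]
    · exact ih (emb ∘ some ∘ Sum.inl) exit fun l => hM _
    · rw [hM]
      simp [Cmd.entry, Cmd.code, hp, Store.cfg]
  | @iteFalse p a b s₀ s₁ t hp _ ih =>
    intro emb exit hM
    rw [Nat.add_comm, iterate_add_apply, step1 _ s₀ (s₀.cfg (emb (some (.inr b.entry))))]
    · exact ih (emb ∘ some ∘ Sum.inr) exit fun l => hM _
    · rw [hM]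
      simp [Cmd.entry, Cmd.code, hp, Store.cfg]
  | @loopFalse p c s hp =>
    intro emb exit hM
    refine step1 _ _ _ ?_
    rw [hM]
    simp [Cmd.entry, Cmd.code, hp, Store.cfg]
  | @loopTrue p c s₀ s₁ s₂ t₁ t₂ hp _ _ ih₁ ih₂ =>
    intro emb exit hM
    rw [Nat.add_comm, iterate_add_apply, Nat.add_comm 1, iterate_add_apply,
      step1 _ s₀ (s₀.cfg (emb (some c.entry)))]
    · have := ih₁ (emb ∘ some) (emb none) fun l => hM _
      exact (congrArg _ this).trans (ih₂ emb exit hM)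
    · rw [hM]
      simp [Cmd.entry, Cmd.code, hp, Store.cfg]

/-- The machine of a program: it runs the program, resets the variable and halts. -/
def Cmd.machine (c : Cmd B) : Turing.FinTM2 where
  K := Option Reg
  k₀ := some .inp
  k₁ := none
  Γ := Alph B
  Λ := Option c.Label
  main := some c.entry
  ΛFin := letI := c.labelFintype; inferInstanceAs (Fintype (Option c.Label))
  σ := Option Sym
  initialState := none
  Γk₀Fin := inferInstanceAs (Fintype Sym)
  m
    -- A halting configuration in the sense of `haltList` has the initial internal state.
    | none => .load (fun _ => none) .halt
    | some l => c.code some none l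

/-- The stacks at the start and at the end of a computation. -/
def onlyInp (w : List Sym) : Reg → List Sym
  | .inp => w
  | _ => []

/-- A program that turns `ea a` into `eb (f a)` in polynomial time makes `f` computable in
polynomial time. -/
theorem computableInPolyTime_of_run {α β : Type} (ea : α → List Sym) (eb : β → List B) (f : α → β)
    (c : Cmd B) (p : Polynomial ℕ)
    (h : ∀ a, ∃ v t, t ≤ p.eval (ea a).length ∧
      Run c ⟨none, onlyInp (ea a), []⟩ ⟨v, onlyInp [], eb (f a)⟩ t) :
    Nonempty (Turing.TM2ComputableInPolyTime ea eb f) := by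
  choose v t ht hrun using h
  refine ⟨{ tm := c.machine, inputAlphabet := Equiv.refl Sym, outputAlphabet := Equiv.refl B,
            time := p + 1, outputsFun := fun a => ?_ }⟩
  -- The additional step executes the halting label; it accounts for the `+ 1` in the time bound.
  refine ⟨⟨1 + t a, ?_⟩, ?_⟩
  · rw [iterate_add_apply]
    have h1 := (hrun a).steps (M := c.machine.m) some none fun l => rfl
    have h2 : Turing.initList c.machine (List.map (Equiv.refl Sym).invFun (ea a)) =
        Store.cfg (some c.entry) ⟨none, onlyInp (ea a), ([] : List B)⟩ := by
      unfold Turing.initList Store.cfg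
      congr 1
      funext k
      rcases k with _ | _ | _ | _ | _
      · rfl
      · exact List.map_id _
      all_goals rfl
    have h3 : Turing.haltList c.machine (List.map (Equiv.refl B).invFun (eb (f a))) =
        (⟨none, none, Store.stk ⟨v a, onlyInp [], eb (f a)⟩⟩ :
          Turing.TM2.Cfg (Alph B) (Option c.Label) (Option Sym)) := by
      unfold Turing.haltList
      congr 1
      funext k
      rcases k with _ | _ | _ | _ | _
      · exact List.map_id _
      all_goals rfl
    rw [h2, Option.map_some, h3]
    exact (congrArg _ h1).trans rfl
  · have := ht a
    simp only [Polynomial.eval_add, Polynomial.eval_one]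
    omega

end StackLang


/-! ### Arithmetic on stacks of unary numbers -/

namespace StackLang

open Function

variable {B : Type}

/-- The program `c` leads from `s` to `s'` within `T` steps. -/
def Cmd.Within (c : Cmd B) (s s' : Store B) (T : ℕ) : Prop := ∃ t ≤ T, Run c s s' t

theorem Run.within {c : Cmd B} {s s' : Store B} {t : ℕ} (h : Run c s s' t) : c.Within s s' t :=
  ⟨t, le_rfl, h⟩

namespace Cmd.Within

theorem mono {c : Cmd B} {s s' : Store B} {T T' : ℕ} (h : c.Within s s' T) (hT : T ≤ T') :
    c.Within s s' T' := by
  obtain ⟨t, ht, hr⟩ := h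
  exact ⟨t, ht.trans hT, hr⟩

theorem seq {a b : Cmd B} {s₀ s₁ s₂ : Store B} {T₁ T₂ : ℕ} (h₁ : a.Within s₀ s₁ T₁)
    (h₂ : b.Within s₁ s₂ T₂) : (Cmd.seq a b).Within s₀ s₂ (T₁ + T₂) := by
  obtain ⟨t₁, ht₁, hr₁⟩ := h₁
  obtain ⟨t₂, ht₂, hr₂⟩ := h₂
  exact ⟨_, add_le_add ht₁ ht₂, .seq hr₁ hr₂⟩

theorem iteTrue {p : Option Sym → Bool} {a b : Cmd B} {s₀ s₁ : Store B} {T : ℕ}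
    (hp : p s₀.v = true) (h : a.Within s₀ s₁ T) : (Cmd.ite p a b).Within s₀ s₁ (1 + T) := by
  obtain ⟨t, ht, hr⟩ := h
  exact ⟨_, by omega, .iteTrue hp hr⟩

theorem iteFalse {p : Option Sym → Bool} {a b : Cmd B} {s₀ s₁ : Store B} {T : ℕ}
    (hp : p s₀.v = false) (h : b.Within s₀ s₁ T) : (Cmd.ite p a b).Within s₀ s₁ (1 + T) := by
  obtain ⟨t, ht, hr⟩ := h
  exact ⟨_, by omega, .iteFalse hp hr⟩

theorem loopTrue {p : Option Sym → Bool} {c : Cmd B} {s₀ s₁ s₂ : Store B} {T₁ T₂ : ℕ}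
    (hp : p s₀.v = true) (h₁ : c.Within s₀ s₁ T₁) (h₂ : (Cmd.loop p c).Within s₁ s₂ T₂) :
    (Cmd.loop p c).Within s₀ s₂ (1 + T₁ + T₂) := by
  obtain ⟨t₁, ht₁, hr₁⟩ := h₁
  obtain ⟨t₂, ht₂, hr₂⟩ := h₂
  exact ⟨_, by omega, .loopTrue hp hr₁ hr₂⟩

theorem loopFalse {p : Option Sym → Bool} {c : Cmd B} {s : Store B} (hp : p s.v = false) :
    (Cmd.loop p c).Within s s 1 := (Run.loopFalse hp).within

end Cmd.Within

/-- The stacks, listed. -/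
def regs (i d a b : List Sym) : Reg → List Sym
  | .inp => i
  | .dat => d
  | .aux => a
  | .aux2 => b

section
variable (i d a b x : List Sym)

@[simp] theorem regs_inp : regs i d a b .inp = i := rfl
@[simp] theorem regs_dat : regs i d a b .dat = d := rfl
@[simp] theorem regs_aux : regs i d a b .aux = a := rfl
@[simp] theorem regs_aux2 : regs i d a b .aux2 = b := rfl

@[simp] theorem update_regs_inp : update (regs i d a b) .inp x = regs x d a b := by
  funext k; cases k <;> simp [update]

@[simp] theorem update_regs_dat : update (regs i d a b) .dat x = regs i x a b := by
  funext k; cases k <;> simp [update]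

@[simp] theorem update_regs_aux : update (regs i d a b) .aux x = regs i d x b := by
  funext k; cases k <;> simp [update]

@[simp] theorem update_regs_aux2 : update (regs i d a b) .aux2 x = regs i d a x := by
  funext k; cases k <;> simp [update]

end

/-- The program `c` transforms the stacks and the output within `T` steps, whatever the symbol
popped last. -/
def Cmd.Transforms (c : Cmd B) (r : Reg → List Sym) (o : List B) (r' : Reg → List Sym)
    (o' : List B) (T : ℕ) : Prop :=
  ∀ v, ∃ v', c.Within ⟨v, r, o⟩ ⟨v', r', o'⟩ T

namespace Cmd.Transforms

theorem mono {c : Cmd B} {r r' : Reg → List Sym} {o o' : List B} {T T' : ℕ}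
    (h : c.Transforms r o r' o' T) (hT : T ≤ T') : c.Transforms r o r' o' T' := fun v => by
  obtain ⟨v', h⟩ := h v
  exact ⟨v', h.mono hT⟩

theorem seq {a b : Cmd B} {r₀ r₁ r₂ : Reg → List Sym} {o₀ o₁ o₂ : List B} {T₁ T₂ : ℕ}
    (h₁ : a.Transforms r₀ o₀ r₁ o₁ T₁) (h₂ : b.Transforms r₁ o₁ r₂ o₂ T₂) :
    (Cmd.seq a b).Transforms r₀ o₀ r₂ o₂ (T₁ + T₂) := fun v => by
  obtain ⟨v₁, h₁⟩ := h₁ v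
  obtain ⟨v₂, h₂⟩ := h₂ v₁
  exact ⟨v₂, h₁.seq h₂⟩

theorem skip (r : Reg → List Sym) (o : List B) : Cmd.skip.Transforms r o r o 1 :=
  fun v => ⟨v, (Run.skip _).within⟩

theorem push (k : Reg) (x : Sym) (r : Reg → List Sym) (o : List B) :
    (Cmd.push k x).Transforms r o (update r k (x :: r k)) o 1 :=
  fun v => ⟨v, (Run.push k x v r o).within⟩

theorem emit (x : B) (r : Reg → List Sym) (o : List B) :
    (Cmd.emit x).Transforms r o r (x :: o) 1 :=
  fun v => ⟨v, (Run.emit x v r o).within⟩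

end Cmd.Transforms

/-- Test for the symbol that counts one unit. -/
def isOne (v : Option Sym) : Bool := v == some (some true)

/-- The program pops `src` as long as `p` holds and runs `body` after each such pop. -/
def popWhile (p : Option Sym → Bool) (src : Reg) (body : Cmd B) : Cmd B :=
  .seq (.pop src) (.loop p (.seq body (.pop src)))

/-- Moves symbols from one stack to another as long as `p` holds. -/
def drain (p : Option Sym → Bool) (src dst : Reg) : Cmd B := popWhile p src (.put dst)

/-- The loop notices its end only by popping a symbol that fails the test, so one symbol beyond `l`
is lost: this removes the end mark of a block. On an exhausted stack the failing pop returns `none`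
and nothing is lost. -/
theorem drain_within (p : Option Sym → Bool) {src dst : Reg} (hne : src ≠ dst)
    (rest : List Sym) (hrest : p rest.head? = false) (o : List B) :
    ∀ (l : List Sym) (_ : ∀ x ∈ l, p (some x) = true) (r : Reg → List Sym)
      (_ : r src = l ++ rest) (v : Option Sym),
      (drain p src dst).Within ⟨v, r, o⟩
        ⟨rest.head?, update (update r src rest.tail) dst (l.reverse ++ r dst), o⟩
        (3 * l.length + 2) := by
  intro l hl r hr v
  -- The test sees the symbol popped last, so the invariant describes a stack whose head has moved
  -- to the variable.
  have key : ∀ (l : List Sym) (_ : ∀ x ∈ l, p (some x) = true) (r : Reg → List Sym),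
      (Cmd.loop p (.seq (.put dst) (.pop src))).Within
        ⟨(l ++ rest).head?, update r src (l ++ rest).tail, o⟩
        ⟨rest.head?, update (update r src rest.tail) dst (l.reverse ++ r dst), o⟩
        (3 * l.length + 1) := by
    intro l
    induction l with
    | nil =>
      intro _ r
      have : update (update r src rest.tail) dst (r dst) = update r src rest.tail := by
        rw [← update_of_ne hne.symm rest.tail r, update_eq_self]
      simpa [this] using Cmd.Within.loopFalse (B := B)
        (s := ⟨rest.head?, update r src rest.tail, o⟩) hrest
    | cons x l ih =>
      intro hl r
      have h1 := ih (fun y hy => hl y (.tail _ hy)) (update r dst (x :: r dst))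
      refine (Cmd.Within.loopTrue (hl x (.head _))
        (Cmd.Within.seq (Run.put _ _ _ _).within (Run.pop _ _ _ _).within) ?_).mono
          (T := 1 + (1 + 1) + (3 * l.length + 1)) (by simp; omega)
      convert h1 using 2
      · simp [update_of_ne hne]
      · simp [update_of_ne hne, update_of_ne hne.symm]
        rw [update_comm hne, update_idem]
      · rw [update_comm hne, update_self]
        rw [update_comm hne, update_idem]
        simp
  refine (Cmd.Within.seq (Run.pop src v r o).within (?_ : Cmd.Within _ _ _ _)).mono
    (T := 1 + (3 * l.length + 1)) (by omega)
  rw [hr]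
  exact key l hl r

/-- The unary code of a number. -/
def block (n : ℕ) : List Sym := List.replicate n (some true) ++ [none]

/-- The code of a list of numbers. -/
def enc (L : List ℕ) : List Sym := L.flatMap block

@[simp] theorem enc_nil : enc [] = [] := rfl

theorem enc_cons (n : ℕ) (L : List ℕ) :
    enc (n :: L) = List.replicate n (some true) ++ none :: enc L := by
  simp [enc, block]

@[simp] theorem length_enc_cons (n : ℕ) (L : List ℕ) :
    (enc (n :: L)).length = n + 1 + (enc L).length := by
  simp [enc_cons]; omega

theorem le_length_enc {n : ℕ} {L : List ℕ} (h : n ∈ L) : n ≤ (enc L).length := by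
  induction L with
  | nil => simp at h
  | cons m L ih =>
    rw [length_enc_cons]
    rcases List.mem_cons.1 h with rfl | h
    · omega
    · have := ih h
      omega

/-- Moves a block of units, and removes its end mark. -/
theorem drain_block {src dst : Reg} (hne : src ≠ dst) (n : ℕ) (rest : List Sym)
    (r : Reg → List Sym) (hr : r src = List.replicate n (some true) ++ none :: rest) (o : List B) :
    (drain isOne src dst).Transforms r o
      (update (update r src rest) dst (List.replicate n (some true) ++ r dst)) o (3 * n + 2) := by
  intro v
  have := drain_within isOne hne (none :: rest) rfl o (List.replicate n (some true))
    (by intro x hx; rw [List.eq_of_mem_replicate hx]; rfl) r hr v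
  exact ⟨_, by simpa using this⟩

/-- Moves a whole stack. -/
theorem drain_all {src dst : Reg} (hne : src ≠ dst) (l : List Sym)
    (r : Reg → List Sym) (hr : r src = l) (o : List B) :
    (drain Option.isSome src dst).Transforms r o
      (update (update r src []) dst (l.reverse ++ r dst)) o (3 * l.length + 2) := by
  intro v
  have := drain_within Option.isSome hne [] rfl o l (fun x _ => rfl) r (by simpa using hr) v
  exact ⟨_, by simpa using this⟩

/-- Adds the two topmost numbers. -/
def addOp : Cmd B := .seq (drain isOne .dat .aux) (drain Option.isSome .aux .dat)

/-- Once the end mark of the upper block is gone, its units put back on the stack merge with the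
block below. -/
theorem addOp_spec (w : List Sym) (m n : ℕ) (L : List ℕ) (o : List B) :
    addOp.Transforms (regs w (enc (n :: m :: L)) [] []) o (regs w (enc ((m + n) :: L)) [] []) o
      (6 * n + 4) := by
  have h1 := drain_block (src := .dat) (dst := .aux) (by decide) n (enc (m :: L))
    (regs w (enc (n :: m :: L)) [] []) (enc_cons _ _) o
  have h2 := drain_all (src := .aux) (dst := .dat) (by decide) (List.replicate n (some true))
    (regs w (enc (m :: L)) (List.replicate n (some true)) []) rfl o
  simp only [update_regs_dat, update_regs_aux, regs_aux, regs_dat, List.append_nil] at h1 h2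
  have := h1.seq h2
  rw [List.reverse_replicate, enc_cons m, ← List.append_assoc, ← List.replicate_add, ← enc_cons,
    Nat.add_comm n] at this
  exact this.mono (by simp; omega)

/-- Subtracts the topmost number from the one below. -/
def subOp : Cmd B :=
  .seq (drain isOne .dat .aux)
    (popWhile isOne .aux (.seq (.pop .dat) (.ite isOne .skip (.push .dat none))))

theorem subOp_spec (w : List Sym) (m n : ℕ) (L : List ℕ) (o : List B) :
    subOp.Transforms (regs w (enc (n :: m :: L)) [] []) o (regs w (enc ((m - n) :: L)) [] []) o
      (8 * n + 4) := by
  have h1 := drain_block (src := .dat) (dst := .aux) (by decide) n (enc (m :: L))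
    (regs w (enc (n :: m :: L)) [] []) (enc_cons _ _) o
  simp only [update_regs_dat, update_regs_aux, regs_aux, List.append_nil] at h1
  have key : ∀ n m : ℕ, (Cmd.loop isOne (.seq (.seq (.pop .dat)
      (.ite isOne .skip (.push .dat none))) (.pop .aux))).Within
        ⟨(List.replicate n (some true)).head?,
          regs w (enc (m :: L)) (List.replicate n (some true)).tail [], o⟩
        ⟨none, regs w (enc ((m - n) :: L)) [] [], o⟩ (5 * n + 1) := by
    intro n
    induction n with
    | zero => exact fun m => (Run.loopFalse rfl).within
    | succ n ih =>
      intro m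
      cases m with
      -- Here the lower number is exhausted: the pop takes its end mark, which is pushed back. This
      -- makes the subtraction truncated.
      | zero =>
        refine (Cmd.Within.loopTrue rfl (.seq (.seq (Run.pop ..).within
          (.iteFalse ?_ (Run.push ..).within)) (Run.pop ..).within) ?_).mono
          (T := 1 + ((1 + (1 + 1)) + 1) + (5 * n + 1)) (by omega)
        · simp [enc_cons, isOne]
        · simpa [enc_cons] using ih 0
      | succ m =>
        refine (Cmd.Within.loopTrue rfl (.seq (.seq (Run.pop ..).within
          (.iteTrue ?_ (Run.skip ..).within)) (Run.pop ..).within) ?_).mono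
          (T := 1 + ((1 + (1 + 1)) + 1) + (5 * n + 1)) (by omega)
        · simp [enc_cons, isOne, List.replicate_succ]
        · simpa [enc_cons, List.replicate_succ] using ih m
  have h2 : (popWhile isOne .aux (.seq (.pop .dat)
      (.ite isOne .skip (.push .dat none)))).Transforms
      (regs w (enc (m :: L)) (List.replicate n (some true)) []) o
      (regs w (enc ((m - n) :: L)) [] []) o (5 * n + 2) := fun v =>
    ⟨none, (Cmd.Within.seq (Run.pop ..).within (by simpa using key n m)).mono (by omega)⟩
  exact (h1.seq h2).mono (by omega)

/-- Adds the topmost number to the third one. -/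
def addUnder : Cmd B :=
  .seq (drain isOne .dat .aux2) <| .seq (drain isOne .dat .aux) <|
    .seq (drain Option.isSome .aux2 .dat) <| .seq (.push .dat none) (drain Option.isSome .aux .dat)

/-- This closes a round of a loop: `v` is the value just computed, `i` the counter, and `acc` the
running sum below it. -/
theorem addUnder_spec (w : List Sym) (v i acc : ℕ) (L : List ℕ) (o : List B) :
    addUnder.Transforms (regs w (enc (v :: i :: acc :: L)) [] []) o
      (regs w (enc (i :: (acc + v) :: L)) [] []) o (6 * v + 6 * i + 9) := by
  have h1 := drain_block (src := .dat) (dst := .aux2) (by decide) v (enc (i :: acc :: L))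
    (regs w (enc (v :: i :: acc :: L)) [] []) (enc_cons _ _) o
  have h2 := drain_block (src := .dat) (dst := .aux) (by decide) i (enc (acc :: L))
    (regs w (enc (i :: acc :: L)) [] (List.replicate v (some true))) (enc_cons _ _) o
  have h3 := drain_all (src := .aux2) (dst := .dat) (by decide) (List.replicate v (some true))
    (regs w (enc (acc :: L)) (List.replicate i (some true)) (List.replicate v (some true))) rfl o
  have h4 := Cmd.Transforms.push .dat none
    (regs w (enc ((acc + v) :: L)) (List.replicate i (some true)) []) o
  have h5 := drain_all (src := .aux) (dst := .dat) (by decide) (List.replicate i (some true))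
    (regs w (none :: enc ((acc + v) :: L)) (List.replicate i (some true)) []) rfl o
  simp only [update_regs_dat, update_regs_aux, update_regs_aux2, regs_aux, regs_dat, regs_aux2,
    List.append_nil, List.reverse_replicate] at h1 h2 h3 h4 h5
  rw [enc_cons acc, ← List.append_assoc, ← List.replicate_add, ← enc_cons, ← enc_cons,
    Nat.add_comm v] at h3
  rw [← enc_cons] at h5
  exact (h1.seq (h2.seq (h3.seq (h4.seq h5)))).mono (by simp; omega)

/-- Halves the topmost number. -/
def halfOp : Cmd B :=
  .seq (popWhile isOne .dat (.seq (.pop .dat) (.ite isOne (.push .aux (some true)) (.push .dat none))))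
    (.seq (.push .dat none) (drain Option.isSome .aux .dat))

theorem halfOp_spec (w : List Sym) (x : ℕ) (L : List ℕ) (b : List Sym) (o : List B) :
    halfOp.Transforms (regs w (enc (x :: L)) [] b) o (regs w (enc ((x / 2) :: L)) [] b) o
      (8 * x + 5) := by
  have key : ∀ x a : ℕ, (Cmd.loop isOne (.seq (.seq (.pop .dat)
      (.ite isOne (.push .aux (some true)) (.push .dat none))) (.pop .dat))).Within
        ⟨(enc (x :: L)).head?,
          regs w (enc (x :: L)).tail (List.replicate a (some true)) b, o⟩
        ⟨some none, regs w (enc L) (List.replicate (a + x / 2) (some true)) b, o⟩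
        (5 * x + 1) := by
    intro x
    induction x using Nat.twoStepInduction with
    | zero => exact fun a => (Run.loopFalse rfl).within
    -- The second pop of the round meets the end mark. It is pushed back, so that the pop at the end
    -- of the round finds it and the loop stops; the odd unit vanishes.
    | one =>
      intro a
      refine (Cmd.Within.loopTrue (s₁ := ⟨some none, regs w (enc L)
          (List.replicate (a + 1 / 2) (some true)) b, o⟩) ?_ (.seq (s₁ := ⟨some none,
          regs w (enc (0 :: L)) (List.replicate (a + 1 / 2) (some true)) b, o⟩)
          (.seq (Run.pop ..).within (.iteFalse ?_ (by simpa [enc_cons] using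
            (Run.push .dat none (some none) (regs w (enc L) (List.replicate a (some true)) b) o).within)))
          (by simpa [enc_cons] using (Run.pop .dat (some none)
            (regs w (enc (0 :: L)) (List.replicate a (some true)) b) o).within))
            (Run.loopFalse rfl).within).mono
          (T := 1 + ((1 + (1 + 1)) + 1) + 1) (by omega)
      · simp [enc_cons, isOne]
      · simp [enc_cons, isOne]
    | more x ih _ =>
      intro a
      refine (Cmd.Within.loopTrue rfl (.seq (.seq (Run.pop ..).within
        (.iteTrue ?_ (Run.push ..).within)) (Run.pop ..).within) ?_).mono
        (T := 1 + ((1 + (1 + 1)) + 1) + (5 * x + 1)) (by omega)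
      · simp [enc_cons, isOne, List.replicate_succ]
      · have := ih (a + 1)
        rw [show a + 1 + x / 2 = a + (x + 2) / 2 by omega] at this
        simpa [enc_cons, List.replicate_succ] using this
  have h2 : (popWhile isOne .dat (.seq (.pop .dat)
      (.ite isOne (.push .aux (some true)) (.push .dat none)))).Transforms
      (regs w (enc (x :: L)) [] b) o
      (regs w (enc L) (List.replicate (x / 2) (some true)) b) o (5 * x + 2) := fun v =>
    ⟨some none, (Cmd.Within.seq (Run.pop ..).within (by simpa using key x 0)).mono (by omega)⟩
  have h3 := Cmd.Transforms.push .dat none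
    (regs w (enc L) (List.replicate (x / 2) (some true)) b) o
  have h4 := drain_all (src := .aux) (dst := .dat) (by decide)
    (List.replicate (x / 2) (some true))
    (regs w (none :: enc L) (List.replicate (x / 2) (some true)) b) rfl o
  simp only [update_regs_dat, update_regs_aux, regs_dat, List.reverse_replicate] at h3 h4
  rw [← enc_cons] at h4
  exact (h2.seq (h3.seq h4)).mono (by simp; omega)

/-- Divides the second number by the power of two with the topmost number as its exponent. -/
def shrOp : Cmd B := .seq (drain isOne .dat .aux2) (popWhile isOne .aux2 halfOp)

theorem shrOp_spec (w : List Sym) (m n : ℕ) (L : List ℕ) (o : List B) :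
    shrOp.Transforms (regs w (enc (n :: m :: L)) [] []) o (regs w (enc ((m / 2 ^ n) :: L)) [] []) o
      (n * (8 * m + 10) + 4) := by
  have h1 := drain_block (src := .dat) (dst := .aux2) (by decide) n (enc (m :: L))
    (regs w (enc (n :: m :: L)) [] []) (enc_cons _ _) o
  simp only [update_regs_dat, update_regs_aux2, regs_aux2, List.append_nil] at h1
  have key : ∀ n m : ℕ, (Cmd.loop isOne (.seq halfOp (.pop .aux2))).Within
        ⟨(List.replicate n (some true)).head?,
          regs w (enc (m :: L)) [] (List.replicate n (some true)).tail, o⟩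
        ⟨none, regs w (enc ((m / 2 ^ n) :: L)) [] [], o⟩ (n * (8 * m + 7) + 1) := by
    intro n
    induction n with
    | zero => intro m; simpa using Cmd.Within.loopFalse rfl
    | succ n ih =>
      intro m
      obtain ⟨v, hv⟩ := halfOp_spec w m L (List.replicate n (some true)) o (some (some true))
      rw [Nat.pow_succ', ← Nat.div_div_eq_div_mul]
      refine (Cmd.Within.loopTrue (s₁ := ⟨(List.replicate n (some true)).head?,
          regs w (enc (m / 2 :: L)) [] (List.replicate n (some true)).tail, o⟩) rfl
        (.seq (by simpa [List.replicate_succ] using hv)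
          (by simpa using (Run.pop .aux2 v (regs w (enc (m / 2 :: L)) []
            (List.replicate n (some true))) o).within)) (ih (m / 2))).mono
        (T := 1 + (8 * m + 5 + 1) + (n * (8 * (m / 2) + 7) + 1)) ?_
      · have : n * (8 * (m / 2) + 7) ≤ n * (8 * m + 7) := by gcongr; omega
        rw [Nat.add_mul n 1]
        omega
  have h2 : (popWhile isOne .aux2 halfOp).Transforms
      (regs w (enc (m :: L)) [] (List.replicate n (some true))) o
      (regs w (enc ((m / 2 ^ n) :: L)) [] []) o (n * (8 * m + 7) + 2) := fun v =>
    ⟨none, (Cmd.Within.seq (Run.pop ..).within (by simpa using key n m)).mono (by omega)⟩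
  exact (h1.seq h2).mono (by ring_nf; omega)

/-- Leaves a copy of the number at position `i` on `aux2`, and moves what lies above to `aux`. -/
def pickAux : ℕ → Cmd B
  | 0 => .seq (popWhile isOne .dat (.seq (.put .aux) (.put .aux2))) (.push .dat none)
  | i + 1 => .seq (drain isOne .dat .aux) (.seq (.push .aux none) (pickAux i))

/-- The split between `D` and `A'` is left open, since `pick` moves `A'` back anyway; only the
equation that restores the stack and the length for the time bound matter. -/
theorem pickAux_spec (w : List Sym) (x : ℕ) (o : List B) :
    ∀ (i : ℕ) (L : List ℕ) (_ : L[i]? = some x) (A : List Sym), ∃ D A' : List Sym,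
      A'.reverse ++ D = A.reverse ++ enc L ∧ A'.length ≤ A.length + (enc L).length ∧
      (pickAux i).Transforms (regs w (enc L) A []) o
        (regs w D A' (List.replicate x (some true))) o (4 * (enc L).length) := by
  intro i
  induction i with
  | zero =>
    intro L hL A
    obtain ⟨L, rfl⟩ : ∃ L', L = x :: L' := by
      cases L with
      | nil => simp at hL
      | cons y L => exact ⟨L, by simpa using hL⟩
    refine ⟨none :: enc L, List.replicate x (some true) ++ A, by simp [enc_cons], by simp; omega,
      ?_⟩
    have key : ∀ (x : ℕ) (A C : List Sym),
        (Cmd.loop isOne (.seq (.seq (.put .aux) (.put .aux2)) (.pop .dat))).Within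
        ⟨(enc (x :: L)).head?, regs w (enc (x :: L)).tail A C, o⟩
        ⟨some none, regs w (enc L) (List.replicate x (some true) ++ A)
          (List.replicate x (some true) ++ C), o⟩ (4 * x + 1) := by
      intro x
      induction x with
      | zero => exact fun A C => (Run.loopFalse rfl).within
      | succ x ih =>
        intro A C
        refine (Cmd.Within.loopTrue rfl (.seq (.seq (Run.put ..).within (Run.put ..).within)
          (Run.pop ..).within) ?_).mono (T := 1 + (1 + 1 + 1) + (4 * x + 1)) (by omega)
        have := ih (some true :: A) (some true :: C)
        rw [List.replicate_succ']
        simpa [enc_cons, List.replicate_succ, List.append_assoc] using this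
    have h1 : (popWhile isOne .dat (.seq (.put .aux) (.put .aux2))).Transforms
        (regs w (enc (x :: L)) A []) o
        (regs w (enc L) (List.replicate x (some true) ++ A) (List.replicate x (some true))) o
        (4 * x + 2) := fun v =>
      ⟨some none, (Cmd.Within.seq (Run.pop ..).within (by simpa using key x A [])).mono (by omega)⟩
    have h2 := Cmd.Transforms.push .dat none
      (regs w (enc L) (List.replicate x (some true) ++ A) (List.replicate x (some true))) o
    simp only [update_regs_dat, regs_dat] at h2
    exact (h1.seq h2).mono (by simp; omega)
  | succ i ih =>
    intro L hL A
    obtain ⟨y, L, rfl⟩ : ∃ y L', L = y :: L' := by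
      cases L with
      | nil => simp at hL
      | cons y L => exact ⟨y, L, rfl⟩
    have h1 := drain_block (src := .dat) (dst := .aux) (by decide) y (enc L)
      (regs w (enc (y :: L)) A []) (enc_cons _ _) o
    have h2 := Cmd.Transforms.push .aux none
      (regs w (enc L) (List.replicate y (some true) ++ A) []) o
    simp only [update_regs_dat, update_regs_aux, regs_aux] at h1 h2
    obtain ⟨D, A', hA, hlen, h3⟩ := ih L (by simpa using hL)
      (none :: (List.replicate y (some true) ++ A))
    refine ⟨D, A', ?_, ?_, (h1.seq (h2.seq h3)).mono (by simp; omega)⟩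
    · rw [hA]
      simp [enc_cons]
    · simp at hlen ⊢
      omega

/-- Copies the number at position `i` to the top. -/
def pick (i : ℕ) : Cmd B :=
  .seq (pickAux i) <| .seq (drain Option.isSome .aux .dat) <|
    .seq (.push .dat none) (drain Option.isSome .aux2 .dat)

theorem pick_spec (w : List Sym) {x i : ℕ} {L : List ℕ} (h : L[i]? = some x) (o : List B) :
    (pick i).Transforms (regs w (enc L) [] []) o (regs w (enc (x :: L)) [] []) o
      (10 * (enc L).length + 5) := by
  obtain ⟨D, A, hA, hlen, h1⟩ := pickAux_spec w x o i L h []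
  have h2 := drain_all (src := .aux) (dst := .dat) (by decide) A
    (regs w D A (List.replicate x (some true))) rfl o
  simp only [update_regs_dat, update_regs_aux, regs_dat, hA] at h2
  have h3 := Cmd.Transforms.push .dat none
    (regs w (enc L) [] (List.replicate x (some true))) o
  have h4 := drain_all (src := .aux2) (dst := .dat) (by decide) (List.replicate x (some true))
    (regs w (none :: enc L) [] (List.replicate x (some true))) rfl o
  simp only [update_regs_dat, update_regs_aux2, regs_dat, List.reverse_replicate] at h3 h4
  rw [← enc_cons] at h4
  have hx := le_length_enc (List.mem_of_getElem? h)
  exact (h1.seq (h2.seq (h3.seq h4))).mono (by simp at hlen ⊢; omega)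

/-- Puts the length of the input on the top. -/
def lenOp : Cmd B :=
  .seq (.push .dat none) <| .seq
    (popWhile Option.isSome .inp (.seq (.put .aux) (.push .dat (some true))))
    (drain Option.isSome .aux .inp)

theorem lenOp_spec (w : List Sym) (L : List ℕ) (o : List B) :
    lenOp.Transforms (regs w (enc L) [] []) o (regs w (enc (w.length :: L)) [] []) o
      (7 * w.length + 5) := by
  have key : ∀ (w d A : List Sym), (Cmd.loop Option.isSome
      (.seq (.seq (.put .aux) (.push .dat (some true))) (.pop .inp))).Within
        ⟨w.head?, regs w.tail d A [], o⟩
        ⟨none, regs [] (List.replicate w.length (some true) ++ d) (w.reverse ++ A) [], o⟩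
        (4 * w.length + 1) := by
    intro w
    induction w with
    | nil => exact fun d A => (Run.loopFalse rfl).within
    | cons x w ih =>
      intro d A
      refine (Cmd.Within.loopTrue rfl (.seq (.seq (Run.put ..).within (Run.push ..).within)
          (Run.pop ..).within) ?_).mono (T := 1 + (1 + 1 + 1) + (4 * w.length + 1))
          (by simp; omega)
      have := ih (some true :: d) (x :: A)
      rw [List.length_cons, List.replicate_succ']
      simpa using this
  have h1 := Cmd.Transforms.push .dat none (regs w (enc L) [] []) o
  have h2 : (popWhile Option.isSome .inp (.seq (.put .aux) (.push .dat (some true)))).Transforms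
      (regs w (none :: enc L) [] []) o
      (regs [] (List.replicate w.length (some true) ++ none :: enc L) w.reverse []) o
      (4 * w.length + 2) := fun v =>
    ⟨none, (Cmd.Within.seq (Run.pop ..).within (by simpa using key w (none :: enc L) [])).mono
      (by omega)⟩
  have h3 := drain_all (src := .aux) (dst := .inp) (by decide) w.reverse
    (regs [] (List.replicate w.length (some true) ++ none :: enc L) w.reverse []) rfl o
  simp only [update_regs_dat, update_regs_aux, update_regs_inp, regs_dat, regs_inp,
    List.reverse_reverse, List.append_nil, ← enc_cons] at h1 h2 h3
  exact (h1.seq (h2.seq h3)).mono (by simp; omega)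

/-- Replaces the topmost number by `1` if it is the position of the symbol `s` in the input, and
by `0` otherwise. -/
def bitOp (s : Sym) : Cmd B :=
  .seq (popWhile isOne .dat (.seq (.pop .inp) (.ite Option.isSome (.put .aux) .skip))) <|
    .seq (.seq (.pop .inp) (.ite (fun v => v == some s)
      (.seq (.put .inp) (.seq (.push .dat none) (.push .dat (some true))))
      (.seq (.ite Option.isSome (.put .inp) .skip) (.push .dat none)))) <|
    drain Option.isSome .aux .inp

/-- Positions beyond the end of the input are permitted: a pop from the empty stack returns `none`,
and the tests with `Option.isSome` keep such a pop from being written back. -/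
theorem bitOp_spec (s : Sym) (w : List Sym) (n : ℕ) (L : List ℕ) (o : List B) :
    (bitOp s).Transforms (regs w (enc (n :: L)) [] []) o
      (regs w (enc ((if w[n]? = some s then 1 else 0) :: L)) [] []) o
      (5 * n + 3 * w.length + 10) := by
  have key : ∀ (n : ℕ) (w A : List Sym), (Cmd.loop isOne
      (.seq (.seq (.pop .inp) (.ite Option.isSome (.put .aux) .skip)) (.pop .dat))).Within
        ⟨(enc (n :: L)).head?, regs w (enc (n :: L)).tail A [], o⟩
        ⟨some none, regs (w.drop n) (enc L) ((w.take n).reverse ++ A) [], o⟩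
        (5 * n + 1) := by
    intro n
    induction n with
    | zero => exact fun w A => (Run.loopFalse rfl).within
    | succ n ih =>
      intro w A
      cases w with
      | nil =>
        refine (Cmd.Within.loopTrue rfl (.seq (.seq (Run.pop ..).within
          (.iteFalse rfl (Run.skip ..).within)) (Run.pop ..).within) ?_).mono
          (T := 1 + (1 + (1 + 1) + 1) + (5 * n + 1)) (by omega)
        simpa [enc_cons, List.replicate_succ] using ih [] A
      | cons x w =>
        refine (Cmd.Within.loopTrue rfl (.seq (.seq (Run.pop ..).within
          (.iteTrue rfl (Run.put ..).within)) (Run.pop ..).within) ?_).mono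
          (T := 1 + (1 + (1 + 1) + 1) + (5 * n + 1)) (by omega)
        simpa [enc_cons, List.replicate_succ] using ih w (x :: A)
  have h1 : (popWhile isOne .dat (.seq (.pop .inp) (.ite Option.isSome (.put .aux) .skip))).Transforms
      (regs w (enc (n :: L)) [] []) o
      (regs (w.drop n) (enc L) (w.take n).reverse []) o (5 * n + 2) := fun v =>
    ⟨some none, (Cmd.Within.seq (Run.pop ..).within (by simpa using key n w [])).mono (by omega)⟩
  have h2 : (Cmd.seq (.pop .inp) (.ite (fun v => v == some s)
      (.seq (.put .inp) (.seq (.push .dat none) (.push .dat (some true))))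
      (.seq (.ite Option.isSome (.put .inp) .skip) (.push .dat none)))).Transforms
      (regs (w.drop n) (enc L) (w.take n).reverse []) o
      (regs (w.drop n) (enc ((if w[n]? = some s then 1 else 0) :: L)) (w.take n).reverse []) o
      6 := by
    intro v
    rw [← List.head?_drop]
    cases h : w.drop n with
    | nil =>
      rw [List.head?_nil, if_neg (by simp), enc_cons]
      exact ⟨none, (Cmd.Within.seq (Run.pop ..).within (.iteFalse rfl (.seq
        (.iteFalse rfl (Run.skip ..).within)
        (by simpa using (Run.push .dat none none (regs [] (enc L) (w.take n).reverse []) o).within)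
        ))).mono (T := 1 + (1 + (1 + 1 + 1))) (by omega)⟩
    | cons x l =>
      by_cases hx : x = s
      · rw [List.head?_cons, if_pos (by rw [hx]), enc_cons]
        exact ⟨some x, (Cmd.Within.seq (Run.pop ..).within (.iteTrue (by simp [hx]) (.seq
          (Run.put ..).within (.seq (Run.push ..).within
          (by simpa using (Run.push .dat (some true) (some x)
            (regs (x :: l) (none :: enc L) (w.take n).reverse []) o).within))))).mono
          (T := 1 + (1 + (1 + (1 + 1)))) (by omega)⟩
      · rw [List.head?_cons, if_neg (by simpa using hx), enc_cons]
        exact ⟨some x, (Cmd.Within.seq (Run.pop ..).within (.iteFalse (by simpa using hx) (.seq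
          (.iteTrue rfl (Run.put ..).within)
          (by simpa using (Run.push .dat none (some x)
            (regs (x :: l) (enc L) (w.take n).reverse []) o).within)))).mono
          (T := 1 + (1 + (1 + 1 + 1))) (by omega)⟩
  have h3 := drain_all (src := .aux) (dst := .inp) (by decide) (w.take n).reverse
    (regs (w.drop n) (enc ((if w[n]? = some s then 1 else 0) :: L)) (w.take n).reverse []) rfl o
  simp only [update_regs_aux, update_regs_inp, regs_inp, List.reverse_reverse,
    List.take_append_drop] at h3
  exact (h1.seq (h2.seq h3)).mono (by simp; omega)

end StackLang


/-! ### Expressions and output programs that compile to polynomial-time stack programs -/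

namespace StackLang

open Function

/-- Number-valued expressions over the positions of the input, with named variables. -/
inductive Expr : Type
  | var : ℕ → Expr
  | const : ℕ → Expr
  | len : Expr
  | add : Expr → Expr → Expr
  | sub : Expr → Expr → Expr
  | mul : Expr → Expr → Expr
  | shr : Expr → Expr → Expr
  | bit : Sym → Expr → Expr
  | sum : ℕ → Expr → Expr → Expr

namespace Expr

/-- The value of an expression: `bit s e` tests for the symbol `s` at position `e` of the input,
and `sum x b e` adds up the values of `e` for `x < b`. -/
def eval (w : List Sym) : Expr → (ℕ → ℕ) → ℕ
  | var x, env => env x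
  | const c, _ => c
  | len, _ => w.length
  | add a b, env => a.eval w env + b.eval w env
  | sub a b, env => a.eval w env - b.eval w env
  | mul a b, env => a.eval w env * b.eval w env
  | shr a b, env => a.eval w env / 2 ^ b.eval w env
  | bit s e, env => if w[e.eval w env]? = some s then 1 else 0
  | sum x b e, env => ∑ i ∈ Finset.range (b.eval w env), e.eval w (update env x i)

/-- Pushes units. -/
def pushOnes {B : Type} : ℕ → Cmd B
  | 0 => .skip
  | n + 1 => .seq (.push .dat (some true)) (pushOnes n)

theorem pushOnes_spec {B : Type} (w : List Sym) (n : ℕ) (d : List Sym) (o : List B) :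
    (pushOnes n).Transforms (regs w d [] []) o
      (regs w (List.replicate n (some true) ++ d) [] []) o (n + 1) := by
  induction n generalizing d with
  | zero => exact Cmd.Transforms.skip _ _
  | succ n ih =>
    have h := Cmd.Transforms.push .dat (some true) (regs w d [] []) o
    simp only [update_regs_dat, regs_dat] at h
    have := (h.seq (ih (some true :: d))).mono (T' := n + 1 + 1) (by omega)
    rw [List.replicate_succ']
    simpa [pushOnes] using this

/-- The stack program of an expression; `δ x` is the position of the variable `x` on the stack of
numbers. -/
def compile {B : Type} : Expr → (ℕ → ℕ) → Cmd B
  | var x, δ => pick (δ x)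
  | const c, _ => .seq (.push .dat none) (pushOnes c)
  | len, _ => lenOp
  | add a b, δ => .seq (a.compile δ) (.seq (b.compile fun x => δ x + 1) addOp)
  | sub a b, δ => .seq (a.compile δ) (.seq (b.compile fun x => δ x + 1) subOp)
  | shr a b, δ => .seq (a.compile δ) (.seq (b.compile fun x => δ x + 1) shrOp)
  | bit s e, δ => .seq (e.compile δ) (bitOp s)
  | mul a b, δ => .seq (.push .dat none) <| .seq (a.compile fun x => δ x + 1) <|
      popWhile isOne .dat (.seq (b.compile fun x => δ x + 2) addUnder)
  -- The counter doubles as the variable `x`. A unit is popped before each round, so the block on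
  -- top holds the indices from the bound minus one down to zero. All other variables lie two places
  -- deeper, below counter and accumulator.
  | sum x b e, δ => .seq (.push .dat none) <| .seq (b.compile fun x => δ x + 1) <|
      popWhile isOne .dat (.seq (e.compile (update (fun x => δ x + 2) x 0)) addUnder)

open Polynomial in
/-- A bound on the value of an expression. -/
noncomputable def valueBound : Expr → Polynomial ℕ
  | var _ => X
  | const c => C c
  | len => X
  | add a b => a.valueBound + b.valueBound
  | sub a _ => a.valueBound
  | mul a b => a.valueBound * b.valueBound
  | shr a _ => a.valueBound
  | bit _ _ => 1
  | sum _ b e => b.valueBound * e.valueBound.comp (X + b.valueBound)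

open Polynomial in
/-- The time of a loop with at most `n` rounds, each of which takes time `t` when the stack has
the given size, and computes a value of at most `f`. -/
noncomputable def loopBound (n f t : Polynomial ℕ) : Polynomial ℕ :=
  -- The argument of `t` bounds the stack during a round: old contents, counter, partial sum and two
  -- end marks. A round adds `6 * f + 6 * n + 9` for `addUnder`, one pop and one test; the final `3`
  -- is the initial push, the first pop and the last test.
  n * (t.comp (X + n + n * f + 2) + 6 * f + 6 * n + 11) + 3

open Polynomial in
/-- A bound on the running time of an expression. -/
noncomputable def timeBound : Expr → Polynomial ℕ
  | var _ => 10 * X + 5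
  | const c => C (c + 2)
  | len => 7 * X + 5
  | add a b => a.timeBound + b.timeBound.comp (X + a.valueBound + 1) + 6 * b.valueBound + 4
  | sub a b => a.timeBound + b.timeBound.comp (X + a.valueBound + 1) + 8 * b.valueBound + 4
  | shr a b => a.timeBound + b.timeBound.comp (X + a.valueBound + 1) +
      b.valueBound * (8 * a.valueBound + 10) + 4
  | bit _ e => e.timeBound + 5 * e.valueBound + 3 * X + 10
  | mul a b => a.timeBound.comp (X + 1) + loopBound a.valueBound b.valueBound b.timeBound
  | sum _ b e => b.timeBound.comp (X + 1) +
      loopBound b.valueBound (e.valueBound.comp (X + b.valueBound)) e.timeBound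

end Expr

namespace Expr

/-- In a sum the index is a further variable with values below the bound of `b`, so the summand is
estimated at `N` plus that bound. Composition of polynomials thus handles nested sums. -/
theorem eval_le_valueBound {w : List Sym} (e : Expr) : ∀ {env : ℕ → ℕ} {N : ℕ},
    w.length ≤ N → (∀ x, env x ≤ N) → e.eval w env ≤ e.valueBound.eval N := by
  induction e with
  | var x => intro env N _ h; simpa [eval, valueBound] using h x
  | const c => intro env N _ h; simp [eval, valueBound]
  | len => intro env N hw h; simpa [eval, valueBound] using hw
  | add a b iha ihb =>
    intro env N hw h
    simpa [eval, valueBound] using add_le_add (iha hw h) (ihb hw h)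
  | sub a b iha ihb =>
    intro env N hw h
    exact (Nat.sub_le _ _).trans (iha hw h)
  | mul a b iha ihb =>
    intro env N hw h
    simpa [eval, valueBound] using mul_le_mul' (iha hw h) (ihb hw h)
  | shr a b iha ihb =>
    intro env N hw h
    exact (Nat.div_le_self _ _).trans (iha hw h)
  | bit s e ih =>
    intro env N hw h
    simp only [eval, valueBound, Polynomial.eval_one]
    split <;> simp
  | sum x b e ihb ihe =>
    intro env N hw h
    have hb := ihb hw h
    simp only [eval, valueBound, Polynomial.eval_mul, Polynomial.eval_comp, Polynomial.eval_add,
      Polynomial.eval_X]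
    refine (Finset.sum_le_card_nsmul _ _ (e.valueBound.eval (N + b.valueBound.eval N)) ?_).trans ?_
    · intro i hi
      have hi' := Finset.mem_range.1 hi
      refine ihe (by omega) fun y => ?_
      by_cases hy : y = x
      · subst hy
        rw [update_self]
        omega
      · rw [update_of_ne hy]
        have := h y
        omega
    · rw [Finset.card_range, smul_eq_mul]
      exact Nat.mul_le_mul_right _ hb

end Expr

/-- A loop that sums up the values computed by `c`. -/
theorem sumLoop_spec {B : Type} {w : List Sym} {L : List ℕ} {o : List B} {c : Cmd B} {f : ℕ → ℕ}
    {N F A T : ℕ} : ∀ (n acc : ℕ), n ≤ N → (∀ i < n, f i ≤ F) →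
      acc + ∑ i ∈ Finset.range n, f i ≤ A →
      (∀ i < n, ∀ acc ≤ A, c.Transforms (regs w (enc (i :: acc :: L)) [] []) o
        (regs w (enc (f i :: i :: acc :: L)) [] []) o T) →
      (Cmd.loop isOne (.seq (.seq c addUnder) (.pop .dat))).Within
        ⟨(enc (n :: acc :: L)).head?, regs w (enc (n :: acc :: L)).tail [] [], o⟩
        ⟨some none, regs w (enc ((acc + ∑ i ∈ Finset.range n, f i) :: L)) [] [], o⟩
        (n * (T + 6 * F + 6 * N + 11) + 1) := by
  intro n
  induction n with
  | zero =>
    intro acc _ _ _ _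
    rw [Finset.range_zero, Finset.sum_empty, Nat.add_zero]
    exact (Cmd.Within.loopFalse rfl).mono (by omega)
  | succ n ih =>
    intro acc hn hF hA hc
    rw [Finset.sum_range_succ] at hA ⊢
    obtain ⟨v₁, h₁⟩ := hc n (by omega) acc (by omega) (some (some true))
    obtain ⟨v₂, h₂⟩ := addUnder_spec w (f n) n acc L o v₁
    have h := ih (acc + f n) (by omega) (fun i hi => hF i (by omega)) (by omega)
      fun i hi => hc i (by omega)
    have hFn := hF n (by omega)
    rw [show acc + (∑ x ∈ Finset.range n, f x + f n) = acc + f n + ∑ x ∈ Finset.range n, f x by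
      omega]
    refine (Cmd.Within.loopTrue (s₁ := ⟨(enc (n :: (acc + f n) :: L)).head?,
      regs w (enc (n :: (acc + f n) :: L)).tail [] [], o⟩) (by simp [enc_cons, isOne, List.replicate_succ])
      (.seq (.seq ?_ h₂) ?_) h).mono
      (T := 1 + (T + (6 * f n + 6 * n + 9) + 1) + (n * (T + 6 * F + 6 * N + 11) + 1)) ?_
    · simpa [enc_cons, List.replicate_succ] using h₁
    · simpa using (Run.pop .dat v₂ (regs w (enc (n :: (acc + f n) :: L)) [] []) o).within
    · rw [Nat.add_mul n 1]
      omega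

namespace Expr

/-- The single number `M` controls everything: it bounds the input and the stack, and hence the
variables, because each of them is a unary entry of the stack. -/
theorem compile_spec {B : Type} (w : List Sym) (e : Expr) : ∀ (δ env : ℕ → ℕ) (L : List ℕ) (M : ℕ)
    (o : List B), (∀ x, L[δ x]? = some (env x)) → w.length + (enc L).length ≤ M →
    (e.compile δ).Transforms (regs w (enc L) [] []) o (regs w (enc (e.eval w env :: L)) [] []) o
      (e.timeBound.eval M) := by
  have hval : ∀ (e : Expr) {δ env : ℕ → ℕ} {L : List ℕ} {M : ℕ},
      (∀ x, L[δ x]? = some (env x)) → w.length + (enc L).length ≤ M →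
      e.eval w env ≤ e.valueBound.eval M := fun e δ env L M hδ hM =>
    e.eval_le_valueBound (by omega) fun x =>
      (le_length_enc (List.mem_of_getElem? (hδ x))).trans (by omega)
  have hbin : ∀ (a b : Expr) (c : Cmd B) (δ env : ℕ → ℕ) (L : List ℕ) (M T : ℕ) (o : List B)
      (r : Reg → List Sym),
      (∀ (δ env : ℕ → ℕ) (L : List ℕ) (M : ℕ)
        (o : List B), (∀ x, L[δ x]? = some (env x)) → w.length + (enc L).length ≤ M →
        (a.compile δ).Transforms (regs w (enc L) [] []) o
          (regs w (enc (a.eval w env :: L)) [] []) o (a.timeBound.eval M)) →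
      (∀ (δ env : ℕ → ℕ) (L : List ℕ) (M : ℕ)
        (o : List B), (∀ x, L[δ x]? = some (env x)) → w.length + (enc L).length ≤ M →
        (b.compile δ).Transforms (regs w (enc L) [] []) o
          (regs w (enc (b.eval w env :: L)) [] []) o (b.timeBound.eval M)) →
      (∀ x, L[δ x]? = some (env x)) → w.length + (enc L).length ≤ M →
      c.Transforms (regs w (enc (b.eval w env :: a.eval w env :: L)) [] []) o r o T →
      (Cmd.seq (a.compile δ) (.seq (b.compile fun x => δ x + 1) c)).Transforms
        (regs w (enc L) [] []) o r o
        (a.timeBound.eval M + (b.timeBound.eval (M + a.valueBound.eval M + 1) + T)) := by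
    intro a b c δ env L M T o r iha ihb hδ hM hc
    have hv := hval a hδ hM
    exact (iha δ env L M o hδ hM).seq ((ihb (fun x => δ x + 1) env _ _ o (by simpa using hδ)
      (by rw [length_enc_cons]; omega)).seq hc)
  -- Products and sums share this loop; a product is a sum of equal terms.
  have hloop : ∀ (a : Expr) (c : Cmd B) (f : ℕ → ℕ) (pf pt : Polynomial ℕ) (δ env : ℕ → ℕ)
      (L : List ℕ) (M : ℕ) (o : List B),
      (∀ (δ env : ℕ → ℕ) (L : List ℕ) (M : ℕ)
        (o : List B), (∀ x, L[δ x]? = some (env x)) → w.length + (enc L).length ≤ M →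
        (a.compile δ).Transforms (regs w (enc L) [] []) o
          (regs w (enc (a.eval w env :: L)) [] []) o (a.timeBound.eval M)) →
      (∀ x, L[δ x]? = some (env x)) → w.length + (enc L).length ≤ M →
      (∀ i < a.eval w env, f i ≤ pf.eval M) →
      (∀ i acc M', w.length + (enc (i :: acc :: L)).length ≤ M' →
        c.Transforms (regs w (enc (i :: acc :: L)) [] []) o
        (regs w (enc (f i :: i :: acc :: L)) [] []) o (pt.eval M')) →
      (Cmd.seq (.push .dat none) <| .seq (a.compile fun x => δ x + 1) <|
        popWhile isOne .dat (.seq c addUnder)).Transforms (regs w (enc L) [] []) o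
        (regs w (enc ((∑ i ∈ Finset.range (a.eval w env), f i) :: L)) [] []) o
        ((a.timeBound.comp (Polynomial.X + 1) + loopBound a.valueBound pf pt).eval M) := by
    intro a c f pf pt δ env L M o iha hδ hM hf hc
    have hv := hval a hδ hM
    have h1 := Cmd.Transforms.push .dat none (regs w (enc L) [] []) o
    simp only [update_regs_dat, regs_dat] at h1
    have h2 := iha (fun x => δ x + 1) env (0 :: L) (M + 1) o (by simpa using hδ) (by simp; omega)
    set n := a.eval w env
    set N := a.valueBound.eval M
    set F := pf.eval M
    have hsum : ∑ i ∈ Finset.range n, f i ≤ N * F := by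
      refine (Finset.sum_le_card_nsmul _ _ F fun i hi => hf i (Finset.mem_range.1 hi)).trans ?_
      rw [Finset.card_range, smul_eq_mul]
      exact Nat.mul_le_mul_right _ hv
    have h3 := sumLoop_spec (w := w) (L := L) (o := o) (c := c) (f := f) (N := N) (F := F)
      (A := N * F) (T := pt.eval (M + N + N * F + 2)) n 0 hv hf (by omega)
      fun i hi acc hacc => hc i acc _ (by rw [length_enc_cons, length_enc_cons]; omega)
    have h4 : (popWhile isOne .dat (.seq c addUnder)).Transforms
        (regs w (enc (n :: 0 :: L)) [] []) o
        (regs w (enc ((∑ i ∈ Finset.range n, f i) :: L)) [] []) o _ := fun v =>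
      ⟨some none, Cmd.Within.seq (Run.pop ..).within (by simpa using h3)⟩
    refine (h1.seq (h2.seq h4)).mono ?_
    have := Nat.mul_le_mul_right (pt.eval (M + N + N * F + 2) + 6 * F + 6 * N + 11) hv
    simp [loopBound]
    simp only [N, F] at this ⊢
    omega
  induction e with
  | var x =>
    intro δ env L M o hδ hM
    exact (pick_spec w (hδ x) o).mono (by simp [timeBound]; omega)
  | const c =>
    intro δ env L M o hδ hM
    have h1 := Cmd.Transforms.push .dat none (regs w (enc L) [] []) o
    have h2 := pushOnes_spec w c (none :: enc L) o
    simp only [update_regs_dat, regs_dat] at h1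
    rw [← enc_cons] at h2
    exact (h1.seq h2).mono (by simp [timeBound]; omega)
  | len =>
    intro δ env L M o hδ hM
    exact (lenOp_spec w L o).mono (by simp [timeBound]; omega)
  | add a b iha ihb =>
    intro δ env L M o hδ hM
    refine (hbin a b _ δ env L M _ o _ iha ihb hδ hM (addOp_spec w _ _ L o)).mono ?_
    have := hval b hδ hM
    simp [timeBound]
    omega
  | sub a b iha ihb =>
    intro δ env L M o hδ hM
    refine (hbin a b _ δ env L M _ o _ iha ihb hδ hM (subOp_spec w _ _ L o)).mono ?_
    have := hval b hδ hM
    simp [timeBound]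
    omega
  | shr a b iha ihb =>
    intro δ env L M o hδ hM
    refine (hbin a b _ δ env L M _ o _ iha ihb hδ hM (shrOp_spec w _ _ L o)).mono ?_
    have ha := hval a hδ hM
    have hb := hval b hδ hM
    have := Nat.mul_le_mul hb
      (show 8 * a.eval w env + 10 ≤ 8 * a.valueBound.eval M + 10 by omega)
    simp [timeBound]
    omega
  | bit s e ih =>
    intro δ env L M o hδ hM
    refine ((ih δ env L M o hδ hM).seq (bitOp_spec s w _ L o)).mono ?_
    have := hval e hδ hM
    simp [timeBound]
    omega
  | mul a b iha ihb =>
    intro δ env L M o hδ hM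
    have := hloop a (b.compile fun x => δ x + 2) (fun _ => b.eval w env) b.valueBound b.timeBound
      δ env L M o iha hδ hM (fun _ _ => hval b hδ hM)
      fun i acc M' hM' => ihb _ env _ _ o (by simpa using hδ) hM'
    simpa [eval, compile, timeBound] using this
  | sum x b e ihb ihe =>
    intro δ env L M o hδ hM
    refine hloop b _ (fun i => e.eval w (update env x i)) _ e.timeBound δ env L M o ihb hδ hM ?_ ?_
    · intro i hi
      have hv := hval b hδ hM
      rw [Polynomial.eval_comp]
      refine e.eval_le_valueBound ?_ fun y => ?_
      · simp; omega
      · have := le_length_enc (List.mem_of_getElem? (hδ y))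
        by_cases hy : y = x
        · subst hy
          simp; omega
        · simp [update_of_ne hy]; omega
    · intro i acc M' hM'
      refine ihe _ _ _ _ o (fun y => ?_) hM'
      by_cases hy : y = x
      · subst hy
        simp
      · simpa [update_of_ne hy] using hδ y

end Expr

/-- Programs that write a word: they write single symbols, and repeat programs for all values of a
variable below a bound. -/
inductive Writer (B : Type) : Type
  | nil : Writer B
  | emit : B → Writer B
  | seq : Writer B → Writer B → Writer B
  | rep : ℕ → Expr → Writer B → Writer B

namespace Writer

variable {B : Type}

/-- The word written. -/
def word (w : List Sym) : Writer B → (ℕ → ℕ) → List B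
  | nil, _ => []
  | emit b, _ => [b]
  | seq p q, env => p.word w env ++ q.word w env
  | rep x e p, env => (List.range (e.eval w env)).flatMap fun i => p.word w (update env x i)

/-- The stack program of a writer: it pushes the word on the output stack from its end. -/
def compile : Writer B → (ℕ → ℕ) → Cmd B
  | nil, _ => .skip
  | emit b, _ => .emit b
  | seq p q, δ => .seq (q.compile δ) (p.compile δ)
  | rep x e p, δ => .seq (e.compile δ)
      (popWhile isOne .dat (p.compile (update (fun x => δ x + 1) x 0)))

open Polynomial in
/-- A bound on the running time. -/
noncomputable def timeBound : Writer B → Polynomial ℕ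
  | nil => 1
  | emit _ => 1
  | seq p q => q.timeBound + p.timeBound
  | rep _ e p => e.timeBound + e.valueBound * (p.timeBound.comp (X + e.valueBound + 1) + 2) + 2

theorem compile_spec (w : List Sym) (p : Writer B) : ∀ (δ env : ℕ → ℕ) (L : List ℕ) (M : ℕ)
    (o : List B), (∀ x, L[δ x]? = some (env x)) → w.length + (enc L).length ≤ M →
    (p.compile δ).Transforms (regs w (enc L) [] []) o (regs w (enc L) [] []) (p.word w env ++ o)
      (p.timeBound.eval M) := by
  induction p with
  | nil => exact fun δ env L M o hδ hM => (Cmd.Transforms.skip _ _).mono (by simp [timeBound])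
  | emit b => exact fun δ env L M o hδ hM => (Cmd.Transforms.emit _ _ _).mono (by simp [timeBound])
  | seq p q ihp ihq =>
    intro δ env L M o hδ hM
    have := (ihq δ env L M o hδ hM).seq (ihp δ env L M _ hδ hM)
    simpa [timeBound, word, compile] using this
  | rep x e p ih =>
    intro δ env L M o hδ hM
    have hv : e.eval w env ≤ e.valueBound.eval M := e.eval_le_valueBound (by omega) fun x =>
      (le_length_enc (List.mem_of_getElem? (hδ x))).trans (by omega)
    have h1 := e.compile_spec w δ env L M o hδ hM
    set N := e.valueBound.eval M
    set T := p.timeBound.eval (M + N + 1)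
    have key : ∀ n ≤ N, ∀ o : List B,
        (Cmd.loop isOne (.seq (p.compile (update (fun x => δ x + 1) x 0)) (.pop .dat))).Within
        ⟨(enc (n :: L)).head?, regs w (enc (n :: L)).tail [] [], o⟩
        ⟨some none, regs w (enc L) [] [],
          ((List.range n).flatMap fun i => p.word w (update env x i)) ++ o⟩
        (n * (T + 2) + 1) := by
      intro n
      induction n with
      | zero => exact fun _ o => (Cmd.Within.loopFalse rfl).mono (by omega)
      | succ n ihn =>
        intro hn o
        obtain ⟨v, h⟩ := ih (update (fun x => δ x + 1) x 0) (update env x n) (n :: L) (M + N + 1) o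
          (fun y => by
            by_cases hy : y = x
            · subst hy
              simp
            · simpa [update_of_ne hy] using hδ y)
          (by rw [length_enc_cons]; omega) (some (some true))
        -- The output is pushed from its end, so the countdown of the loop is the right order: the
        -- round with the largest index comes first.
        rw [List.range_succ, List.flatMap_append, List.append_assoc]
        refine (Cmd.Within.loopTrue (by simp [enc_cons, isOne, List.replicate_succ]) (.seq (s₁ := ⟨v, regs w (enc (n :: L)) [] [],
          p.word w (update env x n) ++ o⟩) ?_ ?_)
          (ihn (by omega) _)).mono
          (T := 1 + (T + 1) + (n * (T + 2) + 1)) (by rw [Nat.add_mul n 1]; omega)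
        · simpa [enc_cons, List.replicate_succ] using h
        · simpa using (Run.pop .dat v (regs w (enc (n :: L)) [] [])
            (p.word w (update env x n) ++ o)).within
    have h2 : (popWhile isOne .dat (p.compile (update (fun x => δ x + 1) x 0))).Transforms
        (regs w (enc (e.eval w env :: L)) [] []) o (regs w (enc L) [] [])
        ((Writer.rep x e p).word w env ++ o) _ := fun v =>
      ⟨some none, Cmd.Within.seq (Run.pop ..).within (by simpa [word] using key _ hv o)⟩
    refine (h1.seq h2).mono ?_
    have := Nat.mul_le_mul_right (T + 2) hv
    simp [timeBound]
    simp only [N, T] at this ⊢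
    omega

/-- The complete program: it puts a zero on the stack of numbers, as the value of all variables,
and empties the stacks in the end. -/
def program (p : Writer B) : Cmd B :=
  .seq (.push .dat none) <| .seq (p.compile fun _ => 0) <|
    .seq (.pop .dat) (popWhile Option.isSome .inp .skip)

/-- Functions given by writers are computable in polynomial time. -/
theorem computableInPolyTime {α β : Type} (ea : α → List Sym) (eb : β → List B) (f : α → β)
    (p : Writer B) (h : ∀ a, p.word (ea a) (fun _ => 0) = eb (f a)) :
    Nonempty (Turing.TM2ComputableInPolyTime ea eb f) := by
  refine computableInPolyTime_of_run ea eb f p.program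
    (p.timeBound.comp (Polynomial.X + 1) + (3 * Polynomial.X + 4)) fun a => ?_
  set w := ea a
  have h1 := Cmd.Transforms.push .dat none (regs w [] [] []) ([] : List B)
  simp only [update_regs_dat, regs_dat] at h1
  have h2 := p.compile_spec w (fun _ => 0) (fun _ => 0) [0] (w.length + 1) [] (fun x => rfl)
    (by simp)
  have h3 : (Cmd.pop .dat).Transforms (regs w (enc [0]) [] []) (eb (f a)) (regs w [] [] [])
      (eb (f a)) 1 := fun v =>
    ⟨_, by simpa [enc_cons] using (Run.pop .dat v (regs w (enc [0]) [] []) (eb (f a))).within⟩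
  have key : ∀ w : List Sym, (Cmd.loop Option.isSome (.seq .skip (.pop .inp))).Within
      ⟨w.head?, regs w.tail [] [] [], eb (f a)⟩ ⟨none, regs [] [] [] [], eb (f a)⟩
      (3 * w.length + 1) := by
    intro w
    induction w with
    | nil => exact Cmd.Within.loopFalse rfl
    | cons x w ih =>
      refine (Cmd.Within.loopTrue rfl (.seq (Run.skip _).within (Run.pop ..).within) ?_).mono
        (T := 1 + (1 + 1) + (3 * w.length + 1)) (by simp; omega)
      simpa using ih
  have h4 : (popWhile Option.isSome .inp .skip).Transforms (regs w [] [] []) (eb (f a))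
      (regs [] [] [] []) (eb (f a)) (1 + (3 * w.length + 1)) := fun v =>
    ⟨_, Cmd.Within.seq (Run.pop ..).within (by simpa using key w)⟩
  rw [List.append_nil, h a] at h2
  have hregs : ∀ w, regs w [] [] [] = onlyInp w := fun w => by
    funext k; cases k <;> rfl
  obtain ⟨v, t, ht, hrun⟩ := (h1.seq (h2.seq (h3.seq h4))) none
  rw [hregs, hregs] at hrun
  exact ⟨v, t, ht.trans (by simp; omega), hrun⟩

end Writer

end StackLang


/-! ### Triangle partitions and sets of vertices that cover the pairs of non-twins -/

namespace TriangleKernel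

open Finset

open scoped Classical

variable {V : Type*} [Fintype V] [DecidableEq V] {G : SimpleGraph V} {S : Finset V}

/-- Any two adjacent vertices outside `S` are twins. -/
def CoversNontwins (G : SimpleGraph V) (S : Finset V) : Prop :=
  ∀ u v, u ∉ S → v ∉ S → G.Adj u v → ∀ w, w ≠ u → w ≠ v → (G.Adj u w ↔ G.Adj v w)

/-- The vertices of `W` can be partitioned into triangles. -/
def Tiles (G : SimpleGraph V) (W : Finset V) : Prop :=
  ∃ T : Finset (Finset V), (∀ t ∈ T, G.IsNClique 3 t) ∧
    (T : Set (Finset V)).PairwiseDisjoint id ∧ T.biUnion id = W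

/-- The closed neighbourhood of `v` outside `S`. -/
noncomputable def cls (G : SimpleGraph V) (S : Finset V) (v : V) : Finset V :=
  univ.filter fun u => u ∉ S ∧ (u = v ∨ G.Adj u v)

theorem mem_cls {u v : V} : u ∈ cls G S v ↔ u ∉ S ∧ (u = v ∨ G.Adj u v) := by simp [cls]

theorem self_mem_cls {v : V} (hv : v ∉ S) : v ∈ cls G S v := mem_cls.2 ⟨hv, .inl rfl⟩

namespace CoversNontwins

variable (h : CoversNontwins G S)
include h

theorem cls_eq {u v : V} (hv : v ∉ S) (hu : u ∈ cls G S v) : cls G S u = cls G S v := by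
  obtain ⟨huS, rfl | huv⟩ := mem_cls.1 hu
  · rfl
  · ext w
    rw [mem_cls, mem_cls]
    refine and_congr_right fun hw => ?_
    by_cases hwu : w = u
    · subst hwu
      simp [huv]
    · by_cases hwv : w = v
      · subst hwv
        simp [huv.symm]
      · simp only [hwu, hwv, false_or]
        rw [G.adj_comm w, G.adj_comm w]
        exact h u v huS hv huv w hwu hwv

theorem adj_of_mem_cls {u v w : V} (hv : v ∉ S) (hu : u ∈ cls G S v) (hw : w ∈ cls G S v)
    (hne : u ≠ w) : G.Adj u w := by
  rw [← h.cls_eq hv hw] at hu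
  exact (mem_cls.1 hu).2.resolve_left hne

theorem adj_iff {u v s : V} (hv : v ∉ S) (hu : u ∈ cls G S v) (hs : s ∈ S) :
    G.Adj s u ↔ G.Adj s v := by
  obtain ⟨huS, rfl | huv⟩ := mem_cls.1 hu
  · rfl
  · rw [G.adj_comm s, G.adj_comm s]
    exact h u v huS hv huv s (by rintro rfl; exact huS hs) (by rintro rfl; exact hv hs)

theorem cls_disjoint_or_eq {u v : V} (hu : u ∉ S) (hv : v ∉ S) :
    cls G S u = cls G S v ∨ Disjoint (cls G S u) (cls G S v) := by
  by_cases hd : Disjoint (cls G S u) (cls G S v)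
  · exact .inr hd
  · obtain ⟨w, hwu, hwv⟩ := not_disjoint_iff.1 hd
    exact .inl ((h.cls_eq hu hwu).symm.trans (h.cls_eq hv hwv))

/-- A set outside `S` all of whose classes have a size divisible by three can be tiled. -/
theorem tiles_of_dvd (Y : Finset V) (hY : ∀ v ∈ Y, v ∉ S)
    (hdvd : ∀ v ∈ Y, 3 ∣ #(cls G S v ∩ Y)) : Tiles G Y := by
  induction hn : #Y using Nat.strong_induction_on generalizing Y with
  | _ n ih =>
  obtain rfl | ⟨v, hv⟩ := Y.eq_empty_or_nonempty
  · exact ⟨∅, by simp, by simp, by simp⟩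
  · have hvS := hY v hv
    have h3 : 3 ≤ #(cls G S v ∩ Y) := Nat.le_of_dvd
      (card_pos.2 ⟨v, mem_inter.2 ⟨self_mem_cls hvS, hv⟩⟩) (hdvd v hv)
    obtain ⟨t, ht, htc⟩ := exists_subset_card_eq h3
    have htY : t ⊆ Y := ht.trans inter_subset_right
    have htC : t ⊆ cls G S v := ht.trans inter_subset_left
    have hcard := card_sdiff_add_card_eq_card htY
    have hdv : ∀ u ∈ Y \ t, 3 ∣ #(cls G S u ∩ (Y \ t)) := fun u hu => by
      have huY := sdiff_subset hu
      have := hdvd u huY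
      rcases h.cls_disjoint_or_eq (hY u huY) hvS with he | hd
      · rw [← inter_sdiff_assoc, card_sdiff_of_subset (by rw [he]; exact ht), htc]
        omega
      · rwa [← inter_sdiff_assoc, sdiff_eq_self_of_disjoint]
        exact hd.mono inter_subset_left htC
    obtain ⟨T, hT, hTd, hTU⟩ := ih #(Y \ t) (by omega) (Y \ t)
      (fun u hu => hY u (sdiff_subset hu)) hdv rfl
    · refine ⟨insert t T, ?_, ?_, ?_⟩
      · intro s hs
        rcases mem_insert.1 hs with rfl | hs
        · exact ⟨fun a ha b hb hab => h.adj_of_mem_cls hvS (htC ha) (htC hb) hab, htc⟩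
        · exact hT s hs
      · rw [coe_insert]
        refine hTd.insert fun s hs _ => ?_
        have : s ⊆ Y \ t := hTU ▸ subset_biUnion_of_mem id hs
        exact (disjoint_sdiff.mono_right this : Disjoint t s)
      · rw [biUnion_insert, hTU, id, union_sdiff_of_subset htY]

end CoversNontwins

/-- The vertices covered by a family of sets. -/
noncomputable abbrev covered (T : Finset (Finset V)) : Finset V := T.biUnion id

/-- The triangles of a triangle partition of `W` that meet `S`. -/
structure Packing (G : SimpleGraph V) (S W : Finset V) (T : Finset (Finset V)) : Prop where
  clique : ∀ t ∈ T, G.IsNClique 3 t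
  disj : (T : Set (Finset V)).PairwiseDisjoint id
  meets : ∀ t ∈ T, ∃ s ∈ t, s ∈ S
  covers : S ⊆ covered T
  subset : covered T ⊆ W
  dvd : ∀ v ∈ W, v ∉ S → 3 ∣ #((cls G S v ∩ W) \ covered T)

/-- The uncovered vertices lie outside `S` and in classes with remainders divisible by three, which
are cut into triangles greedily. -/
theorem Packing.tiles (h : CoversNontwins G S) {W : Finset V} {T : Finset (Finset V)}
    (P : Packing G S W T) : Tiles G W := by
  obtain ⟨T', hT', hd', hU'⟩ := h.tiles_of_dvd (W \ covered T)
    (fun v hv hvS => (mem_sdiff.1 hv).2 (P.covers hvS)) fun v hv => by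
      rw [← inter_sdiff_assoc]
      exact P.dvd v (sdiff_subset hv) fun hvS => (mem_sdiff.1 hv).2 (P.covers hvS)
  refine ⟨T ∪ T', ?_, ?_, ?_⟩
  · intro t ht
    rcases mem_union.1 ht with ht | ht
    · exact P.clique t ht
    · exact hT' t ht
  · rw [coe_union]
    refine Set.PairwiseDisjoint.union P.disj hd' fun t ht t' ht' _ => ?_
    have h1 : t ⊆ covered T := subset_biUnion_of_mem id ht
    have h2 : t' ⊆ W \ covered T := hU' ▸ subset_biUnion_of_mem id ht'
    exact (disjoint_sdiff.mono h1 h2 : Disjoint t t')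
  · rw [union_biUnion, hU']
    exact union_sdiff_of_subset P.subset

theorem Tiles.exists_packing (h : CoversNontwins G S) {W : Finset V} (hSW : S ⊆ W)
    (hW : Tiles G W) : ∃ T, Packing G S W T := by
  obtain ⟨T, hT, hd, hU⟩ := hW
  refine ⟨T.filter fun t => ∃ s ∈ t, s ∈ S, fun t ht => hT t (mem_filter.1 ht).1,
    hd.subset (coe_subset.2 (filter_subset _ _)), fun t ht => (mem_filter.1 ht).2, fun s hs => ?_, ?_, fun v hv hvS => ?_⟩
  · obtain ⟨t, ht, hst⟩ := mem_biUnion.1 (hU ▸ hSW hs)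
    exact mem_biUnion.2 ⟨t, mem_filter.2 ⟨ht, s, hst, hs⟩, hst⟩
  · rw [← hU]
    exact biUnion_subset_biUnion_of_subset_left _ (filter_subset _ _)
  · have : (cls G S v ∩ W) \ covered (T.filter fun t => ∃ s ∈ t, s ∈ S) =
        covered (T.filter fun t => t ⊆ cls G S v) := by
      ext x
      simp only [covered, mem_sdiff, mem_inter, mem_biUnion, mem_filter, id]
      constructor
      · rintro ⟨⟨hx, hxW⟩, hn⟩
        obtain ⟨t, ht, hxt⟩ := mem_biUnion.1 (hU ▸ hxW)
        refine ⟨t, ⟨ht, fun y hy => ?_⟩, hxt⟩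
        have hyS : y ∉ S := fun hyS => hn ⟨t, ⟨ht, y, hy, hyS⟩, hxt⟩
        rw [← h.cls_eq hvS hx]
        by_cases hyx : y = x
        · exact mem_cls.2 ⟨hyS, .inl hyx⟩
        · exact mem_cls.2 ⟨hyS, .inr ((hT t ht).1 hy hxt hyx)⟩
      · rintro ⟨t, ⟨ht, htc⟩, hxt⟩
        refine ⟨⟨htc hxt, hU ▸ mem_biUnion.2 ⟨t, ht, hxt⟩⟩, ?_⟩
        rintro ⟨t', ⟨ht', s, hs, hsS⟩, hxt'⟩
        have : t = t' := hd.elim_finset ht ht' x hxt hxt'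
        subst this
        exact (mem_cls.1 (htc hs)).1 hsS
    rw [this, card_biUnion (fun t ht t' ht' hne => hd (mem_filter.1 ht).1 (mem_filter.1 ht').1 hne)]
    exact dvd_sum fun t ht => (hT t (mem_filter.1 ht).1).2 ▸ dvd_rfl

/-! ### Size of a packing, and moving its vertices -/

namespace Packing

variable {W : Finset V} {T : Finset (Finset V)}

/-- Disjoint triangles that meet `S` have distinct vertices in `S`, so there are at most `#S` of
them. They cover at most `3 * #S` vertices, among them all of `S`. -/
theorem card_covered_sdiff_le (P : Packing G S W T) : #(covered T \ S) ≤ 2 * #S := by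
  have h1 : #(covered T) = 3 * #T := by
    rw [card_biUnion (fun t ht t' ht' hne => P.disj ht ht' hne),
      sum_congr rfl fun t ht => show #(id t) = 3 from (P.clique t ht).2, sum_const, smul_eq_mul, Nat.mul_comm]
  have h2 : #T ≤ #S := by
    choose f hf hfS using P.meets
    rw [← card_attach]
    exact card_le_card_of_injOn (fun t => f t.1 t.2) (fun t _ => hfS t.1 t.2) fun t _ t' _ he =>
      Subtype.ext (P.disj.elim_finset t.2 t'.2 _ (hf t.1 t.2) ((show f t.1 t.2 = f t'.1 t'.2 from he) ▸ hf t'.1 t'.2))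
  rw [card_sdiff_of_subset P.covers]
  omega

/-- Among sufficiently many classes there is one that the triangles of a packing avoid. -/
theorem exists_disjoint_cls (h : CoversNontwins G S) (P : Packing G S W T) {Q : Finset V}
    (hQ : ∀ r ∈ Q, r ∉ S) (hinj : ∀ r ∈ Q, ∀ r' ∈ Q, cls G S r = cls G S r' → r = r')
    (hc : 2 * #S < #Q) : ∃ r ∈ Q, Disjoint (cls G S r) (covered T) := by
  by_contra! hcon
  have : ∀ r ∈ Q, ∃ u, u ∈ cls G S r ∧ u ∈ covered T := fun r hr => not_disjoint_iff.1 (hcon r hr)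
  choose! f hf hfU using this
  -- If every class were hit, one covered vertex from each would give distinct vertices outside `S`,
  -- too many for the packing.
  have hle : #Q ≤ #(covered T \ S) := card_le_card_of_injOn f
    (fun r hr => mem_sdiff.2 ⟨hfU r hr, (mem_cls.1 (hf r hr)).1⟩) fun r hr r' hr' he =>
      hinj r hr r' hr' ((h.cls_eq (hQ r hr) (hf r hr)).symm.trans
        (he ▸ h.cls_eq (hQ r' hr') (hf r' hr')))
  have := P.card_covered_sdiff_le
  omega

/-- Moving the vertices of a packing. -/
theorem map (P : Packing G S univ T) {f : V → V} (hf : Set.InjOn f (covered T))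
    (hS : ∀ s ∈ S, f s = s)
    (hadj : ∀ t ∈ T, ∀ a ∈ t, ∀ b ∈ t, a ≠ b → G.Adj (f a) (f b))
    (hmod : ∀ v ∉ S, #((covered T).filter fun a => f a ∈ cls G S v) ≡
      #((covered T).filter fun a => a ∈ cls G S v) [MOD 3]) :
    Packing G S univ (T.image (image f)) ∧ covered (T.image (image f)) = (covered T).image f := by
  have hU : covered (T.image (image f)) = (covered T).image f := by
    ext x
    simp only [covered, mem_biUnion, mem_image, id]
    constructor
    · rintro ⟨_, ⟨t, ht, rfl⟩, hx⟩
      obtain ⟨a, ha, rfl⟩ := mem_image.1 hx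
      exact ⟨a, ⟨t, ht, ha⟩, rfl⟩
    · rintro ⟨a, ⟨t, ht, ha⟩, rfl⟩
      exact ⟨_, ⟨t, ht, rfl⟩, mem_image_of_mem f ha⟩
  have hsub : ∀ t ∈ T, t ⊆ covered T := fun t ht => subset_biUnion_of_mem id ht
  refine ⟨⟨?_, ?_, ?_, ?_, subset_univ _, ?_⟩, hU⟩
  · intro t' ht'
    obtain ⟨t, ht, rfl⟩ := mem_image.1 ht'
    refine ⟨fun x hx y hy hxy => ?_, ?_⟩
    · obtain ⟨a, ha, rfl⟩ := mem_image.1 (mem_coe.1 hx)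
      obtain ⟨b, hb, rfl⟩ := mem_image.1 (mem_coe.1 hy)
      exact hadj t ht a ha b hb fun he => hxy (he ▸ rfl)
    · rw [card_image_of_injOn (hf.mono (coe_subset.2 (hsub t ht))), (P.clique t ht).2]
  · intro t₁ h₁ t₂ h₂ hne
    obtain ⟨t, ht, rfl⟩ := mem_image.1 (mem_coe.1 h₁)
    obtain ⟨t', ht', rfl⟩ := mem_image.1 (mem_coe.1 h₂)
    refine disjoint_left.2 fun x hx hx' => hne ?_
    obtain ⟨a, ha, rfl⟩ := mem_image.1 hx
    obtain ⟨b, hb, hab⟩ := mem_image.1 hx'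
    have := hf (hsub t' ht' hb) (hsub t ht ha) hab
    subst this
    rw [P.disj.elim_finset ht ht' b ha hb]
  · intro t' ht'
    obtain ⟨t, ht, rfl⟩ := mem_image.1 ht'
    obtain ⟨s, hs, hsS⟩ := P.meets t ht
    exact ⟨s, mem_image.2 ⟨s, hs, hS s hsS⟩, hsS⟩
  · intro s hs
    rw [hU]
    exact mem_image.2 ⟨s, P.covers hs, hS s hs⟩
  · intro v hv hvS
    have h1 := P.dvd v hv hvS
    have h2 := hmod v hvS
    -- Since `f` is injective on the covered vertices, the new use of a class is the number of
    -- vertices moved into it or kept in it.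
    have h3 : #(cls G S v ∩ covered (T.image (image f))) =
        #((covered T).filter fun a => f a ∈ cls G S v) := by
      rw [hU, ← card_image_of_injOn (hf.mono (coe_subset.2 (filter_subset _ _)))]
      congr 1
      ext x
      simp only [mem_inter, mem_image, mem_filter]
      constructor
      · rintro ⟨hx, a, ha, rfl⟩
        exact ⟨a, ⟨ha, hx⟩, rfl⟩
      · rintro ⟨a, ⟨ha, hx⟩, rfl⟩
        exact ⟨hx, a, ha, rfl⟩
    have h4 : #(cls G S v ∩ covered T) = #((covered T).filter fun a => a ∈ cls G S v) := by
      congr 1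
      ext x
      simp [and_comm]
    have h5 := card_sdiff_add_card_inter (cls G S v) (covered T)
    have h6 := card_sdiff_add_card_inter (cls G S v) (covered (T.image (image f)))
    rw [inter_univ] at h1 ⊢
    unfold Nat.ModEq at h2
    omega

end Packing

/-- A nonempty family of ones and twos whose sum is divisible by three has a subfamily of at most
three members with sum three or six. -/
theorem exists_sum_eq {ι : Type*} [DecidableEq ι] (s : Finset ι) (f : ι → ℕ)
    (hf : ∀ i ∈ s, f i = 1 ∨ f i = 2) (hne : s.Nonempty) (h3 : 3 ∣ ∑ i ∈ s, f i) :
    ∃ g ⊆ s, #g ≤ 3 ∧ (∑ i ∈ g, f i = 3 ∨ ∑ i ∈ g, f i = 6) := by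
  by_cases h1 : ∃ i ∈ s, f i = 1
  · by_cases h2 : ∃ j ∈ s, f j = 2
    · obtain ⟨i, hi, hfi⟩ := h1
      obtain ⟨j, hj, hfj⟩ := h2
      have hij : i ≠ j := by rintro rfl; omega
      refine ⟨{i, j}, by simp [insert_subset_iff, hi, hj], card_le_two.trans (by norm_num), .inl ?_⟩
      rw [sum_pair hij, hfi, hfj]
    · have hall : ∀ i ∈ s, f i = 1 := fun i hi => (hf i hi).resolve_right fun h => h2 ⟨i, hi, h⟩
      rw [sum_congr rfl hall, sum_const, smul_eq_mul, mul_one] at h3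
      obtain ⟨g, hg, hgc⟩ := exists_subset_card_eq (Nat.le_of_dvd (card_pos.2 hne) h3)
      refine ⟨g, hg, hgc.le, .inl ?_⟩
      rw [sum_congr rfl fun i hi => hall i (hg hi), sum_const, hgc]
      rfl
  · have hall : ∀ i ∈ s, f i = 2 := fun i hi => (hf i hi).resolve_left fun h => h1 ⟨i, hi, h⟩
    rw [sum_congr rfl hall, sum_const, smul_eq_mul] at h3
    obtain ⟨g, hg, hgc⟩ := exists_subset_card_eq (s := s) (n := 3)
      (Nat.le_of_dvd (card_pos.2 hne) (by omega))
    refine ⟨g, hg, hgc.le, .inr ?_⟩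
    rw [sum_congr rfl fun i hi => hall i (hg hi), sum_const, hgc]
    rfl

/-- A set `R` of vertices outside `S` that can be removed without changing whether there is a
triangle partition: every class is either marked and loses a multiple of three of its vertices, or
removed, and then it can be replaced by many marked classes. -/
structure Removable (G : SimpleGraph V) (S R : Finset V) (marked : V → Prop) : Prop where
  notMem : ∀ v ∈ R, v ∉ S
  dvd : ∀ v ∉ S, marked v → 3 ∣ #(cls G S v ∩ R)
  lt_card : ∀ v ∈ R, marked v → 2 * #S < #(cls G S v \ R)
  -- Six is the largest number of vertices that an exchange moves into a class at once, and also the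
  -- largest number of vertices of `S` in the triangles involved.
  min_le : ∀ v ∉ S, marked v → min #(cls G S v) 6 ≤ #(cls G S v \ R)
  subset : ∀ v ∉ S, ¬ marked v → cls G S v ⊆ R
  replace : ∀ v ∉ S, ¬ marked v → ∀ X ⊆ S, #X ≤ 6 → (∀ s ∈ X, G.Adj s v) →
    ∃ Q : Finset V, 2 * #S < #Q ∧ (∀ r ∈ Q, ∀ r' ∈ Q, cls G S r = cls G S r' → r = r') ∧
      ∀ r ∈ Q, r ∉ S ∧ marked r ∧ #(cls G S r) ≡ #(cls G S v) [MOD 3] ∧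
        (#(cls G S r) < 6 ↔ #(cls G S v) < 6) ∧ ∀ s ∈ X, G.Adj s r

/-! ### The exchange argument -/

namespace Removable

variable {R : Finset V} {marked : V → Prop} {T : Finset (Finset V)}

/-- Among the many marked classes with the same size modulo three, one is untouched by the packing
and is therefore tiled by itself. Both the original and the reduced graph are covered, because each
direction of the equivalence needs this. -/
theorem three_dvd_card (h : CoversNontwins G S) (hR : Removable G S R marked)
    {W : Finset V} (hW : W = univ ∨ W = univ \ R) (P : Packing G S W T) {v : V} (hv : v ∉ S)
    (hm : ¬ marked v) : 3 ∣ #(cls G S v) := by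
  -- Only the size of the class matters here, so no neighbours in `S` are prescribed.
  obtain ⟨Q, hQ, hinj, hQr⟩ := hR.replace v hv hm ∅ (by simp) (by simp) (by simp)
  obtain ⟨r, hr, hd⟩ := P.exists_disjoint_cls h (fun r hr => (hQr r hr).1) hinj hQ
  obtain ⟨hrS, hrm, hmod, -, -⟩ := hQr r hr
  suffices 3 ∣ #(cls G S r) by
    unfold Nat.ModEq at hmod
    omega
  have hpos : 0 < #(cls G S r) := card_pos.2 ⟨r, self_mem_cls hrS⟩
  rcases hW with rfl | rfl
  · have := P.dvd r (mem_univ _) hrS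
    rwa [inter_univ, sdiff_eq_self_of_disjoint hd] at this
  -- In the reduced graph the packing condition speaks of classes of kept vertices only, and `r`
  -- itself may be removed; a nonempty class keeps at least one vertex.
  · have h1 := hR.min_le r hrS hrm
    obtain ⟨u, hu⟩ := card_pos.1 (show 0 < #(cls G S r \ R) by omega)
    obtain ⟨hu, huR⟩ := mem_sdiff.1 hu
    have h2 := P.dvd u (by simp [huR]) (mem_cls.1 hu).1
    rw [h.cls_eq hrS hu, ← inter_sdiff_assoc, inter_univ,
      sdiff_eq_self_of_disjoint (hd.mono_left sdiff_subset)] at h2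
    have h3 := hR.dvd r hrS hrm
    have h4 := card_sdiff_add_card_inter (cls G S r) R
    omega

/-- The same packing works in the whole graph: marked classes regain a multiple of three, and
unmarked classes return as a whole with a size divisible by three. -/
theorem tiles_univ (h : CoversNontwins G S) (hR : Removable G S R marked)
    (hT : Tiles G (univ \ R)) : Tiles G univ := by
  obtain ⟨T, P⟩ := hT.exists_packing h fun s hs => by simpa using fun hsR => hR.notMem s hsR hs
  refine Packing.tiles h (T := T) ⟨P.clique, P.disj, P.meets, P.covers, subset_univ _, ?_⟩
  intro v _ hvS
  rw [inter_univ]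
  have hUR : Disjoint R (covered T) :=
    (disjoint_sdiff (s := R) (t := univ)).mono_right P.subset
  have h1 : #(cls G S v \ covered T) =
      #((cls G S v \ R) \ covered T) + #(cls G S v ∩ R) := by
    rw [← card_union_of_disjoint]
    · congr 1
      ext x
      have : x ∈ R → x ∉ covered T := fun hx => disjoint_left.1 hUR hx
      simp only [mem_sdiff, mem_union, mem_inter]
      tauto
    · exact disjoint_left.2 fun x hx hx' =>
        (mem_sdiff.1 (mem_sdiff.1 hx).1).2 (mem_inter.1 hx').2
  rw [h1]
  by_cases hm : marked v
  · refine dvd_add ?_ (hR.dvd v hvS hm)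
    obtain hE | ⟨u, hu⟩ := (cls G S v \ R).eq_empty_or_nonempty
    · simp [hE]
    · obtain ⟨hu, huR⟩ := mem_sdiff.1 hu
      have := P.dvd u (by simp [huR]) (mem_cls.1 hu).1
      rwa [h.cls_eq hvS hu, ← inter_sdiff_assoc, inter_univ] at this
  · have hsub := hR.subset v hvS hm
    rw [sdiff_eq_empty_iff_subset.2 hsub, inter_eq_left.2 hsub]
    simpa using hR.three_dvd_card h (.inr rfl) P hvS hm

-- Progress measure of the exchange argument: if `f` moves no vertex into `R` from outside and some
-- vertex out of it, fewer vertices of `R` are used.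
omit [Fintype V] in
theorem _root_.TriangleKernel.card_image_inter_lt {U R : Finset V} {f : V → V}
    (hfR : ∀ a ∈ U, f a ∈ R → a ∈ R) (hex : ∃ a ∈ U, a ∈ R ∧ f a ∉ R) :
    #(U.image f ∩ R) < #(U ∩ R) := by
  obtain ⟨a, ha, haR, hfa⟩ := hex
  calc #(U.image f ∩ R) ≤ #((U.filter fun a => f a ∈ R).image f) := by
        refine card_le_card fun x hx => ?_
        obtain ⟨hx, hxR⟩ := mem_inter.1 hx
        obtain ⟨b, hb, rfl⟩ := mem_image.1 hx
        exact mem_image_of_mem f (mem_filter.2 ⟨hb, hxR⟩)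
    _ ≤ #(U.filter fun a => f a ∈ R) := card_image_le
    _ < #(U ∩ R) := card_lt_card
        ⟨fun b hb => mem_inter.2 ⟨(mem_filter.1 hb).1,
          hfR b (mem_filter.1 hb).1 (mem_filter.1 hb).2⟩,
          fun hs => hfa (mem_filter.1 (hs (mem_inter.2 ⟨ha, haR⟩))).2⟩

/-- A packing that uses a removed class can be changed to use fewer removed vertices. -/
theorem exists_packing_card_lt_of_not_marked (h : CoversNontwins G S)
    (hR : Removable G S R marked) (P : Packing G S univ T) {v : V} (hvU : v ∈ covered T)
    (hvS : v ∉ S) (hm : ¬ marked v) :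
    ∃ T', Packing G S univ T' ∧ #(covered T' ∩ R) < #(covered T ∩ R) := by
  set C := cls G S v with hC
  have hCS : ∀ x ∈ C, x ∉ S := fun x hx => (mem_cls.1 hx).1
  have hCR := hR.subset v hvS hm
  have hcov : ∀ t ∈ T, t ⊆ covered T := fun t ht => subset_biUnion_of_mem id ht
  set TC := T.filter fun t => (t ∩ C).Nonempty with hTC
  have hTCT : ∀ t ∈ TC, t ∈ T := fun t ht => (mem_filter.1 ht).1
  have hsplit : ∀ t ∈ TC, ∀ x ∈ t, x ∉ C → x ∈ S := by
    intro t ht x hx hxC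
    obtain ⟨ht, a, ha⟩ := mem_filter.1 ht
    obtain ⟨hat, haC⟩ := mem_inter.1 ha
    by_contra hxS
    refine hxC ?_
    rw [hC, ← h.cls_eq hvS haC]
    by_cases hxa : x = a
    · exact mem_cls.2 ⟨hxS, .inl hxa⟩
    · exact mem_cls.2 ⟨hxS, .inr ((P.clique t ht).1 hx hat hxa)⟩
  -- The triangle has a vertex in `S`, which leaves at most two for the class.
  have hcard : ∀ t ∈ TC, #(t ∩ C) = 1 ∨ #(t ∩ C) = 2 := by
    intro t ht
    have h1 : 0 < #(t ∩ C) := card_pos.2 (mem_filter.1 ht).2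
    obtain ⟨s, hst, hsS⟩ := P.meets t (hTCT t ht)
    have h2 : #(t ∩ C) ≤ #(t.erase s) := card_le_card fun x hx => mem_erase.2
      ⟨by rintro rfl; exact hCS _ (mem_inter.1 hx).2 hsS, (mem_inter.1 hx).1⟩
    rw [card_erase_of_mem hst, (P.clique t (hTCT t ht)).2] at h2
    omega
  have hdisj : ∀ g ⊆ TC, #(g.biUnion (· ∩ C)) = ∑ t ∈ g, #(t ∩ C) := fun g hg =>
    card_biUnion fun t ht t' ht' hne =>
      (P.disj (hTCT t (hg ht)) (hTCT t' (hg ht')) hne).mono inter_subset_left inter_subset_left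
  have hsum : 3 ∣ ∑ t ∈ TC, #(t ∩ C) := by
    have h1 := hR.three_dvd_card h (.inl rfl) P hvS hm
    have h2 := P.dvd v (mem_univ _) hvS
    rw [inter_univ] at h2
    have h3 := card_sdiff_add_card_inter (cls G S v) (covered T)
    have h4 : cls G S v ∩ covered T = TC.biUnion (· ∩ C) := by
      ext x
      simp only [mem_inter, mem_biUnion, hTC, mem_filter, id]
      constructor
      · rintro ⟨hx, t, ht, hxt⟩
        exact ⟨t, ⟨ht, x, mem_inter.2 ⟨hxt, hx⟩⟩, hxt, hx⟩
      · rintro ⟨t, ⟨ht, -⟩, hxt, hx⟩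
        exact ⟨hx, t, ht, hxt⟩
    rw [← hdisj TC subset_rfl, ← h4]
    omega
  obtain ⟨t₀, ht₀, hvt₀⟩ := mem_biUnion.1 hvU
  -- Moving three or six vertices out of one class and into another changes no residue modulo three,
  -- and three triangles at most are affected.
  obtain ⟨g, hg, hg3, hgsum⟩ := exists_sum_eq TC (fun t => #(t ∩ C)) hcard
    ⟨t₀, mem_filter.2 ⟨ht₀, v, mem_inter.2 ⟨hvt₀, self_mem_cls hvS⟩⟩⟩ hsum
  rw [← hdisj g hg] at hgsum
  set A := g.biUnion (· ∩ C) with hA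
  have hAC : A ⊆ C := biUnion_subset.2 fun t _ => inter_subset_right
  have hAU : A ⊆ covered T := biUnion_subset.2 fun t ht =>
    inter_subset_left.trans (hcov t (hTCT t (hg ht)))
  have hAg : ∀ t ∈ T, ∀ a ∈ t, a ∈ A → t ∈ g := by
    intro t ht a hat haA
    obtain ⟨t', ht', hat'⟩ := mem_biUnion.1 haA
    rwa [P.disj.elim_finset ht (hTCT t' (hg ht')) a hat (mem_inter.1 hat').1]
  set X := g.biUnion (· ∩ S) with hX
  -- At most three triangles have at most nine vertices, and at least three of these lie in the
  -- class.
  have hXc : #X ≤ 6 := by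
    have h1 : #X ≤ ∑ t ∈ g, #(t ∩ S) := card_biUnion_le
    have h2 : ∑ t ∈ g, (#(t ∩ S) + #(t ∩ C)) ≤ ∑ t ∈ g, 3 := sum_le_sum fun t ht => by
      rw [← (P.clique t (hTCT t (hg ht))).2, ← card_union_of_disjoint]
      · exact card_le_card (union_subset inter_subset_left inter_subset_left)
      · exact disjoint_left.2 fun x hx hx' => hCS x (mem_inter.1 hx').2 (mem_inter.1 hx).2
    have h3 : #A = ∑ t ∈ g, #(t ∩ C) := hdisj g hg
    rw [sum_add_distrib, ← h3, sum_const, smul_eq_mul] at h2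
    omega
  have hXadj : ∀ s ∈ X, G.Adj s v := by
    intro s hs
    obtain ⟨t, ht, hst⟩ := mem_biUnion.1 hs
    obtain ⟨hst, hsS⟩ := mem_inter.1 hst
    obtain ⟨htT, a, ha⟩ := mem_filter.1 (hg ht)
    obtain ⟨hat, haC⟩ := mem_inter.1 ha
    exact (h.adj_iff hvS haC hsS).1
      ((P.clique t htT).1 hst hat (by rintro rfl; exact hCS _ haC hsS))
  obtain ⟨Q, hQ, hQinj, hQr⟩ := hR.replace v hvS hm X
    (biUnion_subset.2 fun t _ => inter_subset_right) hXc hXadj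
  obtain ⟨r, hr, hrU⟩ := P.exists_disjoint_cls h (fun r hr => (hQr r hr).1) hQinj hQ
  obtain ⟨hrS, hrm, hmod, hsix, hrX⟩ := hQr r hr
  set D := cls G S r with hD
  -- The size of `D` is a positive multiple of three, which suffices if `#A = 3`. If `#A = 6`, then
  -- `C` has at least six vertices, hence so has `D`, and six of them are kept.
  have hAD : #A ≤ #(D \ R) := by
    have h1 := hR.min_le r hrS hrm
    have h2 : #A ≤ #C := card_le_card hAC
    have h3 := hR.three_dvd_card h (.inl rfl) P hvS hm
    have h4 : 0 < #D := card_pos.2 ⟨r, self_mem_cls hrS⟩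
    change min #D 6 ≤ #(D \ R) at h1
    change 3 ∣ #C at h3
    change #D % 3 = #C % 3 at hmod
    change #D < 6 ↔ #C < 6 at hsix
    omega
  obtain ⟨D', hD', hD'c⟩ := exists_subset_card_eq hAD
  let e : A ≃ D' := equivOfCardEq hD'c.symm
  let f : V → V := fun x => if hx : x ∈ A then e ⟨x, hx⟩ else x
  have hfA : ∀ a ∈ A, f a ∈ D' := fun a ha => by
    simp only [f, dif_pos ha]
    exact (e ⟨a, ha⟩).2
  have hfn : ∀ a, a ∉ A → f a = a := fun a ha => by simp only [f, dif_neg ha]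
  have hfinj : ∀ a ∈ A, ∀ b ∈ A, f a = f b → a = b := fun a ha b hb hab => by
    simp only [f, dif_pos ha, dif_pos hb] at hab
    simpa using e.injective (Subtype.ext hab)
  have hD'D : D' ⊆ D := hD'.trans sdiff_subset
  have hD'U : ∀ x ∈ D', x ∉ covered T := fun x hx => disjoint_left.1 hrU (hD'D hx)
  have hinj : Set.InjOn f (covered T) := by
    intro a ha b hb hab
    by_cases haA : a ∈ A <;> by_cases hbA : b ∈ A
    · exact hfinj a haA b hbA hab
    · rw [hfn b hbA] at hab
      exact absurd hb (hD'U b (hab ▸ hfA a haA))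
    · rw [hfn a haA] at hab
      exact absurd ha (hD'U a (hab ▸ hfA b hbA))
    · rwa [hfn a haA, hfn b hbA] at hab
  have hmixed : ∀ t ∈ T, ∀ a ∈ t, ∀ b ∈ t, a ∈ A → b ∉ A → G.Adj b (f a) := by
    intro t ht a hat b hbt haA hbA
    have htg := hAg t ht a hat haA
    have hbS : b ∈ S := hsplit t (hg htg) b hbt fun hbC =>
      hbA (mem_biUnion.2 ⟨t, htg, mem_inter.2 ⟨hbt, hbC⟩⟩)
    exact (h.adj_iff hrS (hD'D (hfA a haA)) hbS).2
      (hrX b (mem_biUnion.2 ⟨t, htg, mem_inter.2 ⟨hbt, hbS⟩⟩))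
  have hadj : ∀ t ∈ T, ∀ a ∈ t, ∀ b ∈ t, a ≠ b → G.Adj (f a) (f b) := by
    intro t ht a ha b hb hab
    by_cases haA : a ∈ A <;> by_cases hbA : b ∈ A
    · exact h.adj_of_mem_cls hrS (hD'D (hfA a haA)) (hD'D (hfA b hbA)) fun he =>
        hab (hfinj a haA b hbA he)
    · rw [hfn b hbA]
      exact (hmixed t ht a ha b hb haA hbA).symm
    · rw [hfn a haA]
      exact hmixed t ht b hb a ha hbA haA
    · rw [hfn a haA, hfn b hbA]
      exact (P.clique t ht).1 ha hb hab
  -- Outside `A` nothing moves; both `A` and its image lie within a single class and have size three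
  -- or six, so they contribute a multiple of three to every class.
  have hmod' : ∀ u ∉ S, #((covered T).filter fun a => f a ∈ cls G S u) ≡
      #((covered T).filter fun a => a ∈ cls G S u) [MOD 3] := by
    intro u hu
    have hsp : ∀ (p : V → Prop) [DecidablePred p], #((covered T).filter p) =
        #((covered T \ A).filter p) + #(A.filter p) := by
      intro p _
      rw [← card_union_of_disjoint
        (disjoint_filter_filter sdiff_disjoint), ← filter_union, sdiff_union_of_subset hAU]
    have hall : ∀ (φ : V → V) (w : V), w ∉ S → (∀ a ∈ A, φ a ∈ cls G S w) →
        3 ∣ #(A.filter fun a => φ a ∈ cls G S u) := by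
      intro φ w hw hφ
      rcases h.cls_disjoint_or_eq hw hu with he | hd
      · rw [filter_true_of_mem fun a ha => he ▸ hφ a ha]
        omega
      · rw [filter_false_of_mem fun a ha => disjoint_left.1 hd (hφ a ha)]
        simp
    rw [hsp, hsp]
    have h1 := hall f r hrS fun a ha => hD'D (hfA a ha)
    have h2 := hall id v hvS fun a ha => hAC ha
    have h3 : (covered T \ A).filter (fun a => f a ∈ cls G S u) =
        (covered T \ A).filter fun a => a ∈ cls G S u :=
      filter_congr fun a ha => by rw [hfn a (mem_sdiff.1 ha).2]
    rw [h3]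
    simp only [id] at h2
    unfold Nat.ModEq
    omega
  obtain ⟨P', hU'⟩ := P.map (f := f) hinj
    (fun s hs => hfn s fun hsA => hCS s (hAC hsA) hs) hadj hmod'
  have hD'R : ∀ x ∈ D', x ∉ R := fun x hx => (mem_sdiff.1 (hD' hx)).2
  refine ⟨_, P', ?_⟩
  rw [hU']
  obtain ⟨a, ha⟩ := card_pos.1 (show 0 < #A by omega)
  refine card_image_inter_lt (fun b hb hbR => ?_) ⟨a, hAU ha, hCR (hAC ha), hD'R _ (hfA a ha)⟩
  by_cases hbA : b ∈ A
  · exact hCR (hAC hbA)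
  · rwa [hfn b hbA] at hbR

/-- A packing that uses a removed vertex can be changed to use fewer of them. -/
theorem exists_packing_card_lt (h : CoversNontwins G S) (hR : Removable G S R marked)
    (P : Packing G S univ T) (hne : (covered T ∩ R).Nonempty) :
    ∃ T', Packing G S univ T' ∧ #(covered T' ∩ R) < #(covered T ∩ R) := by
  obtain ⟨v, hv⟩ := hne
  obtain ⟨hvU, hvR⟩ := mem_inter.1 hv
  have hvS := hR.notMem v hvR
  by_cases hm : marked v
  · have h1 := hR.lt_card v hvR hm
    -- More than `2 * #S` vertices of this class are kept, so one of them is uncovered; exchanging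
    -- it with its twin `v` leaves the use of every class as it was.
    obtain ⟨w, hw, hwU⟩ : ∃ w ∈ cls G S v \ R, w ∉ covered T := by
      by_contra! hcon
      have : #(cls G S v \ R) ≤ #(covered T \ S) := card_le_card fun w hw =>
        mem_sdiff.2 ⟨hcon w hw, (mem_cls.1 (mem_sdiff.1 hw).1).1⟩
      have := P.card_covered_sdiff_le
      omega
    obtain ⟨hwC, hwR⟩ := mem_sdiff.1 hw
    have hwS := (mem_cls.1 hwC).1
    let f : V → V := fun a => if a = v then w else a
    have hfv : f v = w := if_pos rfl
    have hfne : ∀ a, a ≠ v → f a = a := fun a ha => if_neg ha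
    have hinj : Set.InjOn f (covered T) := by
      intro a ha b hb hab
      by_cases hav : a = v <;> by_cases hbv : b = v
      · rw [hav, hbv]
      · rw [hav, hfv, hfne b hbv] at hab
        exact absurd (hab ▸ hb) hwU
      · rw [hbv, hfv, hfne a hav] at hab
        exact absurd (hab ▸ ha) hwU
      · rwa [hfne a hav, hfne b hbv] at hab
    have hadjw : ∀ b, b ≠ v → b ≠ w → G.Adj v b → G.Adj w b := fun b hbv hbw hvb => by
      rcases (mem_cls.1 hwC).2 with rfl | hwv
      · exact hvb
      · exact (h w v hwS hvS hwv b hbw hbv).2 hvb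
    have hadj' : ∀ t ∈ T, ∀ a ∈ t, ∀ b ∈ t, a ≠ b → G.Adj (f a) (f b) := by
      intro t ht a ha b hb hab
      have hmem : ∀ x ∈ t, x ≠ w := fun x hx hxw =>
        hwU (hxw ▸ mem_biUnion.2 ⟨t, ht, hx⟩)
      have hadj := (P.clique t ht).1 ha hb hab
      by_cases hav : a = v
      · subst hav
        rw [hfv, hfne b hab.symm]
        exact hadjw b hab.symm (hmem b hb) hadj
      · by_cases hbv : b = v
        · subst hbv
          rw [hfv, hfne a hav]
          exact (hadjw a hav (hmem a ha) hadj.symm).symm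
        · rwa [hfne a hav, hfne b hbv]
    have hmod' : ∀ v ∉ S, #((covered T).filter fun a => f a ∈ cls G S v) ≡
        #((covered T).filter fun a => a ∈ cls G S v) [MOD 3] := by
      intro u hu
      refine congrArg (· % 3) (congrArg card (filter_congr fun a ha => ?_))
      by_cases hav : a = v
      · rw [hav, hfv]
        have hiff : ∀ x ∈ cls G S v, (x ∈ cls G S u ↔ cls G S u = cls G S v) := fun x hx =>
          ⟨fun hxu => (h.cls_eq hu hxu).symm.trans (h.cls_eq hvS hx), fun he => he ▸ hx⟩
        rw [hiff w hwC, hiff v (self_mem_cls hvS)]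
      · rw [hfne a hav]
    obtain ⟨P', hU'⟩ := P.map (f := f) hinj
      (fun s hs => hfne s (by rintro rfl; exact hvS hs))
      hadj' hmod'
    refine ⟨_, P', ?_⟩
    rw [hU']
    refine card_image_inter_lt (fun a ha haR => ?_) ⟨v, hvU, hvR, by rwa [hfv]⟩
    by_cases hav : a = v
    · rwa [hav]
    · rwa [hfne a hav] at haR
  · exact hR.exists_packing_card_lt_of_not_marked h P hvU hvS hm

theorem tiles_iff (h : CoversNontwins G S) (hR : Removable G S R marked) :
    Tiles G univ ↔ Tiles G (univ \ R) := by
  refine ⟨fun hT => ?_, hR.tiles_univ h⟩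
  obtain ⟨T₀, P₀⟩ := hT.exists_packing h (subset_univ S)
  -- A packing that covers the fewest removed vertices covers none, or it could be improved.
  obtain ⟨T, hT, hmin⟩ := exists_min_image (univ.filter fun T => Packing G S univ T)
    (fun T => #(covered T ∩ R)) ⟨T₀, by simpa using P₀⟩
  have P : Packing G S univ T := by simpa using hT
  have hUR : covered T ∩ R = ∅ := by
    by_contra hne
    obtain ⟨T', P', hlt⟩ := hR.exists_packing_card_lt h P (nonempty_iff_ne_empty.2 hne)
    have := hmin T' (by simpa using P')
    omega
  have hdis : Disjoint (covered T) R := disjoint_iff_inter_eq_empty.2 hUR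
  refine Packing.tiles h (T := T) ⟨P.clique, P.disj, P.meets, P.covers,
    fun x hx => by simpa using disjoint_left.1 hdis hx, fun v hv hvS => ?_⟩
  have h1 := P.dvd v (mem_univ _) hvS
  have hm : marked v := by
    by_contra hm
    exact (mem_sdiff.1 hv).2 (hR.subset v hvS hm (self_mem_cls hvS))
  have h2 := hR.dvd v hvS hm
  have h3 : #(cls G S v \ covered T) =
      #((cls G S v \ R) \ covered T) + #(cls G S v ∩ R) := by
    rw [← card_union_of_disjoint]
    · congr 1
      ext x
      have : x ∈ R → x ∉ covered T := fun hx => disjoint_right.1 hdis hx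
      simp only [mem_sdiff, mem_union, mem_inter]
      tauto
    · exact disjoint_left.2 fun x hx hx' =>
        (mem_sdiff.1 (mem_sdiff.1 hx).1).2 (mem_inter.1 hx').2
  rw [inter_univ, h3] at h1
  rw [← inter_sdiff_assoc, inter_univ]
  omega

end Removable

end TriangleKernel


/-! ### The vertices that the kernel keeps -/

namespace TriangleKernel

open Finset

open scoped Classical

/-! ### A vertex cover of the nontwin pairs by the high-degree rule -/

section Cover

variable {V : Type*} [Fintype V] [DecidableEq V] (G : SimpleGraph V)

/-- The vertices `u` and `v` are adjacent and no twins. -/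
def Nontwin (u v : V) : Prop :=
  G.Adj u v ∧ ∃ w, w ≠ u ∧ w ≠ v ∧ ¬ (G.Adj u w ↔ G.Adj v w)

/-- The number of neighbours that are no twins. -/
noncomputable def ntDegree (v : V) : ℕ := #(univ.filter fun w => Nontwin G v w)

/-- A cover of the pairs of nontwins: the vertices whose degree in the graph of these pairs is
above `t`, and the neighbours of the other vertices. -/
noncomputable def coverAt (t : ℕ) : Finset V :=
  univ.filter fun v => t < ntDegree G v ∨ ∃ w, Nontwin G v w ∧ ntDegree G w ≤ t

/-- The cover `coverAt G t` is as small as it is when `t` vertices cover all pairs of nontwins. -/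
def Good (t : ℕ) : Prop := #(coverAt G t) ≤ t * t + t

variable {G}

omit [Fintype V] [DecidableEq V] in
theorem Nontwin.symm {u v : V} (h : Nontwin G u v) : Nontwin G v u := by
  obtain ⟨h, w, hu, hv, hw⟩ := h
  exact ⟨h.symm, w, hv, hu, fun h' => hw h'.symm⟩

-- Of a nontwin pair outside the cover, both vertices would have low degree; but then each is the
-- neighbour of a vertex of low degree and belongs to the cover.
omit [DecidableEq V] in
theorem coversNontwins_coverAt (t : ℕ) : CoversNontwins G (coverAt G t) := by
  intro u v hu hv huv w hwu hwv
  by_contra hw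
  have hn : Nontwin G u v := ⟨huv, w, hwu, hwv, hw⟩
  simp only [coverAt, mem_filter, mem_univ, true_and, not_or, not_lt, not_exists, not_and,
    not_le] at hu hv
  have := hu.2 v hn
  omega

/-- A vertex outside `C` has all its nontwin neighbours in `C`, hence low degree. If it is in
`coverAt`, it is therefore a neighbour of a vertex of `C` of degree at most `#C`, and there are at
most `#C * #C` of these. -/
theorem good_card {C : Finset V} (hC : ∀ u v, Nontwin G u v → u ∈ C ∨ v ∈ C) : Good G #C := by
  have hsub : coverAt G #C ⊆ C ∪ (C.filter fun w => ntDegree G w ≤ #C).biUnion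
      fun w => univ.filter fun u => Nontwin G w u := by
    intro v hv
    rw [mem_union]
    by_contra! hcon
    obtain ⟨hvC, hv2⟩ := hcon
    have hN : ∀ w, Nontwin G v w → w ∈ C := fun w hw => (hC v w hw).resolve_left hvC
    rcases (mem_filter.1 hv).2 with h | ⟨w, hw, hdeg⟩
    · have : ntDegree G v ≤ #C := card_le_card fun w hw => hN w (mem_filter.1 hw).2
      omega
    · exact hv2 (mem_biUnion.2 ⟨w, mem_filter.2 ⟨hN w hw, hdeg⟩, by simpa using hw.symm⟩)
  refine (card_le_card hsub).trans ((card_union_le _ _).trans ?_)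
  have := card_biUnion_le_card_mul (C.filter fun w => ntDegree G w ≤ #C)
    (fun w => univ.filter fun u => Nontwin G w u) #C fun w hw => (mem_filter.1 hw).2
  have h2 := Nat.mul_le_mul_right #C (card_filter_le C fun w => ntDegree G w ≤ #C)
  omega

theorem exists_good : ∃ t, Good G t := ⟨#(univ : Finset V), good_card fun u _ _ => .inl (mem_univ u)⟩

variable (G) in
/-- The least number for which the cover is small. -/
noncomputable def threshold : ℕ := Nat.find (exists_good (G := G))

variable (G) in
/-- A small set that covers all pairs of nontwins. -/
noncomputable def cover : Finset V := coverAt G (threshold G)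

theorem coversNontwins_cover : CoversNontwins G (cover G) := coversNontwins_coverAt _

-- Two adjacent vertices outside a twin-cover lie in one component of the rest. They agree on `C` by
-- the second condition of a twin-cover, and on the rest because the component is complete.
omit [Fintype V] in
theorem nontwin_mem_of_isTwinCover {C : Finset V} (hC : IsTwinCover G (C : Set V)) {u v : V}
    (h : Nontwin G u v) : u ∈ C ∨ v ∈ C := by
  by_contra! hcon
  obtain ⟨hu, hv⟩ := hcon
  obtain ⟨huv, w, hwu, hwv, hw⟩ := h
  obtain ⟨hcl, htw⟩ := hC
  let u' : ((C : Set V)ᶜ : Set V) := ⟨u, by simpa using hu⟩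
  let v' : ((C : Set V)ᶜ : Set V) := ⟨v, by simpa using hv⟩
  have huv' : (G.induce (C : Set V)ᶜ).Adj u' v' := huv
  apply hw
  by_cases hwC : w ∈ C
  · have := Set.ext_iff.1 (htw u' v' huv'.reachable) w
    simpa [hwC, u', v'] using this
  · let w' : ((C : Set V)ᶜ : Set V) := ⟨w, by simpa using hwC⟩
    constructor
    · intro h
      have h' : (G.induce (C : Set V)ᶜ).Adj u' w' := h
      exact hcl v' w' (huv'.symm.reachable.trans h'.reachable) fun he =>
        hwv (congrArg Subtype.val he).symm
    · intro h
      have h' : (G.induce (C : Set V)ᶜ).Adj v' w' := h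
      exact hcl u' w' (huv'.reachable.trans h'.reachable) fun he =>
        hwu (congrArg Subtype.val he).symm

theorem card_cover_le : #(cover G) ≤ twinCoverNumber G * twinCoverNumber G + twinCoverNumber G := by
  obtain ⟨C, hC, htc⟩ := exists_twinCover_card_eq G
  have h1 : threshold G ≤ twinCoverNumber G :=
    Nat.find_min' _ (hC ▸ good_card fun u v h => nontwin_mem_of_isTwinCover htc h)
  have h2 : Good G (threshold G) := Nat.find_spec (exists_good (G := G))
  exact h2.trans (Nat.add_le_add (Nat.mul_le_mul h1 h1) h1)

end Cover

/-- In a finite linear order, `m` members have fewer than `m` smaller members. -/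
theorem card_filter_rank_lt {α : Type*} [LinearOrder α] (C : Finset α) {m : ℕ} (hm : m ≤ #C) :
    #(C.filter fun u => #(C.filter fun w => w < u) < m) = m := by
  have hlt : ∀ u ∈ C, ∀ v ∈ C, u < v →
      #(C.filter fun w => w < u) < #(C.filter fun w => w < v) := fun u hu v hv huv =>
    card_lt_card ⟨fun w hw => mem_filter.2 ⟨(mem_filter.1 hw).1, (mem_filter.1 hw).2.trans huv⟩,
      fun hs => lt_irrefl u (mem_filter.1 (hs (mem_filter.2 ⟨hu, huv⟩))).2⟩
  have hinj : Set.InjOn (fun u => #(C.filter fun w => w < u)) C := by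
    intro u hu v hv huv
    rcases lt_trichotomy u v with h | h | h
    · exact absurd huv (hlt u hu v hv h).ne
    · exact h
    · exact absurd huv (hlt v hv u hu h).ne'
  have hmaps : Set.MapsTo (fun u => #(C.filter fun w => w < u)) C (range #C) := fun u hu =>
    mem_coe.2 (mem_range.2 (card_lt_card ⟨filter_subset _ _, fun hs =>
      lt_irrefl u (mem_filter.1 (hs hu)).2⟩))
  have himg : C.image (fun u => #(C.filter fun w => w < u)) = range #C :=
    eq_of_subset_of_card_le (image_subset_iff.2 hmaps) (by rw [card_image_of_injOn hinj, card_range])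
  rw [← card_image_of_injOn (hinj.mono (coe_subset.2 (filter_subset _ _)))]
  have : (C.filter fun u => #(C.filter fun w => w < u) < m).image
      (fun u => #(C.filter fun w => w < u)) = range m := by
    ext i
    simp only [mem_image, mem_filter, mem_range]
    constructor
    · rintro ⟨u, ⟨_, h⟩, rfl⟩
      exact h
    · intro hi
      obtain ⟨u, hu, rfl⟩ := mem_image.1 (himg ▸ mem_range.2 (by omega : i < #C))
      exact ⟨u, ⟨hu, hi⟩, rfl⟩
  rw [this, card_range]

/-! ### Marked classes, removed vertices, and the number of kept vertices -/

section Kernel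

variable {n : ℕ} (G : SimpleGraph (Fin n)) (S : Finset (Fin n))

/-- The position of `v` in its class. -/
noncomputable def rank (v : Fin n) : ℕ := #((cls G S v).filter fun w => w < v)

/-- The vertex `v` is the first one of its class. -/
def IsRep (v : Fin n) : Prop := v ∉ S ∧ ∀ u ∈ cls G S v, ¬ u < v

/-- All those vertices `x i` that lie in `S` are adjacent to `v`. -/
def Sees (x : Fin 6 → Fin n) (v : Fin n) : Prop := ∀ i, x i ∈ S → G.Adj (x i) v

/-- The classes of `u` and `v` have the same size modulo three, and both have at least six members
or both do not. -/
def SameType (u v : Fin n) : Prop :=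
  #(cls G S u) ≡ #(cls G S v) [MOD 3] ∧ (#(cls G S u) < 6 ↔ #(cls G S v) < 6)

/-- The classes before the class of `r` that have the same type and see the `x i`. -/
noncomputable def earlier (r : Fin n) (x : Fin 6 → Fin n) : Finset (Fin n) :=
  univ.filter fun u => u < r ∧ IsRep G S u ∧ SameType G S u r ∧ Sees G S x u

/-- The number of classes, and of vertices in a class, that suffice for all purposes. -/
def bound : ℕ := 2 * #S + 6

/-- The class of `v` is among the first ones that see some choice of at most six vertices. -/
def Marked (v : Fin n) : Prop :=
  ∃ r ∈ cls G S v, IsRep G S r ∧ ∃ x, Sees G S x r ∧ #(earlier G S r x) < bound S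

/-- The vertices removed: the classes that are not marked, and the largest multiple of three that
leaves enough vertices in the marked ones. -/
noncomputable def removed : Finset (Fin n) :=
  univ.filter fun v => v ∉ S ∧
    (¬ Marked G S v ∨ ∃ q, rank G S v < 3 * q ∧ 3 * q + bound S ≤ #(cls G S v))

variable {G S}

theorem SameType.trans {u v w : Fin n} (huv : SameType G S u v) (hvw : SameType G S v w) :
    SameType G S u w :=
  ⟨huv.1.trans hvw.1, huv.2.trans hvw.2⟩

theorem IsRep.eq_of_cls_eq {r r' : Fin n} (hr : IsRep G S r) (hr' : IsRep G S r')
    (he : cls G S r = cls G S r') : r = r' := by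
  have h1 : r ∈ cls G S r' := he ▸ self_mem_cls hr.1
  have h2 : r' ∈ cls G S r := he ▸ self_mem_cls hr'.1
  exact le_antisymm (not_lt.1 (hr.2 r' h2)) (not_lt.1 (hr'.2 r h1))

/-- Smaller sets are padded with a vertex outside `S`, which `Sees` ignores. Tuples of fixed length
can be searched by a fixed number of nested loops. -/
theorem exists_tuple {X : Finset (Fin n)} (hX : #X ≤ 6) {v : Fin n} (hv : v ∉ S) :
    ∃ x : Fin 6 → Fin n, (∀ i, x i ∈ S → x i ∈ X) ∧ ∀ s ∈ X, ∃ i, x i = s := by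
  refine ⟨fun i => if hi : i.1 < #X then X.equivFin.symm ⟨i, hi⟩ else v, fun i => ?_, fun s hs => ?_⟩
  · dsimp only
    split
    · exact fun _ => (X.equivFin.symm _).2
    · exact fun hvS => absurd hvS hv
  · refine ⟨⟨X.equivFin ⟨s, hs⟩, (X.equivFin ⟨s, hs⟩).2.trans_le hX⟩, ?_⟩
    simp

variable (h : CoversNontwins G S)
include h

theorem exists_isRep {v : Fin n} (hv : v ∉ S) : ∃ r ∈ cls G S v, IsRep G S r := by
  have hne : (cls G S v).Nonempty := ⟨v, self_mem_cls hv⟩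
  refine ⟨(cls G S v).min' hne, min'_mem _ hne, (mem_cls.1 (min'_mem _ hne)).1, fun u hu => ?_⟩
  rw [h.cls_eq hv (min'_mem _ hne)] at hu
  exact not_lt.2 (min'_le _ u hu)

theorem marked_iff {u v : Fin n} (hv : v ∉ S) (hu : u ∈ cls G S v) :
    Marked G S u ↔ Marked G S v := by
  unfold Marked
  rw [h.cls_eq hv hu]

theorem rank_eq {u v : Fin n} (hv : v ∉ S) (hu : u ∈ cls G S v) :
    rank G S u = #((cls G S v).filter fun w => w < u) := by
  unfold rank
  rw [h.cls_eq hv hu]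

/-- The largest admissible `q` is `(#(cls G S v) - bound S) / 3`. With truncated subtraction this is
zero for small classes, from which nothing is removed. -/
theorem cls_inter_removed {v : Fin n} (hv : v ∉ S) (hm : Marked G S v) :
    cls G S v ∩ removed G S = (cls G S v).filter fun u =>
      #((cls G S v).filter fun w => w < u) < 3 * ((#(cls G S v) - bound S) / 3) := by
  ext u
  rw [mem_inter, mem_filter]
  refine and_congr_right fun hu => ?_
  have huS := (mem_cls.1 hu).1
  simp only [removed, mem_filter, mem_univ, true_and, huS, not_false_eq_true,
    (marked_iff h hv hu).2 hm, not_true_eq_false, false_or]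
  rw [h.cls_eq hv hu, rank_eq h hv hu]
  constructor
  · rintro ⟨q, h1, h2⟩
    omega
  · intro h1
    exact ⟨_, h1, by omega⟩

theorem card_cls_inter_removed {v : Fin n} (hv : v ∉ S) (hm : Marked G S v) :
    #(cls G S v ∩ removed G S) = 3 * ((#(cls G S v) - bound S) / 3) := by
  rw [cls_inter_removed h hv hm, card_filter_rank_lt _ (by omega)]

theorem removable_removed : Removable G S (removed G S) (Marked G S) where
  notMem v hv := (mem_filter.1 hv).2.1
  dvd v hv hm := by
    rw [card_cls_inter_removed h hv hm]
    exact dvd_mul_right _ _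
  lt_card v hv hm := by
    have hvS := (mem_filter.1 hv).2.1
    have h1 := card_cls_inter_removed h hvS hm
    have h2 := card_sdiff_add_card_inter (cls G S v) (removed G S)
    have h3 : 0 < #(cls G S v ∩ removed G S) := card_pos.2 ⟨v, mem_inter.2 ⟨self_mem_cls hvS, hv⟩⟩
    unfold bound at h1
    omega
  min_le v hv hm := by
    have h1 := card_cls_inter_removed h hv hm
    have h2 := card_sdiff_add_card_inter (cls G S v) (removed G S)
    unfold bound at h1
    omega
  subset v hv hm u hu := mem_filter.2 ⟨mem_univ _, (mem_cls.1 hu).1,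
    .inl fun hm' => hm ((marked_iff h hv hu).1 hm')⟩
  replace v hv hm X hXS hX hXv := by
    obtain ⟨x, hx, hxX⟩ := exists_tuple hX hv
    obtain ⟨r, hr, hrep⟩ := exists_isRep h hv
    have hrv := h.cls_eq hv hr
    have hsees : Sees G S x r := fun i hi => (h.adj_iff hv hr hi).2 (hXv _ (hx i hi))
    -- The classes before `r` need not be marked themselves. The first class with at least `bound S`
    -- predecessors of its kind is taken instead: by minimality each of its predecessors has fewer,
    -- so it is marked on account of `x`.
    have hne : (univ.filter fun u => IsRep G S u ∧ SameType G S u r ∧ Sees G S x u ∧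
        bound S ≤ #(earlier G S u x)).Nonempty :=
      ⟨r, mem_filter.2 ⟨mem_univ _, hrep, ⟨rfl, Iff.rfl⟩, hsees,
        not_lt.1 fun hlt => hm ⟨r, hr, hrep, x, hsees, hlt⟩⟩⟩
    have hmin := min'_mem _ hne
    have hleast := min'_le (univ.filter fun u => IsRep G S u ∧ SameType G S u r ∧ Sees G S x u ∧
        bound S ≤ #(earlier G S u x))
    set r₁ := min' _ hne
    obtain ⟨-, hrep₁, htype₁, hsees₁, hcard₁⟩ := mem_filter.1 hmin
    refine ⟨earlier G S r₁ x, by unfold bound at hcard₁; omega, ?_, ?_⟩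
    · intro a ha b hb hab
      exact (mem_filter.1 ha).2.2.1.eq_of_cls_eq (mem_filter.1 hb).2.2.1 hab
    · intro a ha
      obtain ⟨-, halt, harep, hatype, hasees⟩ := mem_filter.1 ha
      have hatype' := hatype.trans htype₁
      refine ⟨harep.1, ⟨a, self_mem_cls harep.1, harep, x, hasees, ?_⟩, hrv ▸ hatype'.1,
        hrv ▸ hatype'.2, fun s hs => ?_⟩
      · by_contra hcon
        exact absurd halt (not_lt.2 (hleast a (mem_filter.2
          ⟨mem_univ _, harep, hatype', hasees, not_lt.1 hcon⟩)))
      · obtain ⟨i, rfl⟩ := hxX s hs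
        exact hasees i (hXS hs)

theorem rank_lt_rank {u v : Fin n} (hv : v ∉ S) (hu : u ∈ cls G S v) (huv : u < v) :
    rank G S u < rank G S v := by
  rw [rank_eq h hv hu, rank_eq h hv (self_mem_cls hv)]
  exact card_lt_card ⟨fun w hw => mem_filter.2 ⟨(mem_filter.1 hw).1, (mem_filter.1 hw).2.trans huv⟩,
    fun hs => lt_irrefl u (mem_filter.1 (hs (mem_filter.2 ⟨hu, huv⟩))).2⟩

/-- A kept vertex outside `S` is determined by a code: the trace on `S` of a tuple that marks its
class, the type of the class, the number of earlier classes of that kind, and the position of the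
vertex counted from the end of the class. The factors of the bound count the values of these
entries. -/
theorem card_compl_removed_le :
    #(univ \ removed G S) ≤ #S + (#S + 1) ^ 6 * (3 * (2 * (bound S * (bound S + 3)))) := by
  have hsub : univ \ removed G S ⊆ S ∪ ((univ \ removed G S) \ S) := fun v hv => by
    by_cases hvS : v ∈ S
    · exact mem_union_left _ hvS
    · exact mem_union_right _ (mem_sdiff.2 ⟨hv, hvS⟩)
  refine (card_le_card hsub).trans ((card_union_le _ _).trans (Nat.add_le_add_left ?_ _))
  have hkept : ∀ v ∈ (univ \ removed G S) \ S, v ∉ S ∧ Marked G S v ∧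
      #(cls G S v) - 1 - rank G S v < bound S + 3 ∧ rank G S v < #(cls G S v) := by
    intro v hv
    obtain ⟨hv, hvS⟩ := mem_sdiff.1 hv
    have hv := (mem_sdiff.1 hv).2
    simp only [removed, mem_filter, mem_univ, true_and, hvS, not_false_eq_true, not_or, not_not,
      not_exists, not_and, not_le] at hv
    refine ⟨hvS, hv.1, ?_, card_lt_card ⟨filter_subset _ _, fun hs =>
      lt_irrefl v (mem_filter.1 (hs (self_mem_cls hvS))).2⟩⟩
    -- This is the least `q` with `rank G S v < 3 * q`; rounding to a multiple of three costs at
    -- most three vertices beyond the bound.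
    have := hv.2 (rank G S v / 3 + 1) (by omega)
    omega
  have hchoose : ∀ v ∈ (univ \ removed G S) \ S, ∃ p : Fin n × (Fin 6 → Fin n),
      p.1 ∈ cls G S v ∧ IsRep G S p.1 ∧ Sees G S p.2 p.1 ∧
        #(earlier G S p.1 p.2) < bound S := fun v hv => by
    obtain ⟨r, hr, hrep, x, hx, hlt⟩ := (hkept v hv).2.1
    exact ⟨(r, x), hr, hrep, hx, hlt⟩
  rcases isEmpty_or_nonempty (Fin n) with hemp | hnonemp
  · simp [eq_empty_of_isEmpty]
  choose! p hpr hprep hpsees hplt using hchoose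
  -- Forgetting the entries outside `S`, which do not influence `Sees`, leaves only `#S + 1` values
  -- per entry.
  let y : (Fin 6 → Fin n) → Fin 6 → Option (Fin n) := fun x i => if x i ∈ S then some (x i) else none
  have hy : ∀ x x' : Fin 6 → Fin n, y x = y x' → ∀ u, Sees G S x u → Sees G S x' u := by
    intro x x' he u hu i hi
    have := congrFun he i
    simp only [y, hi, if_true] at this
    split at this
    · rename_i hxi
      rw [← Option.some_injective _ this]
      exact hu i hxi
    · simp at this
  have hle := card_le_card_of_injOn (s := (univ \ removed G S) \ S)
    (t := Fintype.piFinset (fun _ : Fin 6 => insertNone S) ×ˢ (range 3 ×ˢ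
      ((univ : Finset Bool) ×ˢ (range (bound S) ×ˢ range (bound S + 3)))))
    (fun v => (y (p v).2, #(cls G S v) % 3, decide (#(cls G S v) < 6),
      #(earlier G S (p v).1 (p v).2), #(cls G S v) - 1 - rank G S v)) ?_ ?_
  · simpa [card_product, Fintype.card_piFinset] using hle
  · intro v hv
    simp only [coe_product, Set.mem_prod, mem_coe, Fintype.mem_piFinset, mem_range, mem_univ]
    refine ⟨fun i => ?_, Nat.mod_lt _ (by norm_num), trivial, hplt v hv, (hkept v hv).2.2.1⟩
    simp only [y]
    split <;> simp_all
  -- With the same trace and type, a class and all its predecessors precede any later class, so the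
  -- later one has strictly more predecessors.
  · have key : ∀ v ∈ (univ \ removed G S) \ S, ∀ v' ∈ (univ \ removed G S) \ S,
        y (p v).2 = y (p v').2 → #(cls G S v) % 3 = #(cls G S v') % 3 →
        decide (#(cls G S v) < 6) = decide (#(cls G S v') < 6) →
        #(earlier G S (p v).1 (p v).2) = #(earlier G S (p v').1 (p v').2) →
        ¬ (p v).1 < (p v').1 := by
      intro v hv v' hv' h1 h2 h3 h4 hlt
      have ht : SameType G S (p v).1 (p v').1 := by
        unfold SameType Nat.ModEq
        rw [h.cls_eq (hkept v hv).1 (hpr v hv), h.cls_eq (hkept v' hv').1 (hpr v' hv')]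
        exact ⟨h2, by simpa using h3⟩
      refine (card_lt_card (⟨fun u hu => ?_, fun hs => ?_⟩ : earlier G S (p v).1 (p v).2 ⊂
        earlier G S (p v').1 (p v').2)).ne h4
      · obtain ⟨-, hu1, hu2, hu3, hu4⟩ := mem_filter.1 hu
        exact mem_filter.2 ⟨mem_univ _, hu1.trans hlt, hu2, hu3.trans ht, hy _ _ h1 u hu4⟩
      · have : (p v).1 ∈ earlier G S (p v').1 (p v').2 := mem_filter.2 ⟨mem_univ _, hlt,
          hprep v hv, ht, hy _ _ h1 _ (hpsees v hv)⟩
        exact lt_irrefl _ (mem_filter.1 (hs this)).2.1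
    intro v hv v' hv' he
    simp only [Prod.mk.injEq] at he
    obtain ⟨h1, h2, h3, h4, h5⟩ := he
    have hpp : (p v).1 = (p v').1 := le_antisymm
      (not_lt.1 (key v' hv' v hv h1.symm h2.symm h3.symm h4.symm))
      (not_lt.1 (key v hv v' hv' h1 h2 h3 h4))
    have hcls : cls G S v = cls G S v' := by
      rw [← h.cls_eq (hkept v hv).1 (hpr v hv), ← h.cls_eq (hkept v' hv').1 (hpr v' hv'), hpp]
    have hr1 := (hkept v hv).2.2.2
    have hr2 := (hkept v' hv').2.2.2
    rw [hcls] at h5 hr1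
    have hvv' : v ∈ cls G S v' := hcls ▸ self_mem_cls (hkept v hv).1
    have hv'v : v' ∈ cls G S v := hcls ▸ self_mem_cls (hkept v' hv').1
    rcases lt_trichotomy v v' with hlt | heq | hlt
    · have := rank_lt_rank h (hkept v' hv').1 hvv' hlt
      omega
    · exact heq
    · have := rank_lt_rank h (hkept v hv).1 hv'v hlt
      omega

end Kernel

end TriangleKernel


/-! ### A graph with known twin-cover number -/

namespace TriangleKernel

open Finset

open scoped Classical

/-! ### Tilings under embeddings and disjoint unions -/

section Tiles

variable {V W : Type*} [DecidableEq V] [DecidableEq W]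

/-- Disjoint triangles that cover everything number a third of the vertices, so `k` is forced and
only its comparison with the order of the graph matters. -/
theorem hasTrianglePartition_iff [Fintype V] (G : SimpleGraph V) (k : ℕ) :
    HasTrianglePartition G k ↔ k = Fintype.card V ∧ Tiles G univ := by
  have hcard : ∀ T : Finset (Finset V), (∀ t ∈ T, G.IsNClique 3 t) →
      (T : Set (Finset V)).PairwiseDisjoint id → #(T.biUnion id) = 3 * #T := fun T hT hd => by
    rw [card_biUnion (fun t ht t' ht' hne => hd ht ht' hne),
      sum_congr rfl fun t ht => show #(id t) = 3 from (hT t ht).2, sum_const, smul_eq_mul,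
      Nat.mul_comm]
  constructor
  · rintro ⟨T, hT, hd, hk, hU⟩
    have hU' : T.biUnion id = univ := eq_univ_of_forall fun v => by simpa using hU v
    have := hcard T hT hd
    rw [hU', card_univ] at this
    exact ⟨by omega, T, hT, hd, hU'⟩
  · rintro ⟨hk, T, hT, hd, hU⟩
    have := hcard T hT hd
    rw [hU, card_univ] at this
    refine ⟨T, hT, hd, by omega, fun v => ?_⟩
    simpa using (hU ▸ mem_univ v : v ∈ T.biUnion id)

theorem tiles_map {G : SimpleGraph W} (e : V ↪ W) (A : Finset V) :
    Tiles G (A.map e) ↔ Tiles (G.comap e) A := by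
  constructor
  · rintro ⟨T, hT, hd, hU⟩
    have hsub : ∀ t ∈ T, t ⊆ A.map e := fun t ht => hU ▸ subset_biUnion_of_mem id ht
    have hpre : ∀ t ∈ T, (A.filter fun a => e a ∈ t).map e = t := by
      intro t ht
      ext x
      simp only [mem_map, mem_filter]
      constructor
      · rintro ⟨a, ⟨-, ha⟩, rfl⟩
        exact ha
      · intro hx
        obtain ⟨a, ha, rfl⟩ := mem_map.1 (hsub t ht hx)
        exact ⟨a, ⟨ha, hx⟩, rfl⟩
    refine ⟨T.image fun t => A.filter fun a => e a ∈ t, ?_, ?_, ?_⟩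
    · intro t' ht'
      obtain ⟨t, ht, rfl⟩ := mem_image.1 ht'
      refine ⟨fun a ha b hb hab => ?_, ?_⟩
      · exact (hT t ht).1 (mem_filter.1 (mem_coe.1 ha)).2 (mem_filter.1 (mem_coe.1 hb)).2
          (e.injective.ne hab)
      · rw [← card_map e, hpre t ht, (hT t ht).2]
    · intro t₁ h₁ t₂ h₂ hne
      obtain ⟨t, ht, rfl⟩ := mem_image.1 (mem_coe.1 h₁)
      obtain ⟨t', ht', rfl⟩ := mem_image.1 (mem_coe.1 h₂)
      refine disjoint_left.2 fun a ha ha' => hne ?_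
      rw [hd.elim_finset ht ht' (e a) (mem_filter.1 ha).2 (mem_filter.1 ha').2]
    · ext a
      simp only [mem_biUnion, mem_image, id]
      constructor
      · rintro ⟨_, ⟨t, ht, rfl⟩, ha⟩
        exact (mem_filter.1 ha).1
      · intro ha
        obtain ⟨t, ht, hat⟩ := mem_biUnion.1 (hU ▸ mem_map_of_mem e ha)
        exact ⟨_, ⟨t, ht, rfl⟩, mem_filter.2 ⟨ha, hat⟩⟩
  · rintro ⟨T, hT, hd, hU⟩
    refine ⟨T.image fun t => t.map e, ?_, ?_, ?_⟩
    · intro t' ht'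
      obtain ⟨t, ht, rfl⟩ := mem_image.1 ht'
      refine ⟨fun x hx y hy hxy => ?_, by rw [card_map, (hT t ht).2]⟩
      obtain ⟨a, ha, rfl⟩ := mem_map.1 (mem_coe.1 hx)
      obtain ⟨b, hb, rfl⟩ := mem_map.1 (mem_coe.1 hy)
      exact (hT t ht).1 ha hb fun hab => hxy (hab ▸ rfl)
    · intro t₁ h₁ t₂ h₂ hne
      obtain ⟨t, ht, rfl⟩ := mem_image.1 (mem_coe.1 h₁)
      obtain ⟨t', ht', rfl⟩ := mem_image.1 (mem_coe.1 h₂)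
      exact (disjoint_map e).2 (hd ht ht' fun he => hne (he ▸ rfl))
    · rw [← hU]
      ext x
      simp only [mem_biUnion, mem_image, id, mem_map]
      constructor
      · rintro ⟨_, ⟨t, ht, rfl⟩, hx⟩
        obtain ⟨a, ha, rfl⟩ := mem_map.1 hx
        exact ⟨a, ⟨t, ht, ha⟩, rfl⟩
      · rintro ⟨a, ⟨t, ht, ha⟩, rfl⟩
        exact ⟨_, ⟨t, ht, rfl⟩, mem_map_of_mem e ha⟩

theorem Tiles.union {G : SimpleGraph V} {A B : Finset V} (hA : Tiles G A) (hB : Tiles G B)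
    (hd : Disjoint A B) : Tiles G (A ∪ B) := by
  obtain ⟨T, hT, hTd, rfl⟩ := hA
  obtain ⟨T', hT', hTd', rfl⟩ := hB
  refine ⟨T ∪ T', fun t ht => (mem_union.1 ht).elim (hT t) (hT' t), ?_, union_biUnion ..⟩
  rw [coe_union]
  exact hTd.union hTd' fun t ht t' ht' _ =>
    (hd.mono (subset_biUnion_of_mem id ht) (subset_biUnion_of_mem id ht') : Disjoint t t')

theorem tiles_of_isNClique {G : SimpleGraph V} {t : Finset V} (ht : G.IsNClique 3 t) :
    Tiles G t :=
  ⟨{t}, by simpa using ht, by simp, by simp⟩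

end Tiles

/-! ### Two triangles attached to every vertex -/

variable {n : ℕ}

/-- Adjacency between the copies of a vertex: copy `0` is adjacent to all others, and the others
form two triangles. -/
def Side (c d : Fin 7) : Prop := c ≠ d ∧ (c = 0 ∨ d = 0 ∨ (c < 4 ↔ d < 4))

instance : DecidableRel Side := fun _ _ => inferInstanceAs (Decidable (_ ∧ _))

theorem Side.symm : ∀ {c d : Fin 7}, Side c d → Side d c := by decide

/-- The graph that arises from `G` when two triangles are attached to every vertex. -/
def gadget (G : SimpleGraph (Fin n)) : SimpleGraph (Fin n × Fin 7) where
  Adj a b := (a.2 = 0 ∧ b.2 = 0 ∧ G.Adj a.1 b.1) ∨ (a.1 = b.1 ∧ Side a.2 b.2)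
  symm := ⟨by
    rintro a b (⟨h1, h2, h3⟩ | ⟨h1, h2⟩)
    · exact .inl ⟨h2, h1, h3.symm⟩
    · exact .inr ⟨h1.symm, h2.symm⟩⟩
  loopless := ⟨by
    rintro a (⟨_, _, h⟩ | ⟨_, h, _⟩)
    · exact G.loopless.irrefl _ h
    · exact h rfl⟩

variable {G : SimpleGraph (Fin n)}

theorem gadget_adj {a b : Fin n × Fin 7} : (gadget G).Adj a b ↔
    (a.2 = 0 ∧ b.2 = 0 ∧ G.Adj a.1 b.1) ∨ (a.1 = b.1 ∧ Side a.2 b.2) := Iff.rfl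

/-- The vertices of `G` in the larger graph. -/
def base : Fin n ↪ Fin n × Fin 7 := ⟨fun u => (u, 0), fun _ _ h => (Prod.mk.inj h).1⟩

theorem base_apply (u : Fin n) : base u = (u, 0) := rfl

theorem gadget_comap_base : (gadget G).comap base = G := by
  ext u v
  simp [gadget_adj, base_apply, Side]

theorem isNClique_singleton_product (u : Fin n) {t : Finset (Fin 7)} (ht : #t = 3)
    (hs : ∀ c ∈ t, ∀ d ∈ t, c ≠ d → Side c d) : (gadget G).IsNClique 3 ({u} ×ˢ t) := by
  refine ⟨fun a ha b hb hab => ?_, by simp [ht]⟩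
  simp only [coe_product, coe_singleton, Set.mem_prod, Set.mem_singleton_iff, mem_coe] at ha hb
  refine gadget_adj.2 (.inr ⟨ha.1.trans hb.1.symm, hs _ ha.2 _ hb.2 fun h => hab ?_⟩)
  exact Prod.ext (ha.1.trans hb.1.symm) h

theorem tiles_product_attached (W : Finset (Fin n)) :
    Tiles (gadget G) (W ×ˢ ({1, 2, 3} ∪ {4, 5, 6})) := by
  induction W using Finset.induction_on with
  | empty => exact ⟨∅, by simp, by simp, by simp⟩
  | insert u W hu ih =>
    have h1 := tiles_of_isNClique (isNClique_singleton_product (G := G) u (t := {1, 2, 3})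
      (by decide) (by decide))
    have h2 := tiles_of_isNClique (isNClique_singleton_product (G := G) u (t := {4, 5, 6})
      (by decide) (by decide))
    have h3 := (h1.union h2 (disjoint_product.2 (.inr (by decide)))).union ih (by
      rw [← product_union]
      exact disjoint_product.2 (.inl (disjoint_singleton_left.2 hu)))
    rwa [← product_union, ← union_product, ← insert_eq] at h3

/-- The closed neighbourhood of an attached vertex. -/
theorem mem_of_gadget_adj {a b : Fin n × Fin 7} (ha : a.2 ≠ 0) (h : (gadget G).Adj a b) :
    b.1 = a.1 ∧ (b.2 = 0 ∨ (a.2 < 4 ↔ b.2 < 4)) := by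
  rcases h with ⟨h, -⟩ | ⟨h1, -, h2⟩
  · exact absurd h ha
  · exact ⟨h1.symm, h2.resolve_left ha⟩

/-- Attached triangles can be used as they are. Conversely no triangle of a tiling joins a vertex
`(u, 0)` to an attached vertex, so the triangles through vertices of the form `(u, 0)` tile the
original part. -/
theorem tiles_gadget_iff (W : Finset (Fin n)) :
    Tiles (gadget G) (W ×ˢ univ) ↔ Tiles G W := by
  have hbase : W.map base = W ×ˢ ({0} : Finset (Fin 7)) := by
    ext ⟨u, c⟩
    simp only [mem_map, base_apply, mem_product, mem_singleton, Prod.mk.injEq]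
    exact ⟨fun ⟨_, hw, h1, h2⟩ => ⟨h1 ▸ hw, h2.symm⟩, fun ⟨h1, h2⟩ => ⟨u, h1, rfl, h2.symm⟩⟩
  rw [← gadget_comap_base (G := G), ← tiles_map, gadget_comap_base]
  constructor
  · rintro ⟨T, hT, hd, hU⟩
    have hmem : ∀ a ∈ W ×ˢ (univ : Finset (Fin 7)), ∃ t ∈ T, a ∈ t := fun a ha => by
      simpa using (hU ▸ ha : a ∈ T.biUnion id)
    have hzero : ∀ t ∈ T, ∀ u, (u, 0) ∈ t → ∀ b ∈ t, b.2 = 0 := by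
      intro t ht u hu b hb
      by_contra hb0
      have hne : b ≠ (u, 0) := fun he => hb0 (he ▸ rfl)
      have hbu := (mem_of_gadget_adj hb0 ((hT t ht).1 hb hu hne)).1
      have huW : u ∈ W := by
        have : ((u, 0) : Fin n × Fin 7) ∈ W ×ˢ univ :=
          hU ▸ subset_biUnion_of_mem id ht hu
        simpa using this
      -- The closed neighbourhood of the attached vertex `b`: its triangle and `(u, 0)`. A triangle
      -- of the tiling through `b` and `(u, 0)` leaves one attached vertex of `N`, whose own
      -- triangle would also have to fit into these four vertices.
      let N : Finset (Fin n × Fin 7) :=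
        {u} ×ˢ univ.filter fun d => d = 0 ∨ (b.2 < 4 ↔ d < 4)
      have hN : #N = 4 := by
        have : ∀ c : Fin 7, c ≠ 0 → #(univ.filter fun d : Fin 7 => d = 0 ∨ (c < 4 ↔ d < 4)) = 4 := by
          decide
        simpa [N] using this b.2 hb0
      have hsub : ∀ t ∈ T, ∀ a ∈ t, a.1 = u → a.2 ≠ 0 → (b.2 < 4 ↔ a.2 < 4) → t ⊆ N := by
        intro t ht a ha hau ha0 hab x hx
        by_cases hxa : a = x
        · subst hxa
          exact mem_product.2 ⟨mem_singleton.2 hau, mem_filter.2 ⟨mem_univ _, .inr hab⟩⟩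
        · have := mem_of_gadget_adj ha0 ((hT t ht).1 ha hx hxa)
          exact mem_product.2 ⟨mem_singleton.2 (this.1.trans hau),
            mem_filter.2 ⟨mem_univ _, this.2.imp id hab.trans⟩⟩
      have htN := hsub t ht b hb hbu.symm hb0 Iff.rfl
      obtain ⟨a, haN, hat⟩ : ∃ a ∈ N, a ∉ t := by
        by_contra! hcon
        have := card_le_card (show N ⊆ t from hcon)
        rw [(hT t ht).2] at this
        omega
      obtain ⟨hau, ha2⟩ := mem_product.1 haN
      have hau : a.1 = u := by simpa using hau
      have ha0 : a.2 ≠ 0 := fun h0 => hat (by rwa [show a = (u, 0) from Prod.ext hau h0])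
      obtain ⟨t', ht', hat'⟩ := hmem a (by simp [hau, huW])
      have htN' := hsub t' ht' a hat' hau ha0 ((mem_filter.1 ha2).2.resolve_left ha0)
      have hdis : Disjoint t t' := hd ht ht' fun he => hat (he ▸ hat')
      have := card_le_card (union_subset htN htN')
      rw [card_union_of_disjoint hdis, (hT t ht).2, (hT t' ht').2] at this
      omega
    refine ⟨T.filter fun t => ∃ u, (u, 0) ∈ t, fun t ht => hT t (mem_filter.1 ht).1,
      hd.subset (coe_subset.2 (filter_subset _ _)), ?_⟩
    rw [hbase]
    ext ⟨u, c⟩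
    simp only [mem_biUnion, mem_filter, id, mem_product, mem_singleton]
    constructor
    · rintro ⟨t, ⟨ht, u', hu'⟩, hx⟩
      refine ⟨?_, hzero t ht u' hu' _ hx⟩
      have : ((u, c) : Fin n × Fin 7) ∈ W ×ˢ univ := hU ▸ subset_biUnion_of_mem id ht hx
      simpa using this
    · rintro ⟨hu, rfl⟩
      obtain ⟨t, ht, hut⟩ := hmem (u, 0) (by simp [hu])
      exact ⟨t, ⟨ht, u, hut⟩, hut⟩
  · intro hW
    have h := hW.union (tiles_product_attached W) (by
      rw [hbase]
      exact disjoint_product.2 (.inr (by decide)))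
    rw [hbase, ← product_union] at h
    exact h

/-- The copies `1`, `0`, `4` of a vertex form an induced path, so they cannot all lie in the rest,
whose components are complete. Different vertices thus need different members of `C`. -/
theorem card_le_of_isTwinCover {V : Type*} {W : Finset (Fin n)} (e : V ↪ Fin n × Fin 7)
    (he : ∀ a, a ∈ Set.range e ↔ a.1 ∈ W) {C : Finset V}
    (hC : IsTwinCover ((gadget G).comap e) (C : Set V)) : #W ≤ #C := by
  refine (card_le_card (fun u hu => ?_ : W ⊆ C.image fun i => (e i).1)).trans card_image_le
  by_contra hcon
  have hex : ∀ c, ∃ i, e i = (u, c) := fun c => (he (u, c)).2 hu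
  have hnot : ∀ c i, e i = (u, c) → i ∉ C := fun c i hi hiC =>
    hcon (mem_image.2 ⟨i, hiC, by rw [hi]⟩)
  obtain ⟨i, hi⟩ := hex 0
  obtain ⟨j, hj⟩ := hex 1
  obtain ⟨k, hk⟩ := hex 4
  let i' : ((C : Set V)ᶜ : Set V) := ⟨i, by simpa using hnot 0 i hi⟩
  let j' : ((C : Set V)ᶜ : Set V) := ⟨j, by simpa using hnot 1 j hj⟩
  let k' : ((C : Set V)ᶜ : Set V) := ⟨k, by simpa using hnot 4 k hk⟩
  have h1 : (((gadget G).comap e).induce (C : Set V)ᶜ).Adj j' i' := by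
    change (gadget G).Adj (e j) (e i)
    rw [hi, hj]
    exact .inr ⟨rfl, (by decide : Side 1 0)⟩
  have h2 : (((gadget G).comap e).induce (C : Set V)ᶜ).Adj i' k' := by
    change (gadget G).Adj (e i) (e k)
    rw [hi, hk]
    exact .inr ⟨rfl, (by decide : Side 0 4)⟩
  have h3 := hC.1 j' k' (h1.reachable.trans h2.reachable) (fun h => by
    have : j = k := congrArg Subtype.val h
    rw [this, hk] at hj
    exact absurd (Prod.mk.inj hj).2 (by decide : ¬ (4 : Fin 7) = 1))
  change (gadget G).Adj (e j) (e k) at h3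
  rw [hj, hk] at h3
  rcases h3 with ⟨h, -⟩ | ⟨-, h⟩
  · exact absurd h (by decide : ¬ (1 : Fin 7) = 0)
  · exact absurd h (by decide : ¬ Side 1 4)

/-- Without the copies `0` only parts of attached triangles remain, and each of these sees just its
own copy `0`, if that is present. -/
theorem isTwinCover_base {V : Type*} (e : V ↪ Fin n × Fin 7) :
    IsTwinCover ((gadget G).comap e) {i | (e i).2 = 0} := by
  set C : Set V := {i | (e i).2 = 0} with hC
  have hadj : ∀ i j : (Cᶜ : Set V), (((gadget G).comap e).induce Cᶜ).Adj i j →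
      (e i).1 = (e j).1 ∧ ((e i).2 < 4 ↔ (e j).2 < 4) := by
    intro i j hij
    have hi : (e i).2 ≠ 0 := i.2
    have hj : (e j).2 ≠ 0 := j.2
    have := mem_of_gadget_adj hi (show (gadget G).Adj (e i) (e j) from hij)
    exact ⟨this.1.symm, this.2.resolve_left hj⟩
  have hreach : ∀ i j : (Cᶜ : Set V), (((gadget G).comap e).induce Cᶜ).Reachable i j →
      (e i).1 = (e j).1 ∧ ((e i).2 < 4 ↔ (e j).2 < 4) := by
    rintro i j ⟨p⟩
    induction p with
    | nil => exact ⟨rfl, Iff.rfl⟩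
    | cons h _ ih => exact ⟨(hadj _ _ h).1.trans ih.1, (hadj _ _ h).2.trans ih.2⟩
  refine ⟨fun i j hij hne => ?_, fun i j hij => ?_⟩
  · obtain ⟨h1, h2⟩ := hreach i j hij
    refine show (gadget G).Adj (e i) (e j) from .inr ⟨h1, fun h => hne ?_, .inr (.inr h2)⟩
    exact Subtype.ext (e.injective (Prod.ext h1 h))
  · obtain ⟨h1, h2⟩ := hreach i j hij
    have key : ∀ (i : (Cᶜ : Set V)) (s : V), s ∈ C →
        ((gadget G).Adj (e i) (e s) ↔ (e i).1 = (e s).1) := by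
      intro i s hs
      have hi : (e i).2 ≠ 0 := i.2
      refine ⟨fun h => (mem_of_gadget_adj hi h).1.symm, fun h => .inr ⟨h, ?_, .inr (.inl hs)⟩⟩
      intro h'
      exact hi (h'.trans hs)
    ext s
    refine and_congr_left fun hs => ?_
    change (gadget G).Adj (e i) (e s) ↔ (gadget G).Adj (e j) (e s)
    rw [key i s hs, key j s hs, h1]

theorem twinCoverNumber_gadget {V : Type*} [Fintype V] {W : Finset (Fin n)}
    (e : V ↪ Fin n × Fin 7) (he : ∀ a, a ∈ Set.range e ↔ a.1 ∈ W) :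
    twinCoverNumber ((gadget G).comap e) = #W := by
  apply le_antisymm
  · refine Nat.sInf_le ⟨univ.filter fun i => (e i).2 = 0, ?_, by simpa using isTwinCover_base e⟩
    refine card_bij (fun i _ => (e i).1) (fun i _ => (he _).1 ⟨i, rfl⟩) (fun i hi j hj hij => ?_)
      fun u hu => ?_
    · exact e.injective (Prod.ext hij ((mem_filter.1 hi).2.trans (mem_filter.1 hj).2.symm))
    · obtain ⟨i, hi⟩ := (he (u, 0)).2 hu
      exact ⟨i, by simp [hi], by rw [hi]⟩
  · obtain ⟨C, hC, htc⟩ := exists_twinCover_card_eq ((gadget G).comap e)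
    exact (card_le_of_isTwinCover e he htc).trans hC.le

end TriangleKernel


/-! ### The kernel -/

namespace TriangleKernel

open Finset

open scoped Classical

section Kernel

variable {n : ℕ} (G : SimpleGraph (Fin n))

/-- The vertices that are not removed. -/
noncomputable def kept : Finset (Fin n) := univ \ removed G (cover G)

/-- The vertices of the kernel: seven copies of every kept vertex. -/
noncomputable def copies : List (Fin n × Fin 7) :=
  ((List.finRange n).filter fun u => u ∈ kept G).flatMap fun u => (List.finRange 7).map (u, ·)

variable {G}

theorem mem_copies {a : Fin n × Fin 7} : a ∈ copies G ↔ a.1 ∈ kept G := by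
  simp only [copies, List.mem_flatMap, List.mem_filter, List.mem_finRange, true_and,
    decide_eq_true_eq, List.mem_map]
  constructor
  · rintro ⟨u, hu, c, rfl⟩
    exact hu
  · exact fun h => ⟨a.1, h, a.2, rfl⟩

theorem nodup_copies : (copies G).Nodup := by
  refine List.nodup_flatMap.2 ⟨fun u _ => (List.nodup_finRange 7).map fun c d h =>
    (Prod.mk.inj h).2, ?_⟩
  refine ((List.nodup_finRange n).filter _).imp fun {u v} huv => ?_
  rw [Function.onFun, List.disjoint_left]
  intro a ha hb
  obtain ⟨c, -, rfl⟩ := List.mem_map.1 ha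
  obtain ⟨d, -, hd⟩ := List.mem_map.1 hb
  exact huv (Prod.mk.inj hd).1.symm

theorem length_copies : (copies G).length = 7 * #(kept G) := by
  have h : (copies G).toFinset = kept G ×ˢ univ := by
    ext a
    simp [mem_copies]
  rw [← List.toFinset_card_of_nodup nodup_copies, h, card_product, card_univ, Fintype.card_fin,
    Nat.mul_comm]

/-- The copies as vertices of the gadget graph. -/
noncomputable def getCopy : Fin (copies G).length ↪ Fin n × Fin 7 :=
  ⟨(copies G).get, List.nodup_iff_injective_get.1 nodup_copies⟩

theorem mem_range_getCopy (a : Fin n × Fin 7) : a ∈ Set.range (getCopy (G := G)) ↔ a.1 ∈ kept G := by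
  rw [← mem_copies, List.mem_iff_get]
  rfl

theorem map_getCopy : univ.map (getCopy (G := G)) = kept G ×ˢ univ := by
  ext a
  have := mem_range_getCopy (G := G) a
  simpa using this

theorem card_kept_le : #(kept G) ≤ #(cover G) +
    (#(cover G) + 1) ^ 6 * (3 * (2 * ((2 * #(cover G) + 6) * ((2 * #(cover G) + 6) + 3)))) :=
  card_compl_removed_le coversNontwins_cover

end Kernel

/-- The number sought in the kernel: the number of its vertices if the input asks for the number of
its vertices, and a different number otherwise. -/
noncomputable def target (x : GraphInput) : ℕ := 7 * #(kept x.G) + if x.k = x.n then 0 else 1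

/-- The kernel of an input. -/
noncomputable def kernel (x : GraphInput) : GraphInput :=
  ⟨(copies x.G).length, (gadget x.G).comap getCopy, target x⟩

theorem yes_kernel_iff (x : GraphInput) :
    HasTrianglePartition x.G x.k ↔ HasTrianglePartition (kernel x).G (kernel x).k := by
  rw [hasTrianglePartition_iff, hasTrianglePartition_iff]
  refine and_congr ?_ ?_
  · simp only [Fintype.card_fin]
    change x.k = x.n ↔ target x = (copies x.G).length
    rw [length_copies, target]
    split <;> simp_all
  · change _ ↔ Tiles ((gadget x.G).comap getCopy) univ
    rw [← tiles_map, map_getCopy, tiles_gadget_iff]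
    exact (removable_removed coversNontwins_cover).tiles_iff coversNontwins_cover

theorem twinCoverNumber_kernel (x : GraphInput) : twinCoverNumber (kernel x).G = #(kept x.G) :=
  twinCoverNumber_gadget getCopy mem_range_getCopy

/-- The binary code starts with the lowest digit, so it lists the values of `testBit` in order;
programs read and write numbers digit by digit in this form. -/
theorem encodePosNum_eq (p : PosNum) :
    Computability.encodePosNum p = (List.range (Nat.size (p : ℕ))).map (p : ℕ).testBit := by
  induction p with
  | one => simp [Computability.encodePosNum]
  | bit0 p ih =>
    have h : ((PosNum.bit0 p : PosNum) : ℕ) = Nat.bit false p := by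
      simp [PosNum.cast_bit0]; omega
    have h0 : Nat.bit false (p : ℕ) ≠ 0 := by
      have := PosNum.cast_pos (α := ℕ) p
      simp; omega
    rw [h, Nat.size_bit h0, List.range_succ_eq_map, Computability.encodePosNum, ih]
    simp [Function.comp_def, Nat.testBit_succ]
  | bit1 p ih =>
    have h : ((PosNum.bit1 p : PosNum) : ℕ) = Nat.bit true p := by
      simp [PosNum.cast_bit1]; omega
    have h0 : Nat.bit true (p : ℕ) ≠ 0 := by simp
    have h2 : (2 * (p : ℕ) + 1) / 2 = p := by omega
    rw [h, Nat.size_bit h0, List.range_succ_eq_map, Computability.encodePosNum, ih]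
    simp [Function.comp_def, Nat.testBit_succ, h2]

theorem encodeNat_eq (k : ℕ) :
    Computability.encodeNat k = (List.range (Nat.size k)).map k.testBit := by
  have h : ((k : Num) : ℕ) = k := Num.to_of_nat k
  unfold Computability.encodeNat
  rcases hk : (k : Num) with _ | p
  · rw [hk] at h
    rw [← h]
    simp [Computability.encodeNum]
  · rw [hk] at h
    simp only [Computability.encodeNum]
    rw [encodePosNum_eq, show (p : ℕ) = k from h]

theorem length_encode (x : GraphInput) :
    x.encode.length = x.n * (x.n + 1) + Nat.size x.k := by
  simp [GraphInput.encode, GraphInput.encodeRow, List.length_flatMap, encodeNat_eq]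

/-- A bound for the size of the kernel. -/
noncomputable def kernelBound : Polynomial ℕ :=
  let c : Polynomial ℕ := .X * .X + .X
  let s : Polynomial ℕ := c + (c + 1) ^ 6 * (3 * (2 * ((2 * c + 6) * ((2 * c + 6) + 3))))
  -- Here `c` bounds the cover and `s` the kept vertices. The summands are the matrix with its
  -- separators, the digits of the number sought, and the parameter in unary.
  7 * s * (7 * s + 1) + (7 * s + 1) + s

theorem length_encodeInstance_kernel (x : GraphInput) :
    (trianglePartitionTC.encodeInstance (kernel x)).length ≤
      kernelBound.eval (twinCoverNumber x.G) := by
  have h1 : (trianglePartitionTC.encodeInstance (kernel x)).length =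
      (kernel x).encode.length + #(kept x.G) := by
    rw [← twinCoverNumber_kernel]
    change ((kernel x).encode.map some ++ List.replicate (twinCoverNumber (kernel x).G) none).length = _
    rw [List.length_append, List.length_map, List.length_replicate]
  have h2 : Nat.size (kernel x).k ≤ 7 * #(kept x.G) + 1 := by
    refine (Nat.size_le.2 Nat.lt_two_pow_self).trans ?_
    change target x ≤ _
    unfold target
    split <;> omega
  have h3 := card_kept_le (G := x.G)
  have h4 := card_cover_le (G := x.G)
  rw [h1, length_encode]
  change (copies x.G).length * ((copies x.G).length + 1) + _ + _ ≤ _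
  rw [length_copies]
  simp only [kernelBound, Polynomial.eval_add, Polynomial.eval_mul, Polynomial.eval_pow,
    Polynomial.eval_X, Polynomial.eval_ofNat, Polynomial.eval_one]
  set c := twinCoverNumber x.G * twinCoverNumber x.G + twinCoverNumber x.G
  have h5 : #(kept x.G) ≤ c + (c + 1) ^ 6 * (3 * (2 * ((2 * c + 6) * ((2 * c + 6) + 3)))) :=
    h3.trans (by gcongr)
  refine Nat.add_le_add (Nat.add_le_add ?_ (h2.trans ?_)) h5 <;> gcongr

theorem flatMap_encodeRow_comap {V : Type*} (G : SimpleGraph V) (l : List V)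
    (e : Fin l.length ↪ V) (he : ∀ i, e i = l.get i) :
    (List.finRange l.length).flatMap (GraphInput.encodeRow (G.comap e)) =
      l.flatMap fun a => l.map (fun b => some (decide (G.Adj a b))) ++ [none] := by
  conv_rhs => rw [← List.map_get_finRange l, List.flatMap_map]
  refine congrArg (fun f => List.flatMap f _) (funext fun i => ?_)
  rw [GraphInput.encodeRow, List.map_map]
  simp [Function.comp_def, he]

theorem encode_kernel (x : GraphInput) : (kernel x).encode =
    ((copies x.G).flatMap fun a => (copies x.G).map (fun b => some (decide ((gadget x.G).Adj a b))) ++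
      [none]) ++ (List.range (Nat.size (target x))).map fun j => some ((target x).testBit j) := by
  rw [GraphInput.encode, encodeNat_eq, List.map_map]
  exact congrArg (· ++ _) (flatMap_encodeRow_comap _ _ _ fun _ => rfl)

end TriangleKernel


/-! ### Expressions that compute the kernel -/

namespace StackLang.Expr

open Function Finset

open scoped Classical

/-- An expression is true when its value is not zero. -/
def Holds (w : List Sym) (env : ℕ → ℕ) (e : Expr) : Prop := e.eval w env ≠ 0

/-- Negation. -/
def not (e : Expr) : Expr := .sub (.const 1) e

/-- Conjunction. -/
def and (a b : Expr) : Expr := .mul a b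

/-- Disjunction. -/
def or (a b : Expr) : Expr := .add a b

/-- Equivalence. -/
def iff (a b : Expr) : Expr := ((a.not).or b).and ((b.not).or a)

/-- Strict inequality. -/
def lt (a b : Expr) : Expr := .sub b a

/-- Inequality. -/
def le (a b : Expr) : Expr := (lt b a).not

/-- Equality. -/
def eq (a b : Expr) : Expr := (le a b).and (le b a)

/-- The number of values of a variable below a bound for which an expression is true. -/
def count (x : ℕ) (b e : Expr) : Expr := .sum x b e.not.not

/-- The existence of such a value. -/
def ex (x : ℕ) (b e : Expr) : Expr := .sum x b e

/-- A bit of the value of an expression. -/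
def testBit (e j : Expr) : Expr := lt (.mul (.const 2) (.shr e (.add j (.const 1)))) (.shr e j)

/-- The number of binary digits of the value of an expression, where the variable `x` does not
occur. -/
def size (x : ℕ) (e : Expr) : Expr := count x e (.shr e (.var x))

variable {w : List Sym} {env : ℕ → ℕ} {a b e : Expr} {x : ℕ}

theorem holds_not : Holds w env e.not ↔ ¬ Holds w env e := by
  simp only [Holds, not, eval]
  omega

theorem holds_and : Holds w env (a.and b) ↔ Holds w env a ∧ Holds w env b := by
  simp [Holds, and, eval]

theorem holds_or : Holds w env (a.or b) ↔ Holds w env a ∨ Holds w env b := by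
  simp only [Holds, or, eval]
  omega

theorem holds_iff : Holds w env (a.iff b) ↔ (Holds w env a ↔ Holds w env b) := by
  rw [iff, holds_and, holds_or, holds_or, holds_not, holds_not]
  tauto

theorem holds_lt : Holds w env (lt a b) ↔ a.eval w env < b.eval w env := by
  simp only [Holds, lt, eval]
  omega

theorem holds_le : Holds w env (le a b) ↔ a.eval w env ≤ b.eval w env := by
  rw [le, holds_not, holds_lt, not_lt]

theorem holds_eq : Holds w env (eq a b) ↔ a.eval w env = b.eval w env := by
  rw [eq, holds_and, holds_le, holds_le, le_antisymm_iff]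

theorem holds_bit {s : Sym} : Holds w env (.bit s e) ↔ w[e.eval w env]? = some s := by
  simp [Holds, eval]

theorem holds_ex : Holds w env (ex x b e) ↔
    ∃ i < b.eval w env, Holds w (update env x i) e := by
  simp [Holds, ex, eval]

/-- The double negation in `count` turns every nonzero value into one. -/
theorem eval_count : (count x b e).eval w env =
    #((range (b.eval w env)).filter fun i => Holds w (update env x i) e) := by
  rw [card_filter]
  refine sum_congr rfl fun i _ => ?_
  simp only [not, eval]
  by_cases h : Holds w (update env x i) e
  · rw [if_pos h]
    unfold Holds at h
    omega
  · rw [if_neg h]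
    unfold Holds at h
    omega

/-- The digit is one exactly if the shifted number is odd, that is, larger than twice its half. -/
theorem holds_testBit {j : Expr} :
    Holds w env (testBit e j) ↔ (e.eval w env).testBit (j.eval w env) = true := by
  rw [testBit, holds_lt, Nat.testBit_eq_decide_div_mod_eq, decide_eq_true_eq]
  simp only [eval, pow_succ, ← Nat.div_div_eq_div_mul]
  omega

/-- A position `i` is below the binary length of `m` exactly if `2 ^ i ≤ m`; this implies `i < m`,
so searching the positions below `m` suffices. -/
theorem eval_size (h : ∀ i, e.eval w (update env x i) = e.eval w env) :
    (size x e).eval w env = Nat.size (e.eval w env) := by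
  rw [size, eval_count, ← card_range (Nat.size (e.eval w env))]
  congr 1
  ext i
  simp only [Holds, eval, h, update_self, mem_filter, mem_range]
  rw [Nat.lt_size, ← Nat.pos_iff_ne_zero, Nat.div_pos_iff]
  exact ⟨fun h => h.2.2, fun h => ⟨Nat.lt_two_pow_self.trans_le h, by positivity, h⟩⟩

end StackLang.Expr


/-! ### Expressions for the vertices of the kernel -/

namespace StackLang.Expr

open Function Finset TriangleKernel

open scoped Classical

/-- The number of vertices of the input graph. -/
def order : Expr := .sum 0 .len (.bit none (.var 0))

/-- The existence of a vertex. -/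
def exVertex (v : ℕ) (e : Expr) : Expr := ex v order e

/-- The number of vertices with a property. -/
def countVertex (v : ℕ) (e : Expr) : Expr := count v order e

/-- Adjacency. -/
def adj (u v : ℕ) : Expr :=
  .bit (some true) (.add (.mul (.var u) (.add order (.const 1))) (.var v))

/-- Equality of variables. -/
def same (u v : ℕ) : Expr := eq (.var u) (.var v)

/-- Strict inequality of variables. -/
def less (u v : ℕ) : Expr := lt (.var u) (.var v)

/-- The relation `Nontwin`. -/
def nontwin (u v : ℕ) : Expr :=
  -- This index exceeds both `u` and `v`, so the bound variable captures neither; the later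
  -- expressions choose their variables in the same way.
  let c := u + v + 1
  (adj u v).and (exVertex c (((same c u).not.and (same c v).not).and ((adj u c).iff (adj v c)).not))

/-- The number `ntDegree`. -/
def ntDegree (v : ℕ) : Expr := countVertex (v + 1) (nontwin v (v + 1))

/-- Membership in `coverAt`. -/
def inCoverAt (t v : ℕ) : Expr :=
  let c := t + v + 1
  (lt (.var t) (ntDegree v)).or (exVertex c ((nontwin v c).and (le (ntDegree c) (.var t))))

/-- The property `Good`. -/
def good (t : ℕ) : Expr :=
  le (countVertex (t + 1) (inCoverAt t (t + 1))) (.add (.mul (.var t) (.var t)) (.var t))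

/-- Membership in `cover`. -/
def inCover (v : ℕ) : Expr :=
  let t := v + 1
  ex t (.add order (.const 1))
    (((good t).and (ex (t + 1) (.var t) (good (t + 1))).not).and (inCoverAt t v))

/-- Membership in a class. -/
def inCls (u v : ℕ) : Expr := (inCover u).not.and ((same u v).or (adj u v))

/-- The size of a class. -/
def cardCls (v : ℕ) : Expr := countVertex (v + 1) (inCls (v + 1) v)

/-- The function `rank`. -/
def rank (v : ℕ) : Expr := countVertex (v + 1) ((inCls (v + 1) v).and (less (v + 1) v))

/-- The function `bound`. -/
def bound : Expr := .add (.mul (.const 2) (countVertex 0 (inCover 0))) (.const 6)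

/-- The property `IsRep`. -/
def isRep (v : ℕ) : Expr :=
  (inCover v).not.and (exVertex (v + 1) ((inCls (v + 1) v).and (less (v + 1) v))).not

/-- The property `Sees` for `k` variables from `m` on. -/
def sees (m v : ℕ) : ℕ → Expr
  | 0 => .const 1
  | k + 1 => ((inCover m).not.or (adj m v)).and (sees (m + 1) v k)

/-- The existence of `k` vertices, as values of the variables from `m` on. -/
def exVertices (m : ℕ) (e : Expr) : ℕ → Expr
  | 0 => e
  | k + 1 => exVertex m (exVertices (m + 1) e k)

/-- The property `SameType`. -/
def sameType (u v : ℕ) : Expr :=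
  let q := u + v + 1
  (ex q (.add order (.const 1))
    ((eq (cardCls u) (.add (cardCls v) (.mul (.const 3) (.var q)))).or
      (eq (cardCls v) (.add (cardCls u) (.mul (.const 3) (.var q)))))).and
  ((lt (cardCls u) (.const 6)).iff (lt (cardCls v) (.const 6)))

/-- The size of `earlier`, with the six vertices as values of the variables from `m` on. -/
def cardEarlier (r m : ℕ) : Expr :=
  -- The six vertices occupy the variables `m` to `m + 5`, and this one lies beyond them.
  let u := r + m + 6
  countVertex u (((less u r).and (isRep u)).and ((sameType u r).and (sees m u 6)))

/-- The property `Marked`. -/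
def marked (v : ℕ) : Expr :=
  let r := v + 1
  exVertex r (((inCls r v).and (isRep r)).and
    (exVertices (v + 2) ((sees (v + 2) r 6).and (lt (cardEarlier r (v + 2)) bound)) 6))

/-- Membership in `removed`. -/
def inRemoved (v : ℕ) : Expr :=
  let q := .mul (.const 3) (.var (v + 1))
  (inCover v).not.and ((marked v).not.or (ex (v + 1) (.add order (.const 1))
    ((lt (rank v) q).and (le (.add q bound) (cardCls v)))))

/-- Membership in `kept`. -/
def inKept (v : ℕ) : Expr := (inRemoved v).not

theorem sum_range_getElem? {α : Type*} [BEq α] [LawfulBEq α] [DecidableEq α] (a : α) (l : List α) :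
    ∑ i ∈ range l.length, (if l[i]? = some a then 1 else 0) = l.count a := by
  induction l with
  | nil => simp
  | cons b l ih =>
    rw [List.length_cons, sum_range_succ', List.count_cons]
    simp only [List.getElem?_cons_succ, List.getElem?_cons_zero, ih, Option.some.injEq, beq_iff_eq]

variable {x : GraphInput} {env : ℕ → ℕ}

/-- Each row of the matrix ends with exactly one separator, and the binary part has none, so
counting separators gives the number of vertices. -/
theorem eval_order : order.eval x.encode env = x.n := by
  refine Eq.trans ?_ x.count_encode
  convert sum_range_getElem? none x.encode using 1
  simp only [order, eval, update_self]

theorem holds_exVertex {v : ℕ} {e : Expr} : Holds x.encode env (exVertex v e) ↔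
    ∃ u : Fin x.n, Holds x.encode (update env v u) e := by
  rw [exVertex, holds_ex, eval_order]
  exact ⟨fun ⟨i, hi, h⟩ => ⟨⟨i, hi⟩, h⟩, fun ⟨u, h⟩ => ⟨u, u.2, h⟩⟩

theorem eval_countVertex {v : ℕ} {e : Expr} {A : Finset (Fin x.n)}
    (h : ∀ u : Fin x.n, Holds x.encode (update env v u) e ↔ u ∈ A) :
    (countVertex v e).eval x.encode env = #A := by
  rw [countVertex, eval_count, eval_order]
  refine (card_bij (fun u _ => u.1) (fun u hu => ?_) (fun u _ v _ huv => Fin.ext huv)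
    fun i hi => ?_).symm
  · exact mem_filter.2 ⟨mem_range.2 u.2, (h u).2 hu⟩
  · obtain ⟨hi, hi'⟩ := mem_filter.1 hi
    exact ⟨⟨i, mem_range.1 hi⟩, (h _).1 hi', rfl⟩

theorem getElem?_flatMap_finRange {α : Type*} {n m : ℕ} (f : Fin n → List α)
    (hf : ∀ i, (f i).length = m) (l : List α) (u : Fin n) {j : ℕ} (hj : j < m) :
    ((List.finRange n).flatMap f ++ l)[u * m + j]? = (f u)[j]? := by
  induction n generalizing l with
  | zero => exact u.elim0
  | succ n ih =>
    rw [List.finRange_succ, List.flatMap_cons, List.flatMap_map, List.append_assoc]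
    refine Fin.cases ?_ (fun u => ?_) u
    · rw [List.getElem?_append_left (by simp [hf, hj])]
      simp
    · rw [List.getElem?_append_right (by simp [hf, Nat.add_mul]; omega), hf]
      rw [← ih (fun i => f i.succ) (fun i => hf _) l u]
      congr 1
      simp [Nat.add_mul]
      omega

theorem getElem?_encode (u v : Fin x.n) :
    x.encode[u * (x.n + 1) + v.1]? = some (some (decide (x.G.Adj u v))) := by
  rw [GraphInput.encode, getElem?_flatMap_finRange _ (by simp [GraphInput.encodeRow]) _ _ (by omega),
    GraphInput.encodeRow, List.getElem?_append_left (by simp)]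
  simp

variable {u v r : Fin x.n} {a b : ℕ}

theorem holds_adj (hu : env a = u) (hv : env b = v) :
    Holds x.encode env (adj a b) ↔ x.G.Adj u v := by
  rw [adj, holds_bit]
  simp only [eval, eval_order, hu, hv, getElem?_encode]
  simp

theorem holds_same (hu : env a = u) (hv : env b = v) :
    Holds x.encode env (same a b) ↔ u = v := by
  rw [same, holds_eq, eval, eval, hu, hv, Fin.ext_iff]

theorem holds_less (hu : env a = u) (hv : env b = v) :
    Holds x.encode env (less a b) ↔ u < v := by
  rw [less, holds_lt, eval, eval, hu, hv, Fin.lt_def]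

theorem update_ne {c i j : ℕ} (h : a ≠ c) (ha : env a = i) : update env c j a = i := by
  rw [update_of_ne h, ha]

theorem holds_nontwin (hu : env a = u) (hv : env b = v) :
    Holds x.encode env (nontwin a b) ↔ Nontwin x.G u v := by
  rw [nontwin, holds_and, holds_adj hu hv, holds_exVertex]
  refine and_congr_right fun _ => exists_congr fun c => ?_
  have hu' := update_ne (j := c) (c := a + b + 1) (by omega) hu
  have hv' := update_ne (j := c) (c := a + b + 1) (by omega) hv
  have hc := update_self (a + b + 1) c.1 env
  rw [holds_and, holds_and, holds_not, holds_not, holds_not, holds_iff, holds_same hc hu',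
    holds_same hc hv', holds_adj hu' hc, holds_adj hv' hc, and_assoc]

theorem eval_ntDegree (hv : env b = v) :
    (ntDegree b).eval x.encode env = TriangleKernel.ntDegree x.G v :=
  eval_countVertex fun c => by
    rw [holds_nontwin (update_ne (by omega) hv) (update_self ..), mem_filter]
    simp

theorem holds_inCoverAt {t : ℕ} (ht : env a = t) (hv : env b = v) :
    Holds x.encode env (inCoverAt a b) ↔ v ∈ coverAt x.G t := by
  rw [inCoverAt, holds_or, holds_exVertex, holds_lt, eval_ntDegree hv, eval, ht]
  simp only [coverAt, mem_filter, mem_univ, true_and]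
  refine or_congr Iff.rfl (exists_congr fun c => ?_)
  rw [holds_and, holds_le, holds_nontwin (update_ne (by omega) hv) (update_self ..),
    eval_ntDegree (update_self ..), eval, update_ne (by omega) ht]

theorem holds_good {t : ℕ} (ht : env a = t) :
    Holds x.encode env (good a) ↔ Good x.G t := by
  rw [good, holds_le, Good, eval_countVertex fun c =>
    holds_inCoverAt (update_ne (by omega) ht) (update_self ..)]
  simp [eval, ht]

theorem threshold_le : threshold x.G ≤ x.n := by
  refine Nat.find_min' _ ?_
  simpa using good_card (G := x.G) (C := univ) fun u _ _ => .inl (mem_univ u)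

/-- The minimum in `threshold` is expressed by asking for a good number with no good number below
it; `threshold_le` confines the search. -/
theorem holds_inCover (hv : env b = v) :
    Holds x.encode env (inCover b) ↔ v ∈ cover x.G := by
  rw [inCover, holds_ex]
  have key : ∀ t : ℕ, Holds x.encode (update env (b + 1) t) (((good (b + 1)).and
      (ex (b + 1 + 1) (.var (b + 1)) (good (b + 1 + 1))).not).and (inCoverAt (b + 1) b)) ↔
      t = threshold x.G ∧ v ∈ coverAt x.G t := by
    intro t
    rw [holds_and, holds_and, holds_not, holds_good (update_self ..), holds_ex, eval, update_self,
      holds_inCoverAt (update_self ..) (update_ne (by omega) hv), eq_comm (a := t), threshold,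
      Nat.find_eq_iff]
    simp only [holds_good (update_self ..), not_exists, not_and]
  simp only [key, eval, eval_order]
  constructor
  · rintro ⟨t, -, rfl, h⟩
    exact h
  · exact fun h => ⟨_, Nat.lt_succ_of_le threshold_le, rfl, h⟩

theorem holds_inCls (hu : env a = u) (hv : env b = v) :
    Holds x.encode env (inCls a b) ↔ u ∈ cls x.G (cover x.G) v := by
  rw [inCls, holds_and, holds_not, holds_or, holds_inCover hu, holds_same hu hv, holds_adj hu hv,
    mem_cls]

theorem eval_cardCls (hv : env b = v) :
    (cardCls b).eval x.encode env = #(cls x.G (cover x.G) v) := by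
  rw [cardCls, eval_countVertex fun c => holds_inCls (update_self ..) (update_ne (by omega) hv)]

theorem eval_rank (hv : env b = v) :
    (rank b).eval x.encode env = TriangleKernel.rank x.G (cover x.G) v := by
  refine eval_countVertex fun c => ?_
  rw [holds_and, holds_inCls (update_self ..) (update_ne (by omega) hv),
    holds_less (update_self ..) (update_ne (by omega) hv), mem_filter]

theorem eval_bound : bound.eval x.encode env = TriangleKernel.bound (cover x.G) := by
  simp only [bound, eval]
  rw [eval_countVertex fun c => holds_inCover (update_self ..)]
  rfl

theorem holds_isRep (hv : env b = v) :
    Holds x.encode env (isRep b) ↔ IsRep x.G (cover x.G) v := by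
  rw [isRep, holds_and, holds_not, holds_not, holds_inCover hv, holds_exVertex, IsRep, not_exists]
  refine and_congr_right fun _ => forall_congr' fun c => ?_
  rw [holds_and, holds_inCls (update_self ..) (update_ne (by omega) hv),
      holds_less (update_self ..) (update_ne (by omega) hv), not_and]

theorem holds_sees (hv : env b = v) {k : ℕ} {m : ℕ} {y : Fin k → Fin x.n}
    (hy : ∀ i : Fin k, env (m + i) = y i) :
    Holds x.encode env (sees m b k) ↔ ∀ i, y i ∈ cover x.G → x.G.Adj (y i) v := by
  induction k generalizing m with
  | zero => simp [sees, Holds, eval]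
  | succ k ih =>
    have h0 : env m = y 0 := hy 0
    rw [sees, holds_and, holds_or, holds_not, holds_inCover h0, holds_adj h0 hv,
      ih (y := fun i => y i.succ) (fun i => by rw [← hy, Fin.val_succ]; congr 1; omega),
      Fin.forall_fin_succ, imp_iff_not_or]

/-- The assignment in which the variables from `m` on have the values `y`. -/
def assign (env : ℕ → ℕ) (m : ℕ) {n k : ℕ} (y : Fin k → Fin n) : ℕ → ℕ := fun i =>
  if h : m ≤ i ∧ i < m + k then y ⟨i - m, by omega⟩ else env i

theorem assign_add {m n k : ℕ} (y : Fin k → Fin n) (i : Fin k) : assign env m y (m + i) = y i := by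
  rw [assign, dif_pos ⟨by omega, by omega⟩]
  simp

theorem assign_of_lt {m n k : ℕ} (y : Fin k → Fin n) {i : ℕ} (hi : i < m) :
    assign env m y i = env i := dif_neg (by omega)

theorem holds_exVertices {e : Expr} {m k : ℕ} : Holds x.encode env (exVertices m e k) ↔
    ∃ y : Fin k → Fin x.n, Holds x.encode (assign env m y) e := by
  induction k generalizing m env with
  | zero =>
    have : ∀ y : Fin 0 → Fin x.n, assign env m y = env := fun y => funext fun i => dif_neg (by omega)
    simp [exVertices, this]
  | succ k ih =>
    rw [exVertices, holds_exVertex, Fin.exists_fin_succ_pi]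
    refine exists_congr fun u => ?_
    rw [ih]
    refine exists_congr fun y => iff_of_eq ?_
    congr 1
    funext i
    unfold assign
    rcases lt_trichotomy i m with h | rfl | h
    · rw [dif_neg (by omega), dif_neg (by omega), update_of_ne (by omega)]
    · rw [dif_neg (by omega), dif_pos (by omega), update_self]
      simp
    · by_cases h' : i < m + (k + 1)
      · rw [dif_pos (by omega), dif_pos (by omega)]
        rw [show (⟨i - m, by omega⟩ : Fin (k + 1)) = Fin.succ ⟨i - (m + 1), by omega⟩ from
          Fin.ext (by simp; omega), Fin.cons_succ]
      · rw [dif_neg (by omega), dif_neg (by omega), update_of_ne (by omega)]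

/-- Congruence modulo three is tested by searching for the quotient of the difference, in either
direction; classes have at most `x.n` vertices, so the quotient is in range. -/
theorem holds_sameType (hu : env a = u) (hv : env b = v) :
    Holds x.encode env (sameType a b) ↔ SameType x.G (cover x.G) u v := by
  have key : ∀ q : ℕ, Holds x.encode (update env (a + b + 1) q)
      ((eq (cardCls a) (.add (cardCls b) (.mul (.const 3) (.var (a + b + 1))))).or
      (eq (cardCls b) (.add (cardCls a) (.mul (.const 3) (.var (a + b + 1)))))) ↔
      (#(cls x.G (cover x.G) u) = #(cls x.G (cover x.G) v) + 3 * q ∨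
      #(cls x.G (cover x.G) v) = #(cls x.G (cover x.G) u) + 3 * q) := by
    intro q
    rw [holds_or, holds_eq, holds_eq]
    simp only [eval]
    rw [eval_cardCls (update_ne (by omega) hu), eval_cardCls (update_ne (by omega) hv), update_self]
  rw [sameType, holds_and, holds_iff, holds_lt, holds_lt, eval_cardCls hu, eval_cardCls hv, eval,
    holds_ex]
  refine and_congr ?_ Iff.rfl
  simp only [key, eval, eval_order]
  have h1 := (card_le_univ (cls x.G (cover x.G) u)).trans_eq (Fintype.card_fin _)
  have h2 := (card_le_univ (cls x.G (cover x.G) v)).trans_eq (Fintype.card_fin _)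
  unfold Nat.ModEq
  constructor
  · rintro ⟨q, -, hq | hq⟩ <;> omega
  · intro h
    rcases le_total #(cls x.G (cover x.G) u) #(cls x.G (cover x.G) v) with hle | hle
    · exact ⟨(#(cls x.G (cover x.G) v) - #(cls x.G (cover x.G) u)) / 3, by omega, .inr (by omega)⟩
    · exact ⟨(#(cls x.G (cover x.G) u) - #(cls x.G (cover x.G) v)) / 3, by omega, .inl (by omega)⟩

theorem eval_cardEarlier (hr : env a = r) {m : ℕ} {y : Fin 6 → Fin x.n}
    (hy : ∀ i : Fin 6, env (m + i) = y i) :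
    (cardEarlier a m).eval x.encode env = #(earlier x.G (cover x.G) r y) := by
  refine eval_countVertex fun c => ?_
  have hc := update_self (a + m + 6) c.1 env
  have hr' := update_ne (c := a + m + 6) (j := c) (by omega) hr
  rw [holds_and, holds_and, holds_and, holds_less hc hr', holds_isRep hc, holds_sameType hc hr',
    holds_sees hc fun i => update_ne (by omega) (hy i), and_assoc, earlier, mem_filter]
  simp [Sees]

theorem holds_marked (hv : env b = v) :
    Holds x.encode env (marked b) ↔ Marked x.G (cover x.G) v := by
  rw [marked, holds_exVertex]
  refine exists_congr fun r => ?_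
  have hr := update_self (b + 1) r.1 env
  rw [holds_and, holds_and, holds_inCls hr (update_ne (by omega) hv), holds_isRep hr,
    holds_exVertices, and_assoc]
  refine and_congr_right fun _ => and_congr_right fun _ => exists_congr fun y => ?_
  have hr' := (assign_of_lt (env := update env (b + 1) r) y (m := b + 2)
    (i := b + 1) (by omega)).trans hr
  rw [holds_and, holds_lt, holds_sees hr' (assign_add y), eval_cardEarlier hr' (assign_add y),
    eval_bound]
  rfl

theorem holds_inRemoved (hv : env b = v) :
    Holds x.encode env (inRemoved b) ↔ v ∈ removed x.G (cover x.G) := by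
  have key : ∀ q : ℕ, Holds x.encode (update env (b + 1) q)
      ((lt (rank b) (.mul (.const 3) (.var (b + 1)))).and
        (le (.add (.mul (.const 3) (.var (b + 1))) bound) (cardCls b))) ↔
      TriangleKernel.rank x.G (cover x.G) v < 3 * q ∧
        3 * q + TriangleKernel.bound (cover x.G) ≤ #(cls x.G (cover x.G) v) := by
    intro q
    rw [holds_and, holds_lt, holds_le, eval_rank (update_ne (by omega) hv),
      eval_cardCls (update_ne (by omega) hv)]
    simp only [eval, eval_bound, update_self]
  rw [inRemoved, holds_and, holds_not, holds_inCover hv, holds_or, holds_not, holds_marked hv,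
    holds_ex, removed, mem_filter]
  simp only [key, eval, eval_order, mem_univ, true_and]
  refine and_congr_right fun _ => or_congr Iff.rfl ?_
  have h1 := (card_le_univ (cls x.G (cover x.G) v)).trans_eq (Fintype.card_fin _)
  constructor
  · rintro ⟨q, -, h⟩
    exact ⟨q, h⟩
  · rintro ⟨q, h⟩
    exact ⟨q, by omega, h⟩

theorem holds_inKept (hv : env b = v) :
    Holds x.encode env (inKept b) ↔ v ∈ kept x.G := by
  rw [inKept, holds_not, holds_inRemoved hv, kept, mem_sdiff]
  simp

end StackLang.Expr


/-! ### A program that writes the kernel -/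

namespace StackLang

open Function Finset TriangleKernel

open scoped Classical

namespace Expr

/-- The number sought equals the number of vertices of the input graph. -/
def isOrder : Expr :=
  let m := .mul order (.add order (.const 1))
  (eq .len (.add m (size 0 order))).and
    (ex 0 (size 1 order) ((Expr.bit (some true) (.add m (.var 0))).iff
      (testBit order (.var 0))).not).not

/-- The number `target`. -/
def target : Expr :=
  .add (.mul (.const 7) (countVertex 0 (inKept 0))) isOrder.not

/-- The relation `Side`. -/
def side (c d : ℕ) : Expr :=
  (same c d).not.and ((eq (.var c) (.const 0)).or ((eq (.var d) (.const 0)).or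
    ((lt (.var c) (.const 4)).iff (lt (.var d) (.const 4)))))

/-- Adjacency of copies. -/
def gadgetAdj (u c v d : ℕ) : Expr :=
  (((eq (.var c) (.const 0)).and (eq (.var d) (.const 0))).and (adj u v)).or
    ((same u v).and (side c d))

variable {x : GraphInput} {env : ℕ → ℕ}

theorem getElem?_encode_binary {j : ℕ} (hj : j < Nat.size x.k) :
    x.encode[x.n * (x.n + 1) + j]? = some (some (x.k.testBit j)) := by
  have h : ((List.finRange x.n).flatMap (GraphInput.encodeRow x.G)).length = x.n * (x.n + 1) := by
    simp [List.length_flatMap, GraphInput.encodeRow]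
  rw [GraphInput.encode, List.getElem?_append_right (by omega), h, encodeNat_eq]
  simp [hj]

/-- The number `k` may be exponential in the length of the input and must not be put on a stack in
unary. The total length reveals the number of its digits, and these are then compared one by one
with those of the order. -/
theorem holds_isOrder : Holds x.encode env isOrder ↔ x.k = x.n := by
  have hs : ∀ i, (size i order).eval x.encode env = Nat.size x.n := fun i => by
    rw [eval_size fun _ => by rw [eval_order, eval_order], eval_order]
  rw [isOrder, holds_and, holds_eq, holds_not, holds_ex, hs]
  simp only [holds_not, holds_iff, holds_bit, holds_testBit, eval, eval_order, update_self, hs,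
    length_encode, not_exists, not_and, not_not]
  constructor
  · rintro ⟨h1, h2⟩
    have h1 : Nat.size x.k = Nat.size x.n := by omega
    rw [← Computability.decode_encodeNat x.k, ← Computability.decode_encodeNat x.n, encodeNat_eq,
      encodeNat_eq, h1]
    congr 1
    refine List.map_congr_left fun j hj => ?_
    have hj := List.mem_range.1 hj
    have := h2 j hj
    rw [getElem?_encode_binary (h1 ▸ hj)] at this
    rw [Option.some_inj, Option.some_inj] at this
    exact Bool.eq_iff_iff.2 this
  · intro h
    refine ⟨by rw [h], fun j hj => ?_⟩
    have := getElem?_encode_binary (x := x) (h ▸ hj)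
    rw [h] at this
    rw [this, Option.some_inj, Option.some_inj]

theorem eval_card_kept :
    (countVertex 0 (inKept 0)).eval x.encode env = #(kept x.G) :=
  eval_countVertex fun _ => holds_inKept (update_self ..)

theorem eval_target : target.eval x.encode env = TriangleKernel.target x := by
  have h := holds_isOrder (x := x) (env := env)
  simp only [target, not, eval, eval_card_kept, TriangleKernel.target]
  unfold Holds at h
  split <;> simp_all
  omega

theorem holds_side {a b : ℕ} {c d : Fin 7} (hc : env a = c) (hd : env b = d) :
    Holds x.encode env (side a b) ↔ Side c d := by
  rw [side, holds_and, holds_not, same, holds_or, holds_or, holds_iff, holds_eq, holds_eq, holds_eq,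
    holds_lt, holds_lt]
  simp only [eval, hc, hd, Side, ne_eq, Fin.ext_iff, Fin.lt_def]
  rfl

theorem holds_gadgetAdj {a b a' b' : ℕ} {y z : Fin x.n × Fin 7} (hu : env a = y.1)
    (hc : env b = y.2) (hv : env a' = z.1) (hd : env b' = z.2) :
    Holds x.encode env (gadgetAdj a b a' b') ↔ (gadget x.G).Adj y z := by
  rw [gadgetAdj, holds_or, holds_and, holds_and, holds_and, holds_side hc hd, holds_same hu hv,
    holds_adj hu hv, holds_eq, holds_eq, gadget_adj, and_assoc]
  simp only [eval, hc, hd, Fin.ext_iff]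
  rfl

end Expr

namespace Writer

open StackLang.Expr

/-- Writes under a condition; the variable `x` becomes zero. -/
def guard {B : Type} (x : ℕ) (e : Expr) (p : Writer B) : Writer B := .rep x e.not.not p

/-- Writes the truth value of an expression. -/
def truth (e : Expr) : Writer (Option Sym) :=
  .seq (guard 4 e (.emit (some (some true)))) (guard 4 e.not (.emit (some (some false))))

/-- Writes for every vertex of the kernel, where `a` and `b` are the vertex and the number of its
copy. -/
def repCopies {B : Type} (a b : ℕ) (p : Writer B) : Writer B :=
  .rep a order (guard 4 (inKept a) (.rep b (.const 7) p))

/-- Writes the kernel and its parameter. -/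
def kernel : Writer (Option Sym) :=
  .seq (.seq (repCopies 0 1 (.seq (repCopies 2 3 (truth (gadgetAdj 0 1 2 3))) (.emit (some none))))
    (.rep 0 (size 0 Expr.target) (truth (testBit Expr.target (.var 0)))))
    (.rep 0 (countVertex 0 (inKept 0)) (.emit none))

/-- A conditional is a loop with a bound of zero or one; in its only round the loop variable is
zero. -/
theorem word_guard {B : Type} {w : List Sym} {env : ℕ → ℕ} {x : ℕ} {e : Expr} {p : Writer B} :
    (guard x e p).word w env = if Holds w env e then p.word w (update env x 0) else [] := by
  rw [guard, word]
  split
  · rename_i h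
    have : e.not.not.eval w env = 1 := by
      unfold Holds at h
      simp only [Expr.not, Expr.eval]
      omega
    simp [this]
  · rename_i h
    have : e.not.not.eval w env = 0 := by
      unfold Holds at h
      simp only [Expr.not, Expr.eval]
      omega
    simp [this]

theorem word_truth {w : List Sym} {env : ℕ → ℕ} {e : Expr} :
    (truth e).word w env = [some (some (decide (Holds w env e)))] := by
  rw [truth, word, word_guard, word_guard, holds_not]
  by_cases h : Holds w env e <;> simp [h, word]

theorem flatMap_range_eq {B : Type} (n : ℕ) (f : ℕ → List B) :
    (List.range n).flatMap f = (List.finRange n).flatMap fun u : Fin n => f u.1 := by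
  rw [← List.map_coe_finRange_eq_range, List.flatMap_map]

theorem flatMap_ite_nil {α B : Type} (P : α → Prop) [DecidablePred P] (f : α → List B) (l : List α) :
    (l.flatMap fun u => if P u then f u else []) = (l.filter fun u => P u).flatMap f := by
  induction l with
  | nil => rfl
  | cons a l ih =>
    by_cases h : P a <;> simp [h, ih]

variable {x : GraphInput} {env : ℕ → ℕ}

/-- The update of variable `4` is the trace of the guard; the copies themselves are held in the
variables `0` to `3`. -/
theorem word_repCopies {B : Type} {a b : ℕ} {p : Writer B} :
    (repCopies a b p).word x.encode env = (copies x.G).flatMap fun y =>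
      p.word x.encode (update (update (update env a y.1) 4 0) b y.2) := by
  rw [repCopies, word, eval_order, flatMap_range_eq, copies, List.flatMap_assoc,
    ← flatMap_ite_nil (· ∈ kept x.G)]
  refine congrArg (fun f => List.flatMap f _) (funext fun u => ?_)
  rw [word_guard, if_congr (holds_inKept (update_self ..)) rfl rfl]
  congr 1

theorem flatMap_singleton_eq_map {α B : Type} (l : List α) (f : α → B) :
    (l.flatMap fun a => [f a]) = l.map f := by
  induction l <;> simp_all

theorem word_row (y : Fin x.n × Fin 7) (h0 : env 0 = y.1) (h1 : env 1 = y.2) :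
    (repCopies 2 3 (truth (gadgetAdj 0 1 2 3))).word x.encode env =
      (copies x.G).map fun z => some (some (decide ((gadget x.G).Adj y z))) := by
  rw [word_repCopies, ← flatMap_singleton_eq_map]
  refine congrArg (fun f => List.flatMap f _) (funext fun z => ?_)
  rw [word_truth, decide_eq_decide.2 (holds_gadgetAdj (y := y) (z := z) ?_ ?_ ?_ ?_)]
  · rw [update_ne (by decide) (update_ne (by decide) (update_ne (by decide) h0))]
  · rw [update_ne (by decide) (update_ne (by decide) (update_ne (by decide) h1))]
  · rw [update_ne (by decide) (update_ne (by decide) (update_self ..))]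
  · rw [update_self]

theorem word_rows :
    (repCopies 0 1 (.seq (repCopies 2 3 (truth (gadgetAdj 0 1 2 3))) (.emit (some none)))).word
      x.encode env = ((copies x.G).flatMap fun y =>
        (copies x.G).map (fun z => some (decide ((gadget x.G).Adj y z))) ++ [none]).map some := by
  rw [word_repCopies, List.map_flatMap]
  refine congrArg (fun f => List.flatMap f _) (funext fun y => ?_)
  rw [word, word_row y, List.map_append, List.map_map, word]
  · rfl
  · rw [update_ne (by decide) (update_ne (by decide) (update_self ..))]
  · rw [update_self]

theorem word_binary :
    (Writer.rep 0 (size 0 Expr.target) (truth (testBit Expr.target (.var 0)))).word x.encode env =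
      ((List.range (Nat.size (TriangleKernel.target x))).map fun j =>
        some ((TriangleKernel.target x).testBit j)).map some := by
  rw [word, eval_size (fun _ => by rw [eval_target, eval_target]), eval_target, List.map_map,
    ← flatMap_singleton_eq_map]
  refine congrArg (fun f => List.flatMap f _) (funext fun j => ?_)
  have h := holds_testBit (w := x.encode) (env := update env 0 j) (e := Expr.target) (j := .var 0)
  rw [eval_target, Expr.eval, update_self] at h
  rw [word_truth, decide_eq_decide.2 h, Bool.decide_eq_true]
  · rfl
  · infer_instance

theorem word_param :
    (Writer.rep 0 (countVertex 0 (inKept 0)) (.emit none)).word x.encode env =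
      List.replicate #(kept x.G) (none : Option Sym) := by
  rw [word, eval_card_kept]
  simp only [word, flatMap_singleton_eq_map, List.map_const', List.length_range]

theorem word_kernel : kernel.word x.encode (fun _ => 0) =
    trianglePartitionTC.encodeInstance (TriangleKernel.kernel x) := by
  have h : trianglePartitionTC.encodeInstance (TriangleKernel.kernel x) =
      (TriangleKernel.kernel x).encode.map some ++ List.replicate #(kept x.G) none := by
    rw [← twinCoverNumber_kernel]
    rfl
  rw [kernel, word, word, word_rows, word_binary, word_param, ← List.map_append, ← encode_kernel]
  exact h.symm

end Writer

end StackLang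

/-- Triangle Partition parameterized by the twin-cover number has a polynomial kernel. -/
theorem mainTheorem1 : trianglePartitionTC.HasPolynomialKernel :=
  ⟨TriangleKernel.kernel, TriangleKernel.kernelBound,
    StackLang.Writer.computableInPolyTime _ _ _ StackLang.Writer.kernel fun _ =>
      StackLang.Writer.word_kernel,
    fun x => ⟨TriangleKernel.yes_kernel_iff x, TriangleKernel.length_encodeInstance_kernel x⟩⟩
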